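/- **Liouville billiard tables of classical type.** Let $\omega_1,\omega_2,N>0$, let $\varphi_1,\varphi_2\in C^\infty(\mathbb R)$ and $\varphi_3\in C^\infty([-N,N])$ be real-valued and suppose: (A1) each $\varphi_k$ is even; $\varphi_1(\theta_1)\ge\varphi_2(\theta_2)\ge0\ge\varphi_3(\theta_3)$ for all arguments; $\varphi_k$ is $\omega_k$-periodic for $k=1,2$; $\varphi_2(\theta_2)=\varphi_2(\omega_2/2-\theta_2)$; (A2) $\nu_1:=\min\varphi_1=\max\varphi_2>\nu_2:=\min\varphi_2=\max\varphi_3=0$; for $k=1,2$, $\varphi_k(\theta_k)=\nu_k$ iff $\theta_k\in\frac{\omega_k}{2}\mathbb Z$; $\varphi_2(\theta_2)=\nu_1$ iff $\theta_2\in\frac{\omega_2}{4}+\frac{\omega_2}{2}\mathbb Z$; $\varphi_3(\theta_3)=0$ iff $\theta_3=0$; (A3) $\varphi_k''(0)=\varphi_k''(\omega_k/2)>0$ for $k=1,2$, and for all $l\ge0$: $\varphi_1^{(2l)}(0)=\varphi_1^{(2l)}(\omega_1/2)$, $\varphi_1^{(2l)}(0)=(-1)^l\varphi_2^{(2l)}(\omega_2/4)$,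 $\varphi_2^{(2l)}(0)=(-1)^l\varphi_3^{(2l)}(0)$; (A4) $\varphi_1(\theta_1)=\varphi_1(\omega_1/2-\theta_1)$; (A5) $\varphi_k'>0$ on $(0,\omega_k/4)$ for $k=1,2$, and $\varphi_3'<0$ on $(0,N]$. (No analyticity is assumed.) Let $C=\mathbb R/\omega_1\mathbb Z\times\mathbb R/\omega_2\mathbb Z\times[-N,N]$ and let $\sigma:C\to X$ be the quotient by the group generated by the commuting involutions $\sigma_1(\theta)=(-\theta_1,\frac{\omega_2}{2}-\theta_2,\theta_3)$ and $\sigma_2(\theta)=(\theta_1,-\theta_2,-\theta_3)$, with fixed point sets $S_1,S_2$ and $S=S_1\cup S_2$. Put $\Pi_1=(\varphi_1-\varphi_2)(\varphi_1-\varphi_3)$, $\Pi_2=(\varphi_1-\varphi_2)(\varphi_2-\varphi_3)$, $\Pi_3=(\varphi_1-\varphi_3)(\varphi_2-\varphi_3)$. The 3-manifold with boundary $X$ has as charts the local coordinates $\theta$ away from $\sigma(S)$; the coordinates $(x_1^2-x_2^2,2x_1x_2,x_3)$, $x=\theta-\theta^0$, at $\theta^0\in S_1$; and $(x_1,x_2^2-x_3^2,2x_2x_3)$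 at $\theta^0\in S_2$. The Riemannian metric $g$ of $X$ is the smooth metric whose pull-back to $C$ is $\Pi_1d\theta_1^2+\Pi_2d\theta_2^2+\Pi_3d\theta_3^2$. The pair $(X,g)$ is a 3-dimensional Liouville billiard table of classical type; $\Gamma=\sigma(\{\theta_3=\pm N\})$ is its boundary. Let $G\cong(\mathbb Z/2)^3$ be the group of isometries of $X$ (acting also on $\Gamma$) induced by $\theta\mapsto(-\theta_1,\theta_2,\theta_3)$, $\theta\mapsto(\frac{\omega_1}{2}-\theta_1,\theta_2,\theta_3)$ and $\theta\mapsto(\theta_1,-\theta_2,\theta_3)$. **Billiard ball map and invariant tori.** Let $\Gamma^\circ=\Gamma\setminus\sigma(S)$ be $\Gamma$ without its finitely many branch points, let $\pi_\Gamma$ be the projection to the base point, and let $B^*\Gamma^\circ=\{\xi\in T^*\Gamma^\circ:\|\xi\|_g<1\}$. For $\xi\in B^*\Gamma^\circ$ let $\pi^+(\xi)$ be the unit covector with positive value on the inward unit normal $n_g$ whose restriction to $T\Gamma$ is $\xi$. The billiard ball map $B$ sends $\xi$ to $\xi'$ if the geodesic of $(X,g)$ with initial covector $\pi^+(\xi)$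 stays in the interior until it hits $\Gamma$ transversally, at a point where its covector restricts to $\xi'$. Let $$I_1=\frac{\varphi_2+\varphi_3}{\Pi_1}p_1^2+\frac{\varphi_1+\varphi_3}{\Pi_2}p_2^2+\frac{\varphi_1+\varphi_2}{\Pi_3}p_3^2,\qquad I_2=\frac{\varphi_2\varphi_3}{\Pi_1}p_1^2+\frac{\varphi_1\varphi_3}{\Pi_2}p_2^2+\frac{\varphi_1\varphi_2}{\Pi_3}p_3^2$$ be the quadratic integrals of the billiard flow and $F_j=I_j\circ\pi^+$. Let $\mathcal F$ be the set of invariant Liouville tori: the compact connected components $\Lambda$ of the level sets $\{F_1=c_1,F_2=c_2\}$ in $B^*\Gamma^\circ$ such that $dF_1\wedge dF_2\ne0$ at every point of $\Lambda$ and $B^m(\Lambda)\subseteq\Lambda$ for some $m\ge1$. For $\Lambda\in\mathcal F$ the Leray form $\lambda$ is the restriction to $\Lambda$ of any 2-form $\alpha$ with $\omega\wedge\omega=\alpha\wedge dF_1\wedge dF_2$ along $\Lambda$, where $\omega$ is the canonical symplectic form, and, for a continuous positive density $\mu$ and $K\in C(\Gamma,\mathbb R)$, $$\mathcal R_{K,\mu}(\Lambda)=\frac1{\lambda(\Lambda)}\int_\Lambda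 (K\circ\pi_\Gamma)\,\mu\,\lambda .$$ **Theorem.** Let $(X,g)$ be a 3-dimensional Liouville billiard table of classical type and let $\mu\equiv1$ or $\mu(\xi)=\langle\pi^+(\xi),n_g\rangle^{-1}$. If $K\in C(\Gamma,\mathbb R)$ is invariant under $G$ and $\mathcal R_{K,\mu}(\Lambda)=0$ for every $\Lambda\in\mathcal F$, then $K\equiv0$. -/

import Mathlib

open Set Filter Topology MeasureTheory
open scoped ContDiff

noncomputable section

/-- The data of a three-dimensional Liouville billiard table of classical type: the periods
`ω₁, ω₂`, the half-height `N` of the cylinder and the functions `φ₁, φ₂, φ₃`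
(`φ₃` matters only on `[-N, N]`), with their symmetry, extremum, compatibility and monotonicity
conditions. -/
structure ClassicalLBT where
  ω₁ : ℝ
  ω₂ : ℝ
  N : ℝ
  /-- the common value `min φ₁ = max φ₂` -/
  ν₁ : ℝ
  φ₁ : ℝ → ℝ
  φ₂ : ℝ → ℝ
  φ₃ : ℝ → ℝ
  ω₁_pos : 0 < ω₁
  ω₂_pos : 0 < ω₂
  N_pos : 0 < N
  smooth₁ : ContDiff ℝ ∞ φ₁
  smooth₂ : ContDiff ℝ ∞ φ₂
  smooth₃ : ContDiffOn ℝ ∞ φ₃ (Icc (-N) N)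
  -- parity, ordering, periodicity
  even₁ : ∀ t, φ₁ (-t) = φ₁ t
  even₂ : ∀ t, φ₂ (-t) = φ₂ t
  even₃ : ∀ t ∈ Icc (-N) N, φ₃ (-t) = φ₃ t
  le₂₁ : ∀ s t, φ₂ t ≤ φ₁ s
  nonneg₂ : ∀ t, 0 ≤ φ₂ t
  nonpos₃ : ∀ t ∈ Icc (-N) N, φ₃ t ≤ 0
  periodic₁ : Function.Periodic φ₁ ω₁
  periodic₂ : Function.Periodic φ₂ ω₂
  symm₂ : ∀ t, φ₂ (ω₂ / 2 - t) = φ₂ t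
  -- extremal values and where they are attained
  ν₁_pos : 0 < ν₁
  min₁ : IsLeast (range φ₁) ν₁
  max₂ : IsGreatest (range φ₂) ν₁
  min₂ : IsLeast (range φ₂) 0
  max₃ : IsGreatest (φ₃ '' Icc (-N) N) 0
  min₁_iff : ∀ t, φ₁ t = ν₁ ↔ ∃ k : ℤ, t = k * (ω₁ / 2)
  min₂_iff : ∀ t, φ₂ t = 0 ↔ ∃ k : ℤ, t = k * (ω₂ / 2)
  max₂_iff : ∀ t, φ₂ t = ν₁ ↔ ∃ k : ℤ, t = ω₂ / 4 + k * (ω₂ / 2)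
  max₃_iff : ∀ t ∈ Icc (-N) N, φ₃ t = 0 ↔ t = 0
  -- compatibility conditions
  nondeg₁ : iteratedDeriv 2 φ₁ 0 = iteratedDeriv 2 φ₁ (ω₁ / 2) ∧ 0 < iteratedDeriv 2 φ₁ 0
  nondeg₂ : iteratedDeriv 2 φ₂ 0 = iteratedDeriv 2 φ₂ (ω₂ / 2) ∧ 0 < iteratedDeriv 2 φ₂ 0
  compat₁₁ : ∀ l : ℕ, iteratedDeriv (2 * l) φ₁ 0 = iteratedDeriv (2 * l) φ₁ (ω₁ / 2)
  compat₁₂ : ∀ l : ℕ,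
    iteratedDeriv (2 * l) φ₁ 0 = (-1) ^ l * iteratedDeriv (2 * l) φ₂ (ω₂ / 4)
  compat₂₃ : ∀ l : ℕ,
    iteratedDeriv (2 * l) φ₂ 0 = (-1) ^ l * iteratedDeriv (2 * l) φ₃ 0
  -- conditions of classical type
  symm₁ : ∀ t, φ₁ t = φ₁ (ω₁ / 2 - t)
  deriv₁_pos : ∀ t ∈ Ioo 0 (ω₁ / 4), 0 < deriv φ₁ t
  deriv₂_pos : ∀ t ∈ Ioo 0 (ω₂ / 4), 0 < deriv φ₂ t
  deriv₃_neg : ∀ t ∈ Ioc 0 N, derivWithin φ₃ (Icc (-N) N) t < 0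

namespace ClassicalLBT

/-! ### Metric and integrals, as functions of the values `a = φ₁`, `b = φ₂`, `c = φ₃` -/

/-- `Π₁ = (φ₁ - φ₂)(φ₁ - φ₃)` -/
def Pi1 (a b c : ℝ) : ℝ := (a - b) * (a - c)

/-- `Π₂ = (φ₁ - φ₂)(φ₂ - φ₃)` -/
def Pi2 (a b c : ℝ) : ℝ := (a - b) * (b - c)

/-- `Π₃ = (φ₁ - φ₃)(φ₂ - φ₃)` -/
def Pi3 (a b c : ℝ) : ℝ := (a - c) * (b - c)

/-- The first quadratic integral `I₁` on the cotangent bundle of the cylinder. -/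
def int1 (a b c p₁ p₂ p₃ : ℝ) : ℝ :=
  (b + c) * p₁ ^ 2 / Pi1 a b c + (a + c) * p₂ ^ 2 / Pi2 a b c + (a + b) * p₃ ^ 2 / Pi3 a b c

/-- The second quadratic integral `I₂` on the cotangent bundle of the cylinder. -/
def int2 (a b c p₁ p₂ p₃ : ℝ) : ℝ :=
  (b * c) * p₁ ^ 2 / Pi1 a b c + (a * c) * p₂ ^ 2 / Pi2 a b c + (a * b) * p₃ ^ 2 / Pi3 a b c

/-- The squared norm of the covector `p₁ dθ₁ + p₂ dθ₂` tangent to a level of `θ₃`. -/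
def tangNormSq (a b c p₁ p₂ : ℝ) : ℝ := p₁ ^ 2 / Pi1 a b c + p₂ ^ 2 / Pi2 a b c

/-- The third momentum of the unit covector at `θ₃ = N` which points into the table and restricts
to `p₁ dθ₁ + p₂ dθ₂` on the boundary. -/
def inwardMomentum (a b c p₁ p₂ : ℝ) : ℝ :=
  -(√(Pi3 a b c) * √(1 - tangNormSq a b c p₁ p₂))

variable (T : ClassicalLBT)

/-! ### The cylinder, the table `X` and its boundary `Γ` -/

/-- The cylinder `C = (ℝ/ω₁ℤ) × (ℝ/ω₂ℤ) × [-N, N]`. -/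
abbrev Cyl : Type := AddCircle T.ω₁ × AddCircle T.ω₂ × Icc (-T.N) T.N

/-- The reflection of the interval `[-N, N]`. -/
def negIcc (s : Icc (-T.N) T.N) : Icc (-T.N) T.N :=
  ⟨-s.1, by have := s.2.1; have := s.2.2; constructor <;> linarith⟩

/-- The point `N` of `[-N, N]`. -/
def top : Icc (-T.N) T.N := ⟨T.N, by have := T.N_pos; constructor <;> linarith⟩

/-- `σ₁(θ₁, θ₂, θ₃) = (-θ₁, ω₂/2 - θ₂, θ₃)` -/
def inv₁ (p : T.Cyl) : T.Cyl := (-p.1, ((T.ω₂ / 2 : ℝ) : AddCircle T.ω₂) - p.2.1, p.2.2)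

/-- `σ₂(θ₁, θ₂, θ₃) = (θ₁, -θ₂, -θ₃)` -/
def inv₂ (p : T.Cyl) : T.Cyl := (p.1, -p.2.1, T.negIcc p.2.2)

/-- The topological space underlying the table: the quotient of the cylinder by the group
generated by the two commuting involutions. -/
abbrev X : Type := Quot (fun p q : T.Cyl => q = T.inv₁ p ∨ q = T.inv₂ p)

/-- The branched covering `σ : C → X`. -/
def proj (p : T.Cyl) : T.X := Quot.mk _ p

/-- The branch set `S₁`, fixed by `σ₁`. -/
def S₁ : Set T.Cyl := {p | T.inv₁ p = p}

/-- The branch set `S₂`, fixed by `σ₂`. -/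
def S₂ : Set T.Cyl := {p | T.inv₂ p = p}

/-- The branch set `S` of the covering (`σ₁ ∘ σ₂` has no fixed points). -/
def S : Set T.Cyl := T.S₁ ∪ T.S₂

/-- The boundary `Γ` of the table. -/
def Γ : Set T.X := T.proj '' {p | p.2.2.1 = T.N ∨ p.2.2.1 = -T.N}

/-! ### The isometry group `G` -/

lemma half_add_half (l : ℝ) : ((l / 2 : ℝ) : AddCircle l) + ((l / 2 : ℝ) : AddCircle l) = 0 := by
  rw [← AddCircle.coe_add, add_halves, AddCircle.coe_period]

lemma neg_half (l : ℝ) : -((l / 2 : ℝ) : AddCircle l) = ((l / 2 : ℝ) : AddCircle l) :=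
  neg_eq_of_add_eq_zero_left (half_add_half l)

/-- The isometry induced by `(θ₁, θ₂, θ₃) ↦ (-θ₁, θ₂, θ₃)`. -/
def iso₁ : T.X → T.X :=
  Quot.map (fun p => (-p.1, p.2.1, p.2.2)) (by
    rintro p q (rfl | rfl)
    · left; simp [inv₁]
    · right; simp [inv₂])

/-- The isometry induced by `(θ₁, θ₂, θ₃) ↦ (ω₁/2 - θ₁, θ₂, θ₃)`. -/
def iso₂ : T.X → T.X :=
  Quot.map (fun p => (((T.ω₁ / 2 : ℝ) : AddCircle T.ω₁) - p.1, p.2.1, p.2.2)) (by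
    rintro p q (rfl | rfl)
    · left
      simp only [inv₁, Prod.mk.injEq, and_true]
      rw [neg_sub, sub_neg_eq_add, sub_eq_add_neg, neg_half, add_comm]
    · right; simp [inv₂])

/-- The isometry induced by `(θ₁, θ₂, θ₃) ↦ (θ₁, -θ₂, θ₃)`. -/
def iso₃ : T.X → T.X :=
  Quot.map (fun p => (p.1, -p.2.1, p.2.2)) (by
    rintro p q (rfl | rfl)
    · left
      simp only [inv₁, Prod.mk.injEq, and_true, true_and]
      rw [neg_sub, sub_neg_eq_add, sub_eq_add_neg, neg_half, add_comm]
    · right; simp [inv₂])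

lemma iso₁_involutive : Function.Involutive T.iso₁ := by
  rintro ⟨p⟩; simp [iso₁, Quot.map]

lemma iso₂_involutive : Function.Involutive T.iso₂ := by
  rintro ⟨p⟩; simp [iso₂, Quot.map]

lemma iso₃_involutive : Function.Involutive T.iso₃ := by
  rintro ⟨p⟩; simp [iso₃, Quot.map]

/-- The group `G ≅ (ℤ/2)³` of isometries of the table. -/
def G : Subgroup (Equiv.Perm T.X) :=
  Subgroup.closure {T.iso₁_involutive.toPerm, T.iso₂_involutive.toPerm, T.iso₃_involutive.toPerm}

/-- Invariance of a function on `Γ` under the action of `G` on `Γ`. -/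
def IsInvariant (K : C(T.Γ, ℝ)) : Prop :=
  ∀ g ∈ T.G, ∀ x y : T.Γ, (y : T.X) = g x → K y = K x

/-! ### The phase space over the boundary -/

/-- `φ₁` on the circle -/
def circ₁ : AddCircle T.ω₁ → ℝ := T.periodic₁.lift

/-- `φ₂` on the circle -/
def circ₂ : AddCircle T.ω₂ → ℝ := T.periodic₂.lift

/-- `ν₃ = φ₃(N)` -/
def ν₃ : ℝ := T.φ₃ T.N

/-- The cotangent bundle of the torus `θ₃ = N`, with coordinates `(θ₁, θ₂, p₁, p₂)`. -/
abbrev CotTorus : Type := AddCircle T.ω₁ × AddCircle T.ω₂ × ℝ × ℝ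

/-- The cotangent lift of the involution `(θ₁, θ₂) ↦ (-θ₁, ω₂/2 - θ₂)`, whose quotient is `Γ`. -/
def invCot (u : T.CotTorus) : T.CotTorus :=
  (-u.1, ((T.ω₂ / 2 : ℝ) : AddCircle T.ω₂) - u.2.1, -u.2.2.1, -u.2.2.2)

/-- The quotient of the cotangent bundle of the torus by the lifted involution. Over the regular
part `Γ ∖ σ(S)` of the boundary it is the cotangent bundle of `Γ`; see `coball`. -/
abbrev Phase : Type := Quot (fun u v : T.CotTorus => v = T.invCot u)

/-- The canonical coordinates `(θ₁, θ₂, p₁, p₂)` on the phase space. -/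
def cover (u : Fin 4 → ℝ) : T.Phase :=
  Quot.mk _ ((u 0 : AddCircle T.ω₁), (u 1 : AddCircle T.ω₂), u 2, u 3)

lemma circ₁_neg (x : AddCircle T.ω₁) : T.circ₁ (-x) = T.circ₁ x := by
  induction x using QuotientAddGroup.induction_on with
  | H t => exact T.even₁ t

lemma circ₂_half (x : AddCircle T.ω₂) :
    T.circ₂ (((T.ω₂ / 2 : ℝ) : AddCircle T.ω₂) - x) = T.circ₂ x := by
  induction x using QuotientAddGroup.induction_on with
  | H t => exact T.symm₂ t

/-- A function of `φ₁, φ₂, φ₃, p₁, p₂` at `θ₃ = N`, even in the momenta, seen on the phase space. -/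
def onPhase (f : ℝ → ℝ → ℝ → ℝ → ℝ → ℝ) (hf : ∀ a b c p q, f a b c (-p) (-q) = f a b c p q) :
    T.Phase → ℝ :=
  Quot.lift (fun u => f (T.circ₁ u.1) (T.circ₂ u.2.1) T.ν₃ u.2.2.1 u.2.2.2) (by
    rintro u v rfl
    simp [invCot, circ₁_neg, circ₂_half, hf])

/-- The squared norm of a covector of `Γ`. -/
def normSq : T.Phase → ℝ := T.onPhase tangNormSq (by intros; simp [tangNormSq])

/-- The base point `π_Γ(ξ)`. -/
def base : T.Phase → T.Γ :=
  Quot.lift (fun u => ⟨T.proj (u.1, u.2.1, T.top), _, Or.inl rfl, rfl⟩) (by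
    rintro u v rfl
    exact Subtype.ext (Quot.sound (Or.inl rfl)))

/-- The open coball bundle of `Γ ∖ σ(S)`. -/
def coball : Set T.Phase := {ξ | (T.base ξ : T.X) ∉ T.proj '' T.S ∧ T.normSq ξ < 1}

/-- The pairing `⟨π⁺(ξ), n_g⟩` with the inward unit normal `n_g = -Π₃^{-1/2} ∂/∂θ₃`. -/
def normalPairing : T.Phase → ℝ :=
  T.onPhase (fun a b c p q => inwardMomentum a b c p q * (-(√(Pi3 a b c))⁻¹))
    (by intros; simp [inwardMomentum, tangNormSq])

/-- The integral `I₁ ∘ π⁺` of the billiard ball map. -/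
def F₁ : T.Phase → ℝ :=
  T.onPhase (fun a b c p q => int1 a b c p q (inwardMomentum a b c p q))
    (by intros; simp [int1, inwardMomentum, tangNormSq])

/-- The integral `I₂ ∘ π⁺` of the billiard ball map. -/
def F₂ : T.Phase → ℝ :=
  T.onPhase (fun a b c p q => int2 a b c p q (inwardMomentum a b c p q))
    (by intros; simp [int2, inwardMomentum, tangNormSq])

/-! ### Geodesics of the table and the billiard ball map -/

/-- The point of the cylinder with coordinates `θ`. -/
def pt (θ : Fin 3 → ℝ) (h : θ 2 ∈ Icc (-T.N) T.N) : T.Cyl :=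
  ((θ 0 : AddCircle T.ω₁), (θ 1 : AddCircle T.ω₂), ⟨θ 2, h⟩)

/-- `θ` are cylinder coordinates of some preimage of the point `x` of the table. -/
def Over (θ : Fin 3 → ℝ) (x : T.X) : Prop :=
  ∃ h : θ 2 ∈ Icc (-T.N) T.N, T.proj (T.pt θ h) = x

/-- The coefficients `Π₁, Π₂, Π₃` of the quadratic form `g` on the cylinder. -/
def coeff (θ : Fin 3 → ℝ) : Fin 3 → ℝ :=
  ![Pi1 (T.φ₁ (θ 0)) (T.φ₂ (θ 1)) (T.φ₃ (θ 2)),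
    Pi2 (T.φ₁ (θ 0)) (T.φ₂ (θ 1)) (T.φ₃ (θ 2)),
    Pi3 (T.φ₁ (θ 0)) (T.φ₂ (θ 1)) (T.φ₃ (θ 2))]

/-- The quadratic form `g = Π₁ dθ₁² + Π₂ dθ₂² + Π₃ dθ₃²` on the cylinder, degenerate on `S`. -/
def form (θ v w : Fin 3 → ℝ) : ℝ := ∑ k, T.coeff θ k * v k * w k

/-- The branch chart transverse to `S₁`. -/
def fold₁₂ (x : Fin 3 → ℝ) : Fin 3 → ℝ := ![x 0 ^ 2 - x 1 ^ 2, 2 * x 0 * x 1, x 2]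

/-- The branch chart transverse to `S₂`. -/
def fold₂₃ (x : Fin 3 → ℝ) : Fin 3 → ℝ := ![x 0, x 1 ^ 2 - x 2 ^ 2, 2 * x 1 * x 2]

/-- The charts of the differential structure of the interior of `X`: near the point `σ(θ₀)` the
coordinates of the point `σ(θ₀ + x)` are `Φ x`. -/
def IsChart (θ₀ : Fin 3 → ℝ) (Φ : (Fin 3 → ℝ) → Fin 3 → ℝ) : Prop :=
  θ₀ 2 ∈ Ioo (-T.N) T.N ∧ ∃ h : θ₀ 2 ∈ Icc (-T.N) T.N,
    (T.pt θ₀ h ∉ T.S ∧ Φ = id) ∨ (T.pt θ₀ h ∈ T.S₁ ∧ Φ = fold₁₂) ∨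
      (T.pt θ₀ h ∈ T.S₂ ∧ Φ = fold₂₃)

/-- `M` is the push-forward of `g` in the chart `Φ` at `θ₀`: the smooth metric whose pull-back
by `Φ` is `g`. -/
def IsChartMetric (θ₀ : Fin 3 → ℝ) (Φ : (Fin 3 → ℝ) → Fin 3 → ℝ)
    (M : (Fin 3 → ℝ) → (Fin 3 → ℝ) →L[ℝ] (Fin 3 → ℝ) →L[ℝ] ℝ) : Prop :=
  ContDiffAt ℝ ∞ M (Φ 0) ∧
    ∀ᶠ x in 𝓝 (0 : Fin 3 → ℝ), ∀ v w : Fin 3 → ℝ,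
      M (Φ x) (fderiv ℝ Φ x v) (fderiv ℝ Φ x w) = T.form (θ₀ + x) v w

/-- Near the time `t₀` the curve `c` is a geodesic in the interior of `(X, σ_* g)`: in a chart
centred at `c t₀` it solves the Euler-Lagrange equations of the energy. -/
def IsGeodesicAt (c : ℝ → T.X) (t₀ : ℝ) : Prop :=
  ∃ (θ₀ : Fin 3 → ℝ) (Φ : (Fin 3 → ℝ) → Fin 3 → ℝ)
    (M : (Fin 3 → ℝ) → (Fin 3 → ℝ) →L[ℝ] (Fin 3 → ℝ) →L[ℝ] ℝ) (y v : ℝ → Fin 3 → ℝ),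
    T.IsChart θ₀ Φ ∧ T.IsChartMetric θ₀ Φ M ∧ y t₀ = Φ 0 ∧
    ∀ᶠ t in 𝓝 t₀, (∃ x, Φ x = y t ∧ T.Over (θ₀ + x) (c t)) ∧ HasDerivAt y (v t) t ∧
      ∀ w, HasDerivAt (fun s => M (y s) (v s) w)
        (fderiv ℝ (fun z => M z (v t) (v t)) (y t) w / 2) t

/-- Along the one-sided neighbourhood `l` of the time `t₀`, the curve `c` ends at the boundary
point with coordinates `(u 0, u 1, N)` and its covector `(Πₖ θₖ')ₖ` there is
`(u 2, u 3, p₃)`. -/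
def HasBoundaryCovector (c : ℝ → T.X) (t₀ : ℝ) (l : Filter ℝ) (u : Fin 4 → ℝ) (p₃ : ℝ) : Prop :=
  T.Over ![u 0, u 1, T.N] (c t₀) ∧ ∃ θ v : ℝ → Fin 3 → ℝ,
    (∀ᶠ t in l, T.Over (θ t) (c t) ∧ HasDerivAt θ (v t) t) ∧
    Tendsto θ l (𝓝 ![u 0, u 1, T.N]) ∧
    Tendsto (fun t k => T.coeff (θ t) k * v t k) l (𝓝 ![u 2, u 3, p₃])

/-- The third momentum of `π⁺(ξ)`, where `ξ` has coordinates `u`. -/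
def piPlus₃ (u : Fin 4 → ℝ) : ℝ :=
  inwardMomentum (T.φ₁ (u 0)) (T.φ₂ (u 1)) T.ν₃ (u 2) (u 3)

/-- The graph of the billiard ball map `B`: the geodesic with initial covector `π⁺(ξ)` runs in
the interior of `X` until it hits `Γ` transversally, and after reflection its covector is
`π⁺(ξ')`. -/
def BilliardStep (ξ ξ' : T.Phase) : Prop :=
  ξ ∈ T.coball ∧ ξ' ∈ T.coball ∧
  ∃ (u u' : Fin 4 → ℝ) (t₁ : ℝ) (c : ℝ → T.X),
    T.cover u = ξ ∧ T.cover u' = ξ' ∧ 0 < t₁ ∧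
    T.HasBoundaryCovector c 0 (𝓝[>] 0) u (T.piPlus₃ u) ∧
    (∀ t ∈ Ioo 0 t₁, T.IsGeodesicAt c t) ∧
    T.HasBoundaryCovector c t₁ (𝓝[<] t₁) u' (-T.piPlus₃ u')

/-- The graph of the iterate `B^m`. -/
def BilliardIter : ℕ → T.Phase → T.Phase → Prop
  | 0 => Eq
  | m + 1 => fun ξ ζ => ∃ η, BilliardIter m ξ η ∧ T.BilliardStep η ζ

/-! ### Invariant Liouville tori, Leray form and Radon transform -/

/-- The level set `{F₁ = c₁, F₂ = c₂}` in the coball bundle. -/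
def level (c₁ c₂ : ℝ) : Set T.Phase := {ξ ∈ T.coball | T.F₁ ξ = c₁ ∧ T.F₂ ξ = c₂}

/-- The canonical symplectic form `dp₁ ∧ dθ₁ + dp₂ ∧ dθ₂`. -/
def symp (v w : Fin 4 → ℝ) : ℝ := (v 2 * w 0 - w 2 * v 0) + (v 3 * w 1 - w 3 * v 1)

/-- The two-form `dF₁ ∧ dF₂`, in the coordinates of `cover`. -/
def dFdF (u v w : Fin 4 → ℝ) : ℝ :=
  fderiv ℝ (fun z => T.F₁ (T.cover z)) u v * fderiv ℝ (fun z => T.F₂ (T.cover z)) u w -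
    fderiv ℝ (fun z => T.F₁ (T.cover z)) u w * fderiv ℝ (fun z => T.F₂ (T.cover z)) u v

/-- The wedge product of two two-forms. -/
def wedge (α β : (Fin 4 → ℝ) → (Fin 4 → ℝ) → ℝ) (a b c d : Fin 4 → ℝ) : ℝ :=
  α a b * β c d - α a c * β b d + α a d * β b c +
    α b c * β a d - α b d * β a c + α c d * β a b

/-- The family `𝓕` of invariant Liouville tori: compact connected components of level sets of
`(F₁, F₂)`, at all of whose points `dF₁ ∧ dF₂ ≠ 0`, with `B^m(Λ) ⊆ Λ` for some `m ≥ 1`. -/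
def tori : Set (Set T.Phase) :=
  {Λ | (∃ c₁ c₂, ∃ ξ ∈ T.level c₁ c₂, Λ = connectedComponentIn (T.level c₁ c₂) ξ) ∧
    IsCompact Λ ∧
    (∀ u, T.cover u ∈ Λ → ∃ v w, T.dFdF u v w ≠ 0) ∧
    ∃ m : ℕ, 1 ≤ m ∧ ∀ ξ ∈ Λ, ∀ ζ, T.BilliardIter m ξ ζ → ζ ∈ Λ}

/-- `α` is a two-form along `Λ` with `ω ∧ ω = α ∧ dF₁ ∧ dF₂`. Its restriction to `Λ` is the
Leray form. -/
def IsLerayForm (Λ : Set T.Phase)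
    (α : (Fin 4 → ℝ) → (Fin 4 → ℝ) [⋀^Fin 2]→ₗ[ℝ] ℝ) : Prop :=
  ∀ u, T.cover u ∈ Λ → ∀ a b c d : Fin 4 → ℝ,
    wedge symp symp a b c d = wedge (fun v w => α u ![v, w]) (T.dFdF u) a b c d

/-- `lam` is the measure on `Λ` given by the volume form `α|_Λ`: in every smooth injective
regular parametrization `r` of a piece of `Λ` it has density `|α(∂₁r, ∂₂r)|`. -/
def IsVolumeOn (Λ : Set T.Phase) (α : (Fin 4 → ℝ) → (Fin 4 → ℝ) [⋀^Fin 2]→ₗ[ℝ] ℝ)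
    (lam : Measure T.Phase) : Prop :=
  lam Λᶜ = 0 ∧
  ∀ (U : Set (ℝ × ℝ)) (r : ℝ × ℝ → Fin 4 → ℝ), IsOpen U → ContDiffOn ℝ ∞ r U →
    (∀ s ∈ U, Function.Injective (fderiv ℝ r s)) → InjOn (fun s => T.cover (r s)) U →
    (∀ s ∈ U, T.cover (r s) ∈ Λ) →
    ∀ E ⊆ U, MeasurableSet E →
      lam ((fun s => T.cover (r s)) '' E) =
        ∫⁻ s in E, ENNReal.ofReal |α (r s) ![fderiv ℝ r s (1, 0), fderiv ℝ r s (0, 1)]|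

/-- `a` is the value at `Λ` of the Radon transform `R_{K,μ}`: the mean value of `(π_Γ^* K) μ` on
`Λ` with respect to the Leray form. -/
def HasRadonTransform (K : C(T.Γ, ℝ)) (μ : T.Phase → ℝ) (Λ : Set T.Phase) (a : ℝ) : Prop :=
  ∃ (α : (Fin 4 → ℝ) → (Fin 4 → ℝ) [⋀^Fin 2]→ₗ[ℝ] ℝ) (lam : Measure T.Phase),
    T.IsLerayForm Λ α ∧ T.IsVolumeOn Λ α lam ∧
    a = (lam Λ).toReal⁻¹ * ∫ ξ in Λ, K (T.base ξ) * μ ξ ∂lam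

end ClassicalLBT

end

/-! The integrals separate. With `quad c₁ c₂ x = x² - c₁ x + c₂`, a unit covector with `I₁ = c₁`,
`I₂ = c₂` satisfies `p₁² = quad (φ₁)`, `p₂² = -quad (φ₂)`, `p₃² = quad (φ₃)` (`separation`). Hence a
level set of `(F₁, F₂)` is cut out by the first two equations, and its shape depends only on the
signs of `quad` at `0`, at `ν₁` and at a few other values. If these signs are generic (`IsGeneric`),
the level is compact and regular, and its components are distinguished by the signs of `sin₂`, `p₁
cos₂` or `sin₁ p₂`, whichever cannot vanish on the level. Such signs, completed by `p₃` or `θ₃` to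
functions invariant under the deck group, persist along geodesics, also where the lift to the
cylinder is not unique. Thus `B²` preserves every component, and every component belongs to `𝓕`
(`IsGeneric.component_mem_tori`).

Over the base the Leray measure has density `(φ₁ - φ₂) / (2 |p₁| |p₂|)`. A torus is, up to a null
set, a finite union of pieces projecting to the same part of one fundamental cell of the symmetries,
and an invariant `K` takes the same values on all of them. The hypothesis therefore says that the
integral of `K` times a positive weight against this density vanishes for almost every relevant
`(c₁, c₂)` (`IsGeneric.integral_eq_zero`).

Multiply this by `(c₁ - 2ν₃)^i quad(ν₃)^j`, integrate over `(c₁, c₂)` and exchange the integrals.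
Over a fixed base point the polynomials `quad` run through those positive at `a = φ₁` and `n = ν₃`
and negative at `b = φ₂`. Lagrange interpolation at `a, b, n` identifies them with an open triangle
and turns the Leray density into a Dirichlet density, independent of the base point up to a positive
factor (`density_baryCoeff`). The test functions become sums of monomials in `a - n` and `b - n`
with positive symmetric coefficients (`integral_testFun`). An induction on these triangular
relations (`moment_add_swap_eq_zero`) shows that `H`, which is `K` times positive factors, is
orthogonal to all symmetric polynomials in `a - n` and `b - n`. Since `a ≥ b`, the elementary
symmetric functions still separate the points of the cell, and Stone-Weierstrass gives `H = 0`
(`eq_zero_of_moments`). No analyticity is needed, because almost every level is used rather than a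
family near one point. -/

noncomputable section

/-! ### Even periodic functions which are monotone on a quarter of the period -/

/-- The sign `±1` of a Boolean. -/
def sgn (b : Bool) : ℝ := if b then 1 else -1

@[simp] lemma sgn_true : sgn true = 1 := rfl
@[simp] lemma sgn_false : sgn false = -1 := rfl
@[simp] lemma sgn_mul_self (b : Bool) : sgn b * sgn b = 1 := by cases b <;> simp
@[simp] lemma sgn_sq (b : Bool) : sgn b ^ 2 = 1 := by cases b <;> simp
@[simp] lemma sgn_not (b : Bool) : sgn (!b) = -sgn b := by cases b <;> simp
@[simp] lemma abs_sgn (b : Bool) : |sgn b| = 1 := by cases b <;> simp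
lemma sgn_ne_zero (b : Bool) : sgn b ≠ 0 := by cases b <;> simp

/-- The image of a point of `[0, ℓ/4]` in the other quarters of the period. -/
def quarterPt (ℓ : ℝ) (s s' : Bool) (t : ℝ) : ℝ := sgn s * (if s' then t else ℓ / 2 - t)

/-- An even smooth `ℓ`-periodic function which is symmetric about `ℓ/4` and increases on the first
quarter of the period. -/
structure Profile (φ : ℝ → ℝ) (ℓ : ℝ) : Prop where
  pos : 0 < ℓ
  smooth : ContDiff ℝ ∞ φ
  even : ∀ t, φ (-t) = φ t
  periodic : Function.Periodic φ ℓ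
  symm : ∀ t, φ (ℓ / 2 - t) = φ t
  deriv_pos : ∀ t ∈ Ioo 0 (ℓ / 4), 0 < deriv φ t

lemma quarterPt_eq_affine (ℓ : ℝ) (s s' : Bool) :
    ∃ k, ∀ t, quarterPt ℓ s s' t = (sgn s * sgn s') * t + k := by
  refine ⟨sgn s * (if s' then 0 else ℓ / 2), fun t => ?_⟩
  cases s' <;> simp [quarterPt] ; ring

lemma continuous_quarterPt (ℓ : ℝ) (s s' : Bool) : Continuous (quarterPt ℓ s s') := by
  obtain ⟨k, hk⟩ := quarterPt_eq_affine ℓ s s'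
  rw [funext hk]; fun_prop

/-- Reduce modulo `ℓ` to `[-ℓ/2, ℓ/2]`; the sign of the remainder gives `s`, and the comparison of
its absolute value with `ℓ/4` gives `s'`. -/
lemma exists_quarterPt {ℓ : ℝ} (hℓ : 0 < ℓ) (θ : ℝ) :
    ∃ s s' : Bool, ∃ t ∈ Icc 0 (ℓ / 4), ∃ m : ℤ, θ = quarterPt ℓ s s' t + m * ℓ := by
  have h1 : ∃ r ∈ Icc (-(ℓ / 2)) (ℓ / 2), ∃ m : ℤ, θ = r + m * ℓ := by
    refine ⟨toIcoMod hℓ (-(ℓ / 2)) θ, ?_, toIcoDiv hℓ (-(ℓ / 2)) θ, ?_⟩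
    · have := toIcoMod_mem_Ico hℓ (-(ℓ / 2)) θ
      constructor <;> linarith [this.1, this.2]
    · have := toIcoMod_add_toIcoDiv_zsmul hℓ (-(ℓ / 2)) θ
      rw [zsmul_eq_mul] at this; exact this.symm
  obtain ⟨r, hr, m, rfl⟩ := h1
  rcases le_total 0 r with h0 | h0 <;> rcases le_total |r| (ℓ / 4) with h4 | h4
  · rw [abs_of_nonneg h0] at h4
    exact ⟨true, true, r, ⟨h0, h4⟩, m, by simp [quarterPt]⟩
  · rw [abs_of_nonneg h0] at h4
    exact ⟨true, false, ℓ / 2 - r, ⟨by linarith [hr.2], by linarith⟩, m, by simp [quarterPt]⟩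
  · rw [abs_of_nonpos h0] at h4
    exact ⟨false, true, -r, ⟨by linarith, h4⟩, m, by simp [quarterPt]⟩
  · rw [abs_of_nonpos h0] at h4
    exact ⟨false, false, ℓ / 2 + r, ⟨by linarith [hr.1], by linarith⟩, m, by simp [quarterPt]⟩

namespace Profile

variable {φ : ℝ → ℝ} {ℓ : ℝ}

lemma differentiable (h : Profile φ ℓ) : Differentiable ℝ φ := h.smooth.differentiable (by simp)

lemma strictMonoOn (h : Profile φ ℓ) : StrictMonoOn φ (Icc 0 (ℓ / 4)) := by
  refine strictMonoOn_of_deriv_pos (convex_Icc _ _) h.smooth.continuous.continuousOn ?_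
  rw [interior_Icc]; exact h.deriv_pos

lemma apply_quarterPt (h : Profile φ ℓ) (s s' : Bool) (t : ℝ) : φ (quarterPt ℓ s s' t) = φ t := by
  cases s <;> cases s' <;> simp only [quarterPt, sgn_true, sgn_false, neg_one_mul, one_mul, h.even,
    h.symm, if_true, Bool.false_eq_true, if_false]

lemma apply_add_int (h : Profile φ ℓ) (t : ℝ) (m : ℤ) : φ (t + m * ℓ) = φ t := h.periodic.int_mul m t

lemma zero_mem (h : Profile φ ℓ) : (0 : ℝ) ∈ Icc 0 (ℓ / 4) := ⟨le_rfl, by linarith [h.pos]⟩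

lemma quarter_mem (h : Profile φ ℓ) : ℓ / 4 ∈ Icc 0 (ℓ / 4) := ⟨by linarith [h.pos], le_rfl⟩

lemma mem_Icc (h : Profile φ ℓ) (θ : ℝ) : φ θ ∈ Icc (φ 0) (φ (ℓ / 4)) := by
  obtain ⟨s, s', t, ht, m, rfl⟩ := exists_quarterPt h.pos θ
  rw [h.apply_add_int, h.apply_quarterPt]
  exact ⟨h.strictMonoOn.monotoneOn h.zero_mem ht ht.1,
    h.strictMonoOn.monotoneOn ht h.quarter_mem ht.2⟩

/-- Away from the extremal values a point is the image of an interior point of the first quarter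
under an affine symmetry of `φ`, and the chain rule transports the positive derivative. -/
lemma deriv_ne_zero (h : Profile φ ℓ) {θ : ℝ} (h0 : φ θ ≠ φ 0) (h1 : φ θ ≠ φ (ℓ / 4)) :
    deriv φ θ ≠ 0 := by
  obtain ⟨s, s', t, ht, m, rfl⟩ := exists_quarterPt h.pos θ
  rw [h.apply_add_int, h.apply_quarterPt] at h0 h1
  have ht' : t ∈ Ioo 0 (ℓ / 4) :=
    ⟨lt_of_le_of_ne ht.1 (by rintro rfl; exact h0 rfl),
      lt_of_le_of_ne ht.2 (by rintro rfl; exact h1 rfl)⟩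
  obtain ⟨k, hk⟩ := quarterPt_eq_affine ℓ s s'
  intro h2
  have h3 : HasDerivAt φ 0 (quarterPt ℓ s s' t + m * ℓ) := by
    rw [← h2]; exact (h.differentiable _).hasDerivAt
  have h4 : HasDerivAt (fun x => quarterPt ℓ s s' x + m * ℓ) (sgn s * sgn s') t := by
    simp only [hk]
    simpa using (((hasDerivAt_id t).const_mul (sgn s * sgn s')).add_const k).add_const (m * ℓ)
  have h5 := h3.comp t h4
  have h6 : φ ∘ (fun x => quarterPt ℓ s s' x + m * ℓ) = φ := by
    funext x; simp [h.apply_add_int, h.apply_quarterPt]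
  rw [h6, zero_mul] at h5
  exact (h.deriv_pos t ht').ne' h5.deriv

/-- The graph is symmetric about every multiple of `ℓ/4`, so the derivative there equals its own
negative. Later this keeps these points out of the charts around turning points. -/
lemma deriv_zero_of_quarter_int (h : Profile φ ℓ) (k : ℤ) : deriv φ (k * (ℓ / 4)) = 0 := by
  have key : ∀ x, φ (2 * (k * (ℓ / 4)) - x) = φ x := by
    intro x
    rcases Int.even_or_odd' k with ⟨j, rfl | rfl⟩
    · have := h.apply_add_int (-x) j
      rw [h.even] at this
      rw [← this]; congr 1; push_cast; ring
    · have := h.apply_add_int (ℓ / 2 - x) j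
      rw [h.symm] at this
      rw [← this]; congr 1; push_cast; ring
  set z := k * (ℓ / 4)
  have h1 : HasDerivAt φ (deriv φ z) z := (h.differentiable z).hasDerivAt
  have h2 : HasDerivAt (fun x => 2 * z - x) (-1) z := by
    simpa using (hasDerivAt_id z).const_sub (2 * z)
  have h3 : HasDerivAt φ (deriv φ z) (2 * z - z) := by
    have e : 2 * z - z = z := by ring
    rw [e]; exact h1
  have h4 := h3.comp z h2
  have h5 : φ ∘ (fun x => 2 * z - x) = φ := by funext x; exact key x
  rw [h5] at h4
  have := h1.unique h4
  linarith

end Profile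

namespace ClassicalLBT

/-! ### Separation of variables -/

/-- The monic quadratic polynomial `x² - c₁ x + c₂`. -/
def quad (c₁ c₂ x : ℝ) : ℝ := x ^ 2 - c₁ * x + c₂

/-- The squared norm of a covector of the table. -/
def energy (a b c p₁ p₂ p₃ : ℝ) : ℝ :=
  p₁ ^ 2 / Pi1 a b c + p₂ ^ 2 / Pi2 a b c + p₃ ^ 2 / Pi3 a b c

/-- The polynomial `x² energy - x int1 + int2` is `p₁²/Π₁ (x - b)(x - c) + p₂²/Π₂ (x - a)(x - c) +
p₃²/Π₃ (x - a)(x - b)`. At each of `a, b, c` a single term survives, with value `p₁²`, `-p₂²`,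
`p₃²`. -/
lemma separation {a b c p₁ p₂ p₃ c₁ c₂ : ℝ} (hab : b < a) (hbc : c < b) :
    (energy a b c p₁ p₂ p₃ = 1 ∧ int1 a b c p₁ p₂ p₃ = c₁ ∧ int2 a b c p₁ p₂ p₃ = c₂) ↔
      p₁ ^ 2 = quad c₁ c₂ a ∧ p₂ ^ 2 = -quad c₁ c₂ b ∧ p₃ ^ 2 = quad c₁ c₂ c := by
  have h1 : a - b ≠ 0 := by linarith
  have h2 : a - c ≠ 0 := by linarith
  have h3 : b - c ≠ 0 := by linarith
  constructor
  · rintro ⟨h, h', h''⟩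
    have e1 : p₁ ^ 2 = a ^ 2 * energy a b c p₁ p₂ p₃ - a * int1 a b c p₁ p₂ p₃ +
        int2 a b c p₁ p₂ p₃ := by
      simp only [energy, int1, int2, Pi1, Pi2, Pi3]; field_simp; ring
    have e2 : p₂ ^ 2 = -(b ^ 2 * energy a b c p₁ p₂ p₃ - b * int1 a b c p₁ p₂ p₃ +
        int2 a b c p₁ p₂ p₃) := by
      simp only [energy, int1, int2, Pi1, Pi2, Pi3]; field_simp; ring
    have e3 : p₃ ^ 2 = c ^ 2 * energy a b c p₁ p₂ p₃ - c * int1 a b c p₁ p₂ p₃ +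
        int2 a b c p₁ p₂ p₃ := by
      simp only [energy, int1, int2, Pi1, Pi2, Pi3]; field_simp; ring
    rw [h, h', h''] at e1 e2 e3
    refine ⟨?_, ?_, ?_⟩ <;> simp only [quad] <;> linarith
  · rintro ⟨h, h', h''⟩
    simp only [energy, int1, int2, h, h', h'', Pi1, Pi2, Pi3, quad]
    refine ⟨?_, ?_, ?_⟩ <;> field_simp <;> ring

lemma quad_sub (c₁ c₂ x y : ℝ) :
    quad c₁ c₂ x - quad c₁ c₂ y = (x - y) * (x + y - c₁) := by simp only [quad]; ring

/-- A convex parabola which has risen from a negative value to a nonnegative one is past its vertex.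
-/
lemma quad_lt_of_neg {c₁ c₂ b x y : ℝ} (hb : quad c₁ c₂ b < 0) (hx : 0 ≤ quad c₁ c₂ x)
    (hbx : b ≤ x) (hxy : x < y) : quad c₁ c₂ x < quad c₁ c₂ y := by
  have h1 := quad_sub c₁ c₂ x b
  have h2 := quad_sub c₁ c₂ y x
  have h3 : 0 < x + b - c₁ := by
    by_contra h
    nlinarith [mul_nonneg (sub_nonneg.2 hbx) (sub_nonneg.2 (not_lt.1 h))]
  nlinarith

lemma quad_convex {c₁ c₂ x y z : ℝ} (hx : quad c₁ c₂ x ≤ 0) (hz : quad c₁ c₂ z ≤ 0)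
    (hxy : x ≤ y) (hyz : y ≤ z) : quad c₁ c₂ y ≤ 0 := by
  rcases hxy.eq_or_lt with rfl | hxy
  · exact hx
  rcases hyz.eq_or_lt with rfl | hyz
  · exact hz
  simp only [quad] at *
  nlinarith [mul_pos (sub_pos.2 hxy) (sub_pos.2 hyz), mul_nonneg (sub_pos.2 hxy).le (neg_nonneg.2 hz),
    mul_nonneg (sub_pos.2 hyz).le (neg_nonneg.2 hx)]

/-- With a double root the polynomial would be a square, hence nowhere negative. -/
lemma two_mul_sub_ne_zero {c₁ c₂ b x : ℝ} (hb : quad c₁ c₂ b < 0) (hx : quad c₁ c₂ x = 0) :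
    2 * x - c₁ ≠ 0 := by
  intro h
  obtain rfl : c₁ = 2 * x := by linarith
  simp only [quad] at *
  nlinarith [sq_nonneg (b - x)]

lemma hasDerivAt_quad (c₁ c₂ x : ℝ) : HasDerivAt (quad c₁ c₂) (2 * x - c₁) x := by
  have := (((hasDerivAt_id x).pow 2).sub ((hasDerivAt_id x).const_mul c₁)).add_const c₂
  simp only [id, Nat.cast_ofNat, mul_one] at this
  refine (this.congr_deriv (by ring)).congr_of_eventuallyEq (.of_forall fun y => ?_)
  simp [quad]

lemma contDiff_quad (c₁ c₂ : ℝ) : ContDiff ℝ ∞ (quad c₁ c₂) := by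
  unfold quad; fun_prop

lemma continuous_quad (c₁ c₂ : ℝ) : Continuous (quad c₁ c₂) := (contDiff_quad c₁ c₂).continuous

variable (T : ClassicalLBT)

lemma profile₁ : Profile T.φ₁ T.ω₁ :=
  ⟨T.ω₁_pos, T.smooth₁, T.even₁, T.periodic₁, fun t => (T.symm₁ t).symm, T.deriv₁_pos⟩

lemma profile₂ : Profile T.φ₂ T.ω₂ :=
  ⟨T.ω₂_pos, T.smooth₂, T.even₂, T.periodic₂, T.symm₂, T.deriv₂_pos⟩

lemma φ₁_zero : T.φ₁ 0 = T.ν₁ := (T.min₁_iff 0).2 ⟨0, by simp⟩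

lemma φ₂_zero : T.φ₂ 0 = 0 := (T.min₂_iff 0).2 ⟨0, by simp⟩

lemma φ₂_quarter : T.φ₂ (T.ω₂ / 4) = T.ν₁ := (T.max₂_iff _).2 ⟨0, by simp⟩

lemma ν₁_le_φ₁ (t : ℝ) : T.ν₁ ≤ T.φ₁ t := T.min₁.2 ⟨t, rfl⟩

lemma φ₂_le_ν₁ (t : ℝ) : T.φ₂ t ≤ T.ν₁ := T.max₂.2 ⟨t, rfl⟩

lemma N_mem : T.N ∈ Icc (-T.N) T.N := ⟨by linarith [T.N_pos], le_rfl⟩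

lemma ν₃_neg : T.ν₃ < 0 :=
  lt_of_le_of_ne (T.nonpos₃ _ T.N_mem) fun h => T.N_pos.ne' ((T.max₃_iff _ T.N_mem).1 h)

lemma φ₃_le_φ₂ {t : ℝ} (ht : t ∈ Icc (-T.N) T.N) (s : ℝ) : T.φ₃ t ≤ T.φ₂ s :=
  (T.nonpos₃ t ht).trans (T.nonneg₂ s)

end ClassicalLBT

lemma addCircle_coe_eq_iff {l x y : ℝ} :
    (x : AddCircle l) = (y : AddCircle l) ↔ ∃ m : ℤ, y = x + m * l := by
  rw [QuotientAddGroup.eq, AddSubgroup.mem_zmultiples_iff]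
  refine exists_congr fun m => ?_
  rw [zsmul_eq_mul]
  constructor <;> intro h <;> linarith

namespace ClassicalLBT

variable (T : ClassicalLBT)

/-! ### Orbits of the deck group -/

lemma inv₁_inv₁ (p : T.Cyl) : T.inv₁ (T.inv₁ p) = p := by simp [inv₁]

lemma negIcc_negIcc (s : Icc (-T.N) T.N) : T.negIcc (T.negIcc s) = s := by simp [negIcc]

lemma inv₂_inv₂ (p : T.Cyl) : T.inv₂ (T.inv₂ p) = p := by simp [inv₂, negIcc_negIcc]

lemma inv₁_inv₂ (p : T.Cyl) : T.inv₁ (T.inv₂ p) = T.inv₂ (T.inv₁ p) := by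
  simp only [inv₁, inv₂, Prod.mk.injEq, and_true, true_and, sub_neg_eq_add, neg_sub]
  rw [sub_eq_add_neg, neg_half, add_comm]

/-- Two points of the cylinder lie in the same orbit of the deck group. -/
def SameOrbit (p q : T.Cyl) : Prop :=
  q = p ∨ q = T.inv₁ p ∨ q = T.inv₂ p ∨ q = T.inv₂ (T.inv₁ p)

variable {T}

lemma SameOrbit.symm {p q : T.Cyl} (h : T.SameOrbit p q) : T.SameOrbit q p := by
  rcases h with rfl | rfl | rfl | rfl
  · exact Or.inl rfl
  · exact Or.inr (Or.inl (by rw [inv₁_inv₁]))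
  · exact Or.inr (Or.inr (Or.inl (by rw [inv₂_inv₂])))
  · exact Or.inr (Or.inr (Or.inr (by rw [inv₁_inv₂, inv₁_inv₁, inv₂_inv₂])))

lemma SameOrbit.step {p q r : T.Cyl} (h : T.SameOrbit p q) (h' : r = T.inv₁ q ∨ r = T.inv₂ q) :
    T.SameOrbit p r := by
  rcases h with rfl | rfl | rfl | rfl <;> rcases h' with rfl | rfl <;>
    simp [SameOrbit, inv₁_inv₁, inv₂_inv₂, inv₁_inv₂]

lemma SameOrbit.trans {p q r : T.Cyl} (h : T.SameOrbit p q) (h' : T.SameOrbit q r) :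
    T.SameOrbit p r := by
  rcases h' with rfl | rfl | rfl | rfl
  · exact h
  · exact h.step (Or.inl rfl)
  · exact h.step (Or.inr rfl)
  · exact (h.step (Or.inl rfl)).step (Or.inr rfl)

lemma sameOrbit_of_proj_eq {p q : T.Cyl} (h : T.proj p = T.proj q) : T.SameOrbit p q := by
  have := Quot.eqvGen_exact h
  induction this with
  | rel x y h1 => exact SameOrbit.step (Or.inl rfl) h1
  | refl x => exact Or.inl rfl
  | symm x y _ ih => exact (ih (Quot.eqvGen_sound ‹_›)).symm
  | trans x y z h1 h2 ih1 ih2 =>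
    exact (ih1 (Quot.eqvGen_sound h1)).trans (ih2 (Quot.eqvGen_sound h2))

variable (T) in
/-- The deck transformation given by two signs maps the coordinates `θ` to `θ'`. -/
def DeckPt (b b' : Bool) (θ θ' : Fin 3 → ℝ) : Prop :=
  (∃ m : ℤ, θ' 0 - sgn b * θ 0 = m * T.ω₁) ∧
  (∃ m : ℤ, θ' 1 - sgn b * sgn b' * θ 1 - (if b then 0 else T.ω₂ / 2) = m * T.ω₂) ∧
  θ' 2 - sgn b' * θ 2 = 0

variable (T) in
/-- The covectors `(θ, p)` and `(θ', p')` are related by a deck transformation. -/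
def Deck (θ p θ' p' : Fin 3 → ℝ) : Prop :=
  ∃ b b' : Bool, T.DeckPt b b' θ θ' ∧ p' = ![sgn b * p 0, sgn b * sgn b' * p 1, sgn b' * p 2]

lemma Over.exists_deckPt {θ θ' : Fin 3 → ℝ} {x : T.X} (h : T.Over θ x) (h' : T.Over θ' x) :
    ∃ b b', T.DeckPt b b' θ θ' := by
  obtain ⟨hθ, rfl⟩ := h
  obtain ⟨hθ', h'⟩ := h'
  rcases sameOrbit_of_proj_eq h'.symm with h | h | h | h <;>
    simp only [pt, inv₁, inv₂, negIcc, Prod.mk.injEq, Subtype.mk.injEq] at h <;>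
    obtain ⟨h0, h1, h2⟩ := h
  · obtain ⟨m, hm⟩ := addCircle_coe_eq_iff.1 h0
    obtain ⟨n, hn⟩ := addCircle_coe_eq_iff.1 h1
    exact ⟨true, true, ⟨-m, by push_cast; simp; linarith⟩, ⟨-n, by push_cast; simp; linarith⟩,
      by simp; linarith⟩
  · rw [← AddCircle.coe_neg] at h0
    rw [← AddCircle.coe_sub] at h1
    obtain ⟨m, hm⟩ := addCircle_coe_eq_iff.1 h0
    obtain ⟨n, hn⟩ := addCircle_coe_eq_iff.1 h1
    exact ⟨false, true, ⟨-m, by push_cast; simp; linarith⟩, ⟨-n, by push_cast; simp; linarith⟩,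
      by simp; linarith⟩
  · rw [← AddCircle.coe_neg] at h1
    obtain ⟨m, hm⟩ := addCircle_coe_eq_iff.1 h0
    obtain ⟨n, hn⟩ := addCircle_coe_eq_iff.1 h1
    exact ⟨true, false, ⟨-m, by push_cast; simp; linarith⟩, ⟨-n, by push_cast; simp; linarith⟩,
      by simp; linarith⟩
  · rw [← AddCircle.coe_neg] at h0
    rw [← AddCircle.coe_sub, ← AddCircle.coe_neg] at h1
    obtain ⟨m, hm⟩ := addCircle_coe_eq_iff.1 h0
    obtain ⟨n, hn⟩ := addCircle_coe_eq_iff.1 h1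
    -- The composite of the involutions sends `θ₂` to `θ₂ - ω₂/2`, whereas `DeckPt` has the shift
    -- `+ω₂/2`; hence the extra period.
    exact ⟨false, false, ⟨-m, by push_cast; simp; linarith⟩,
      ⟨-n - 1, by push_cast; simp; linarith⟩, by simp; linarith⟩

lemma DeckPt.φ₁_eq {b b' : Bool} {θ θ' : Fin 3 → ℝ} (h : T.DeckPt b b' θ θ') :
    T.φ₁ (θ' 0) = T.φ₁ (θ 0) := by
  obtain ⟨⟨m, hm⟩, -, -⟩ := h
  rw [show θ' 0 = sgn b * θ 0 + m * T.ω₁ by linarith, T.profile₁.apply_add_int]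
  cases b <;> simp [T.even₁]

lemma DeckPt.φ₂_eq {b b' : Bool} {θ θ' : Fin 3 → ℝ} (h : T.DeckPt b b' θ θ') :
    T.φ₂ (θ' 1) = T.φ₂ (θ 1) := by
  obtain ⟨-, ⟨m, hm⟩, -⟩ := h
  rw [show θ' 1 = (sgn b * sgn b' * θ 1 + (if b then 0 else T.ω₂ / 2)) + m * T.ω₂ by linarith,
    T.profile₂.apply_add_int]
  cases b <;> cases b' <;> simp [T.even₂]
  · rw [← T.symm₂]; simp [T.even₂]
  · rw [← T.symm₂]; simp

lemma DeckPt.φ₃_eq {b b' : Bool} {θ θ' : Fin 3 → ℝ} (h : T.DeckPt b b' θ θ')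
    (hθ : θ 2 ∈ Icc (-T.N) T.N) : T.φ₃ (θ' 2) = T.φ₃ (θ 2) := by
  obtain ⟨-, -, hm⟩ := h
  rw [show θ' 2 = sgn b' * θ 2 by linarith]
  cases b' <;> simp [T.even₃ _ hθ]

/-- Since `φ₂ ≤ ν₁ ≤ φ₁`, equality forces both values to be `ν₁`, and these are attained exactly at
the fixed points of `σ₁`. So the branch set can be read off from the degeneracy of the metric
coefficients. -/
lemma mem_S₁_iff {θ : Fin 3 → ℝ} (h : θ 2 ∈ Icc (-T.N) T.N) :
    T.pt θ h ∈ T.S₁ ↔ T.φ₁ (θ 0) = T.φ₂ (θ 1) := by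
  have e : T.pt θ h ∈ T.S₁ ↔ T.φ₁ (θ 0) = T.ν₁ ∧ T.φ₂ (θ 1) = T.ν₁ := by
    simp only [S₁, mem_ofPred_eq, inv₁, pt, Prod.mk.injEq, and_true, T.min₁_iff, T.max₂_iff]
    rw [← AddCircle.coe_neg, ← AddCircle.coe_sub, addCircle_coe_eq_iff, addCircle_coe_eq_iff]
    refine and_congr (exists_congr fun m => ?_) (exists_congr fun m => ?_)
    · constructor <;> intro h <;> linarith
    · constructor <;> intro h <;> linarith
  rw [e]
  constructor
  · rintro ⟨h1, h2⟩; rw [h1, h2]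
  · intro h
    have h1 := T.ν₁_le_φ₁ (θ 0)
    have h2 := T.φ₂_le_ν₁ (θ 1)
    constructor <;> linarith

lemma mem_S₂_iff {θ : Fin 3 → ℝ} (h : θ 2 ∈ Icc (-T.N) T.N) :
    T.pt θ h ∈ T.S₂ ↔ T.φ₂ (θ 1) = T.φ₃ (θ 2) := by
  have e : T.pt θ h ∈ T.S₂ ↔ T.φ₂ (θ 1) = 0 ∧ T.φ₃ (θ 2) = 0 := by
    simp only [S₂, mem_ofPred_eq, inv₂, negIcc, pt, Prod.mk.injEq, true_and, T.min₂_iff,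
      T.max₃_iff _ h, Subtype.ext_iff]
    rw [← AddCircle.coe_neg, addCircle_coe_eq_iff]
    refine and_congr (exists_congr fun m => ?_) ?_
    · constructor <;> intro h <;> linarith
    · constructor <;> intro h <;> linarith
  rw [e]
  constructor
  · rintro ⟨h1, h2⟩; rw [h1, h2]
  · intro h'
    have h1 := T.nonneg₂ (θ 1)
    have h2 := T.nonpos₃ _ h
    constructor <;> linarith

lemma Over.mem_proj_S_iff {θ : Fin 3 → ℝ} {x : T.X} (h : T.Over θ x) :
    x ∈ T.proj '' T.S ↔ T.φ₁ (θ 0) = T.φ₂ (θ 1) ∨ T.φ₂ (θ 1) = T.φ₃ (θ 2) := by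
  constructor
  · rintro ⟨⟨q0, q1, q2, hq⟩, hqS, hq'⟩
    obtain ⟨x0, rfl⟩ := QuotientAddGroup.mk_surjective q0
    obtain ⟨x1, rfl⟩ := QuotientAddGroup.mk_surjective q1
    have ho : T.Over ![x0, x1, q2] x := ⟨hq, hq'⟩
    obtain ⟨b, b', hb⟩ := ho.exists_deckPt h
    rw [hb.φ₁_eq, hb.φ₂_eq, hb.φ₃_eq hq]
    exact hqS.imp (mem_S₁_iff (θ := ![x0, x1, q2]) hq).1 (mem_S₂_iff (θ := ![x0, x1, q2]) hq).1
  · intro h'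
    obtain ⟨hθ, rfl⟩ := h
    exact ⟨_, h'.imp (mem_S₁_iff hθ).2 (mem_S₂_iff hθ).2, rfl⟩

lemma Over.lt_of_notMem {θ : Fin 3 → ℝ} {x : T.X} (h : T.Over θ x) (hx : x ∉ T.proj '' T.S) :
    T.φ₂ (θ 1) < T.φ₁ (θ 0) ∧ T.φ₃ (θ 2) < T.φ₂ (θ 1) := by
  rw [h.mem_proj_S_iff, not_or] at hx
  exact ⟨lt_of_le_of_ne (T.le₂₁ _ _) (Ne.symm hx.1),
    lt_of_le_of_ne (T.φ₃_le_φ₂ h.1 _) (Ne.symm hx.2)⟩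

/-! ### Lifts of curves -/

variable (T) in
/-- The covector of the curve `c` at the time `t` has coordinates `(θ, p)` on the cylinder. -/
def LiftAt (c : ℝ → T.X) (t : ℝ) (θ p : Fin 3 → ℝ) : Prop :=
  ∃ ϑ : ℝ → Fin 3 → ℝ, ∃ v : Fin 3 → ℝ, ϑ t = θ ∧ (∀ᶠ s in 𝓝 t, T.Over (ϑ s) (c s)) ∧
    HasDerivAt ϑ v t ∧ p = fun k => T.coeff θ k * v k

lemma LiftAt.over {c : ℝ → T.X} {t : ℝ} {θ p : Fin 3 → ℝ} (h : T.LiftAt c t θ p) :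
    T.Over θ (c t) := by
  obtain ⟨ϑ, v, rfl, h, -⟩ := h
  exact h.self_of_nhds

/-- The zeros of `sin (π f / l)` accumulate at `t`, so both this function and its derivative vanish
there. This compares two lifts of a curve to first order when they agree modulo periods only along a
sequence of times. -/
lemma eq_int_mul_of_frequently {f : ℝ → ℝ} {d t l : ℝ} (hl : 0 < l) (hf : HasDerivAt f d t)
    (h : ∃ᶠ s in 𝓝[≠] t, ∃ m : ℤ, f s = m * l) : (∃ m : ℤ, f t = m * l) ∧ d = 0 := by
  have hπ := Real.pi_pos
  set g : ℝ → ℝ := fun s => Real.sin (f s * (Real.pi / l)) with hg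
  have h1 : ∀ s, (∃ m : ℤ, f s = m * l) ↔ g s = 0 := by
    intro s
    simp only [hg]
    rw [Real.sin_eq_zero_iff]
    refine exists_congr fun m => ?_
    constructor
    · intro h; rw [h]; field_simp
    · intro h; field_simp at h; linarith
  simp only [h1] at h
  have hgd : HasDerivAt g (Real.cos (f t * (Real.pi / l)) * (d * (Real.pi / l))) t :=
    (hf.mul_const (Real.pi / l)).sin
  have h0 : g t = 0 := by
    by_contra hne
    exact h ((hgd.continuousAt.eventually_ne hne).filter_mono nhdsWithin_le_nhds)
  refine ⟨(h1 t).2 h0, ?_⟩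
  by_contra hd
  have hc : Real.cos (f t * (Real.pi / l)) ≠ 0 := by
    intro hc
    have := Real.sin_sq_add_cos_sq (f t * (Real.pi / l))
    rw [hc, show Real.sin (f t * (Real.pi / l)) = 0 from h0] at this
    norm_num at this
  exact h (hgd.eventually_ne (mul_ne_zero hc (mul_ne_zero hd (by positivity))))

/-- The deck transformation relating two lifts may depend on the time. By pigeonhole one of the four
sign pairs occurs at times accumulating at `t`, and this suffices to relate positions and velocities
at `t`, even if the curve is in the branch set. -/
lemma LiftAt.deck {c : ℝ → T.X} {t : ℝ} {θ p θ' p' : Fin 3 → ℝ} (h : T.LiftAt c t θ p)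
    (h' : T.LiftAt c t θ' p') : T.Deck θ p θ' p' := by
  obtain ⟨ϑ, v, rfl, ho, hd, rfl⟩ := h
  obtain ⟨ϑ', v', rfl, ho', hd', rfl⟩ := h'
  have key : ∃ b b', ∃ᶠ s in 𝓝[≠] t, T.DeckPt b b' (ϑ s) (ϑ' s) := by
    have : ∀ᶠ s in 𝓝[≠] t, ∃ b b', T.DeckPt b b' (ϑ s) (ϑ' s) :=
      (ho.and ho').filter_mono nhdsWithin_le_nhds |>.mono fun s hs => hs.1.exists_deckPt hs.2
    by_contra hcon
    push Not at hcon
    have h4 := ((hcon true true).and (hcon true false)).and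
      ((hcon false true).and (hcon false false))
    obtain ⟨s, ⟨b, b', hb⟩, ⟨h1, h2⟩, h3, h4⟩ := (this.and h4).exists
    cases b <;> cases b' <;> contradiction
  obtain ⟨b, b', hb⟩ := key
  have d := hasDerivAt_pi.1 hd
  have d' := hasDerivAt_pi.1 hd'
  have k0 := eq_int_mul_of_frequently T.ω₁_pos ((d' 0).sub ((d 0).const_mul (sgn b)))
    (hb.mono fun s hs => hs.1)
  have k1 := eq_int_mul_of_frequently T.ω₂_pos
    (((d' 1).sub ((d 1).const_mul (sgn b * sgn b'))).sub_const (if b then 0 else T.ω₂ / 2))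
    (hb.mono fun s hs => hs.2.1)
  have hc2 : HasDerivAt (fun s => ϑ' s 2 - sgn b' * ϑ s 2) (v' 2 - sgn b' * v 2) t :=
    (d' 2).sub ((d 2).const_mul (sgn b'))
  have h2 : ϑ' t 2 - sgn b' * ϑ t 2 = 0 := by
    by_contra hne
    exact hb ((hc2.continuousAt.eventually_ne hne).filter_mono nhdsWithin_le_nhds |>.mono
      fun s hs h => hs h.2.2)
  -- The difference is zero itself, not merely modulo a period, so any positive number can serve as
  -- the period.
  have k2 := eq_int_mul_of_frequently T.N_pos hc2
    (hb.mono fun s hs => ⟨0, by rw [hs.2.2]; simp⟩)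
  have hD : T.DeckPt b b' (ϑ t) (ϑ' t) := ⟨k0.1, k1.1, h2⟩
  have e1 := hD.φ₁_eq
  have e2 := hD.φ₂_eq
  have e3 := hD.φ₃_eq ho.self_of_nhds.1
  refine ⟨b, b', hD, ?_⟩
  have v0 : v' 0 = sgn b * v 0 := by linarith [k0.2]
  have v1 : v' 1 = sgn b * sgn b' * v 1 := by linarith [k1.2]
  have v2 : v' 2 = sgn b' * v 2 := by linarith [k2.2]
  funext k
  fin_cases k <;> simp [coeff, e1, e2, e3, v0, v1, v2] <;> ring

end ClassicalLBT

namespace ClassicalLBT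

/-! ### Conservation laws along geodesics -/

section Conservation

variable {A B C P₀ P₁ P₂ : ℝ → ℝ} {a' b' c' v₀ v₁ v₂ s : ℝ}

/-- The hypotheses on `P₀, P₁, P₂` are the Euler-Lagrange equations: the right-hand sides are halves
of the partial derivatives of `Π₁ v₀² + Π₂ v₁² + Π₃ v₂²`. After substituting `p = Π v`, conservation
is an algebraic identity. -/
lemma hasDerivAt_integrals (hA : HasDerivAt A (a' * v₀) s) (hB : HasDerivAt B (b' * v₁) s)
    (hC : HasDerivAt C (c' * v₂) s)
    (hP₀ : HasDerivAt P₀ (a' * ((2 * A s - B s - C s) * v₀ ^ 2 + (B s - C s) * v₁ ^ 2 +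
      (B s - C s) * v₂ ^ 2) / 2) s)
    (hP₁ : HasDerivAt P₁ (b' * (-(A s - C s) * v₀ ^ 2 + (A s - 2 * B s + C s) * v₁ ^ 2 +
      (A s - C s) * v₂ ^ 2) / 2) s)
    (hP₂ : HasDerivAt P₂ (c' * (-(A s - B s) * v₀ ^ 2 - (A s - B s) * v₁ ^ 2 +
      (2 * C s - A s - B s) * v₂ ^ 2) / 2) s)
    (h₀ : P₀ s = Pi1 (A s) (B s) (C s) * v₀) (h₁ : P₁ s = Pi2 (A s) (B s) (C s) * v₁)
    (h₂ : P₂ s = Pi3 (A s) (B s) (C s) * v₂) (hBA : B s < A s) (hCB : C s < B s) :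
    HasDerivAt (fun s => (energy (A s) (B s) (C s) (P₀ s) (P₁ s) (P₂ s),
      int1 (A s) (B s) (C s) (P₀ s) (P₁ s) (P₂ s),
      int2 (A s) (B s) (C s) (P₀ s) (P₁ s) (P₂ s))) 0 s := by
  have h1 : A s - B s ≠ 0 := by linarith
  have h2 : A s - C s ≠ 0 := by linarith
  have h3 : B s - C s ≠ 0 := by linarith
  have hq₁ := (hA.sub hB).mul (hA.sub hC)
  have hq₂ := (hA.sub hB).mul (hB.sub hC)
  have hq₃ := (hA.sub hC).mul (hB.sub hC)
  have n₁ := mul_ne_zero h1 h2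
  have n₂ := mul_ne_zero h1 h3
  have n₃ := mul_ne_zero h2 h3
  simp only [Pi1, Pi2, Pi3] at h₀ h₁ h₂
  refine HasDerivAt.prodMk ?_ (HasDerivAt.prodMk ?_ ?_)
  · have := (((hP₀.pow 2).div hq₁ n₁).add ((hP₁.pow 2).div hq₂ n₂)).add ((hP₂.pow 2).div hq₃ n₃)
    refine this.congr_deriv ?_
    simp only [Pi.mul_apply, Pi.sub_apply, Pi.pow_apply, h₀, h₁, h₂]
    field_simp
    simp
    ring
  · have := ((((hB.add hC).mul (hP₀.pow 2)).div hq₁ n₁).add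
      (((hA.add hC).mul (hP₁.pow 2)).div hq₂ n₂)).add
      (((hA.add hB).mul (hP₂.pow 2)).div hq₃ n₃)
    refine this.congr_deriv ?_
    simp only [Pi.mul_apply, Pi.sub_apply, Pi.add_apply, Pi.pow_apply, h₀, h₁, h₂]
    field_simp
    simp
    ring
  · have := ((((hB.mul hC).mul (hP₀.pow 2)).div hq₁ n₁).add
      (((hA.mul hC).mul (hP₁.pow 2)).div hq₂ n₂)).add
      (((hA.mul hB).mul (hP₂.pow 2)).div hq₃ n₃)
    refine this.congr_deriv ?_
    simp only [Pi.mul_apply, Pi.sub_apply, Pi.pow_apply, h₀, h₁, h₂]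
    field_simp
    simp
    ring

end Conservation

variable (T : ClassicalLBT)

/-- The energy and the two quadratic integrals of a covector on the cylinder. -/
def ints (θ p : Fin 3 → ℝ) : ℝ × ℝ × ℝ :=
  (energy (T.φ₁ (θ 0)) (T.φ₂ (θ 1)) (T.φ₃ (θ 2)) (p 0) (p 1) (p 2),
    int1 (T.φ₁ (θ 0)) (T.φ₂ (θ 1)) (T.φ₃ (θ 2)) (p 0) (p 1) (p 2),
    int2 (T.φ₁ (θ 0)) (T.φ₂ (θ 1)) (T.φ₃ (θ 2)) (p 0) (p 1) (p 2))

variable {T}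

lemma Deck.sq_eq {θ p θ' p' : Fin 3 → ℝ} (h : T.Deck θ p θ' p') (k : Fin 3) :
    p' k ^ 2 = p k ^ 2 := by
  obtain ⟨b, b', -, rfl⟩ := h
  fin_cases k <;> simp [mul_pow]

lemma Deck.ints_eq {θ p θ' p' : Fin 3 → ℝ} (h : T.Deck θ p θ' p') (hθ : θ 2 ∈ Icc (-T.N) T.N) :
    T.ints θ' p' = T.ints θ p := by
  have := h.sq_eq
  obtain ⟨b, b', hb, -⟩ := h
  simp only [ints, energy, int1, int2, hb.φ₁_eq, hb.φ₂_eq, hb.φ₃_eq hθ, this]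

lemma fold₁₂_zero : fold₁₂ 0 = 0 := by funext k; fin_cases k <;> simp [fold₁₂]

lemma fold₂₃_zero : fold₂₃ 0 = 0 := by funext k; fin_cases k <;> simp [fold₂₃]

/-- The branch chart is the complex square, and `|z²| = |z|²` shows that `z → 0` when `z² → 0`. -/
lemma tendsto_sq_fold {ι : Type*} {l : Filter ι} {f g : ι → ℝ}
    (h1 : Tendsto (fun i => f i ^ 2 - g i ^ 2) l (𝓝 0))
    (h2 : Tendsto (fun i => 2 * f i * g i) l (𝓝 0)) :
    Tendsto f l (𝓝 0) ∧ Tendsto g l (𝓝 0) := by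
  have h3 : Tendsto (fun i => f i ^ 2 + g i ^ 2) l (𝓝 0) := by
    have := ((h1.pow 2).add (h2.pow 2)).sqrt
    simp only [ne_eq, OfNat.ofNat_ne_zero, not_false_eq_true, zero_pow, add_zero,
      Real.sqrt_zero] at this
    refine this.congr fun i => ?_
    rw [show (f i ^ 2 - g i ^ 2) ^ 2 + (2 * f i * g i) ^ 2 = (f i ^ 2 + g i ^ 2) ^ 2 by ring,
      Real.sqrt_sq (by positivity)]
  have key : ∀ u : ι → ℝ, (∀ i, u i ^ 2 ≤ f i ^ 2 + g i ^ 2) → Tendsto u l (𝓝 0) := by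
    intro u hu
    have h4 : Tendsto (fun i => u i ^ 2) l (𝓝 0) :=
      squeeze_zero (fun i => sq_nonneg _) hu h3
    have h5 := h4.sqrt
    simp only [Real.sqrt_sq_eq_abs, Real.sqrt_zero] at h5
    exact (tendsto_zero_iff_abs_tendsto_zero u).2 h5
  exact ⟨key f fun i => by nlinarith [sq_nonneg (g i)], key g fun i => by nlinarith [sq_nonneg (f i)]⟩

lemma tendsto_of_tendsto_chart {θ₀ : Fin 3 → ℝ} {Φ : (Fin 3 → ℝ) → Fin 3 → ℝ}
    (h : T.IsChart θ₀ Φ) {ι : Type*} {l : Filter ι} {x : ι → Fin 3 → ℝ}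
    (hx : Tendsto (fun i => Φ (x i)) l (𝓝 (Φ 0))) : Tendsto x l (𝓝 0) := by
  obtain ⟨-, -, ⟨-, rfl⟩ | ⟨-, rfl⟩ | ⟨-, rfl⟩⟩ := h
  · exact hx
  · rw [fold₁₂_zero] at hx
    have h := tendsto_pi_nhds.1 hx
    have := tendsto_sq_fold (f := fun i => x i 0) (g := fun i => x i 1) (h 0) (h 1)
    refine tendsto_pi_nhds.2 fun k => ?_
    fin_cases k
    exacts [this.1, this.2, h 2]
  · rw [fold₂₃_zero] at hx
    have h := tendsto_pi_nhds.1 hx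
    have := tendsto_sq_fold (f := fun i => x i 1) (g := fun i => x i 2) (h 1) (h 2)
    refine tendsto_pi_nhds.2 fun k => ?_
    fin_cases k
    exacts [h 0, this.1, this.2]

/-- A geodesic has locally a lift to the cylinder which is continuous at the given time. -/
lemma IsGeodesicAt.exists_lift {c : ℝ → T.X} {t : ℝ} (h : T.IsGeodesicAt c t) :
    ∃ ϑ : ℝ → Fin 3 → ℝ, ContinuousAt ϑ t ∧ ∀ᶠ s in 𝓝 t, T.Over (ϑ s) (c s) := by
  obtain ⟨θ₀, Φ, M, y, v, hc, hM, hy, hev⟩ := h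
  have h1 : ∀ᶠ s in 𝓝 t, ∃ x, Φ x = y s ∧ T.Over (θ₀ + x) (c s) := hev.mono fun s hs => hs.1
  obtain ⟨x, hx⟩ := h1.choice
  have hyc : Tendsto y (𝓝 t) (𝓝 (Φ 0)) := by
    rw [← hy]; exact hev.self_of_nhds.2.1.continuousAt
  have hx0 : Tendsto x (𝓝 t) (𝓝 0) :=
    tendsto_of_tendsto_chart hc (hyc.congr' (hx.mono fun s hs => hs.1.symm))
  have hxt : x t = 0 := by
    have h2 : Φ (x t) = Φ 0 := by rw [hx.self_of_nhds.1, hy]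
    -- Applied to a constant sequence, the properness of the chart says that the origin is the only
    -- preimage of `Φ 0`.
    have h3 : Tendsto (fun _ : ℕ => x t) atTop (𝓝 0) :=
      tendsto_of_tendsto_chart hc (by rw [h2]; exact tendsto_const_nhds)
    exact tendsto_nhds_unique tendsto_const_nhds h3
  refine ⟨fun s => θ₀ + x s, ?_, hx.mono fun s hs => hs.2⟩
  have : ContinuousAt x t := by rw [ContinuousAt, hxt]; exact hx0
  exact continuousAt_const.add this

lemma form_single (θ v : Fin 3 → ℝ) (k : Fin 3) :
    T.form θ v (Pi.single k 1) = T.coeff θ k * v k := by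
  simp [form, Pi.single_apply]

lemma differentiableAt_φ₃ {t : ℝ} (ht : t ∈ Ioo (-T.N) T.N) : DifferentiableAt ℝ T.φ₃ t :=
  (T.smooth₃.contDiffAt (Icc_mem_nhds ht.1 ht.2)).differentiableAt (by simp)

lemma fderiv_form {θ₀ y v : Fin 3 → ℝ} (h : (θ₀ + y) 2 ∈ Ioo (-T.N) T.N) (w : Fin 3 → ℝ)
    {a b c : ℝ} (ha : a = T.φ₁ ((θ₀ + y) 0)) (hb : b = T.φ₂ ((θ₀ + y) 1))
    (hc : c = T.φ₃ ((θ₀ + y) 2)) :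
    fderiv ℝ (fun z => T.form (θ₀ + z) v v) y w =
      deriv T.φ₁ ((θ₀ + y) 0) * ((2 * a - b - c) * v 0 ^ 2 + (b - c) * v 1 ^ 2 +
        (b - c) * v 2 ^ 2) * w 0 +
      deriv T.φ₂ ((θ₀ + y) 1) * (-(a - c) * v 0 ^ 2 + (a - 2 * b + c) * v 1 ^ 2 +
        (a - c) * v 2 ^ 2) * w 1 +
      deriv T.φ₃ ((θ₀ + y) 2) * (-(a - b) * v 0 ^ 2 - (a - b) * v 1 ^ 2 +
        (2 * c - a - b) * v 2 ^ 2) * w 2 := by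
  have hpr : ∀ k : Fin 3, HasFDerivAt (fun z : Fin 3 → ℝ => (θ₀ + z) k)
      (ContinuousLinearMap.proj (R := ℝ) (φ := fun _ : Fin 3 => ℝ) k) y := fun k =>
    (ContinuousLinearMap.proj (R := ℝ) (φ := fun _ : Fin 3 => ℝ) k).hasFDerivAt.const_add (θ₀ k)
  have hA := ((T.profile₁.differentiable _).hasDerivAt).comp_hasFDerivAt y (hpr 0)
  have hB := ((T.profile₂.differentiable _).hasDerivAt).comp_hasFDerivAt y (hpr 1)
  have hC := ((differentiableAt_φ₃ h).hasDerivAt).comp_hasFDerivAt y (hpr 2)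
  have := (((((hA.sub hB).mul (hA.sub hC)).mul_const (v 0)).mul_const (v 0)).add
    ((((hA.sub hB).mul (hB.sub hC)).mul_const (v 1)).mul_const (v 1))).add
    ((((hA.sub hC).mul (hB.sub hC)).mul_const (v 2)).mul_const (v 2))
  have e := this.congr_of_eventuallyEq (f₁ := fun z => T.form (θ₀ + z) v v)
    (.of_forall fun z => by simp only [form, coeff, Fin.sum_univ_three]; rfl)
  subst ha hb hc
  refine (congrArg (fun L => L w) e.fderiv).trans ?_
  simp
  ring

/-- Away from the branch set a geodesic has locally a differentiable lift along which the energy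
and the quadratic integrals are constant. -/
lemma IsGeodesicAt.exists_flow {c : ℝ → T.X} {t : ℝ} (h : T.IsGeodesicAt c t)
    (hS : c t ∉ T.proj '' T.S) :
    ∃ ϑ p : ℝ → Fin 3 → ℝ, ∀ᶠ s in 𝓝 t, T.LiftAt c s (ϑ s) (p s) ∧ ContinuousAt ϑ s ∧
      ContinuousAt p s ∧ HasDerivAt (fun s => T.ints (ϑ s) (p s)) 0 s ∧
      T.φ₂ (ϑ s 1) < T.φ₁ (ϑ s 0) ∧ T.φ₃ (ϑ s 2) < T.φ₂ (ϑ s 1) := by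
  obtain ⟨θ₀, Φ, M, y, v, ⟨hθ₀, hθ₀', hc⟩, hM, hy, hev⟩ := h
  -- The chart is centred at `c t`, which is off the branch set, so it can only be the identity
  -- chart; there `M` is the form `g` itself.
  have hΦ : Φ = id ∧ y t = 0 ∧ T.Over θ₀ (c t) := by
    obtain ⟨x, hx, hx'⟩ := hev.self_of_nhds.1
    have hx0 : x = 0 := by
      have h3 : Tendsto (fun _ : ℕ => x) atTop (𝓝 0) :=
        tendsto_of_tendsto_chart ⟨hθ₀, hθ₀', hc⟩ (by rw [hx, hy]; exact tendsto_const_nhds)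
      exact tendsto_nhds_unique tendsto_const_nhds h3
    rw [hx0, add_zero] at hx'
    rw [hx'.mem_proj_S_iff, not_or, ← mem_S₁_iff hθ₀', ← mem_S₂_iff hθ₀'] at hS
    rcases hc with ⟨-, h⟩ | ⟨h, -⟩ | ⟨h, -⟩
    · subst h; exact ⟨rfl, hy, hx'⟩
    · exact absurd h hS.1
    · exact absurd h hS.2
  obtain ⟨rfl, hy0, ho⟩ := hΦ
  have hM2 : ∀ᶠ x in 𝓝 (0 : Fin 3 → ℝ), ∀ v w : Fin 3 → ℝ, M x v w = T.form (θ₀ + x) v w :=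
    hM.2.mono fun x hx v w => by simpa using hx v w
  have hyc : Tendsto y (𝓝 t) (𝓝 0) := by
    rw [← hy0]; exact hev.self_of_nhds.2.1.continuousAt
  have h2 : ∀ᶠ x in 𝓝 (0 : Fin 3 → ℝ), (θ₀ + x) 2 ∈ Ioo (-T.N) T.N := by
    have : ContinuousAt (fun x : Fin 3 → ℝ => (θ₀ + x) 2) 0 := 
      (continuous_const.add (continuous_apply 2)).continuousAt
    exact this.eventually_mem (by simpa using Ioo_mem_nhds hθ₀.1 hθ₀.2)
  have hlt := ho.lt_of_notMem hS
  have c3 : ContinuousAt T.φ₃ (θ₀ 2) := (differentiableAt_φ₃ hθ₀).continuousAt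
  have h3 : ∀ᶠ x in 𝓝 (0 : Fin 3 → ℝ), T.φ₂ ((θ₀ + x) 1) < T.φ₁ ((θ₀ + x) 0) ∧
      T.φ₃ ((θ₀ + x) 2) < T.φ₂ ((θ₀ + x) 1) := by
    have e0 : Tendsto (fun x : Fin 3 → ℝ => (θ₀ + x) 0) (𝓝 0) (𝓝 (θ₀ 0)) := by
      have : ContinuousAt (fun x : Fin 3 → ℝ => (θ₀ + x) 0) 0 :=
        (continuous_const.add (continuous_apply 0)).continuousAt
      simpa [ContinuousAt] using this
    have e1 : Tendsto (fun x : Fin 3 → ℝ => (θ₀ + x) 1) (𝓝 0) (𝓝 (θ₀ 1)) := by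
      have : ContinuousAt (fun x : Fin 3 → ℝ => (θ₀ + x) 1) 0 :=
        (continuous_const.add (continuous_apply 1)).continuousAt
      simpa [ContinuousAt] using this
    have e2 : Tendsto (fun x : Fin 3 → ℝ => (θ₀ + x) 2) (𝓝 0) (𝓝 (θ₀ 2)) := by
      have : ContinuousAt (fun x : Fin 3 → ℝ => (θ₀ + x) 2) 0 :=
        (continuous_const.add (continuous_apply 2)).continuousAt
      simpa [ContinuousAt] using this
    have f0 := (T.smooth₁.continuous.tendsto _).comp e0
    have f1 := (T.smooth₂.continuous.tendsto _).comp e1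
    have f2 := c3.tendsto.comp e2
    exact (f1.eventually_lt f0 hlt.1).and (f2.eventually_lt f1 hlt.2)
  refine ⟨fun s => θ₀ + y s, fun s k => T.coeff (θ₀ + y s) k * v s k, ?_⟩
  filter_upwards [hev.eventually_nhds, hyc.eventually hM2.eventually_nhds, hyc.eventually h2,
    hyc.eventually h3, (hyc.eventually hM2).eventually_nhds] with s hs hMs h2s h3s hMs'
  have hyd : HasDerivAt y (v s) s := hs.self_of_nhds.2.1
  have hyk := hasDerivAt_pi.1 hyd
  have hθd : HasDerivAt (fun s => θ₀ + y s) (v s) s := hyd.const_add θ₀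
  have hfd : ∀ w, fderiv ℝ (fun z => M z (v s) (v s)) (y s) w =
      fderiv ℝ (fun z => T.form (θ₀ + z) (v s) (v s)) (y s) w := by
    intro w
    rw [Filter.EventuallyEq.fderiv_eq (hMs.mono fun z hz => hz (v s) (v s))]
  have hp : ∀ k : Fin 3, HasDerivAt (fun s => T.coeff (θ₀ + y s) k * v s k)
      (fderiv ℝ (fun z => T.form (θ₀ + z) (v s) (v s)) (y s) (Pi.single k 1) / 2) s := by
    intro k
    have := hs.self_of_nhds.2.2 (Pi.single k 1)
    rw [hfd] at this
    refine this.congr_of_eventuallyEq (hMs'.mono fun z hz => ?_)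
    simp only [hz, form_single]
  have hpc : HasDerivAt (fun s k => T.coeff (θ₀ + y s) k * v s k)
      (fun k => fderiv ℝ (fun z => T.form (θ₀ + z) (v s) (v s)) (y s) (Pi.single k 1) / 2) s :=
    hasDerivAt_pi.2 hp
  refine ⟨⟨fun s => θ₀ + y s, v s, rfl, ?_, hθd, rfl⟩, hθd.continuousAt, hpc.continuousAt, ?_, h3s⟩
  · filter_upwards [hs] with r hr
    obtain ⟨x, hx, hx'⟩ := hr.1
    rw [← hx]; exact hx'
  · have hA : HasDerivAt (fun s => T.φ₁ ((θ₀ + y s) 0))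
        (deriv T.φ₁ ((θ₀ + y s) 0) * v s 0) s :=
      (T.profile₁.differentiable _).hasDerivAt.comp s ((hyk 0).const_add (θ₀ 0))
    have hB : HasDerivAt (fun s => T.φ₂ ((θ₀ + y s) 1))
        (deriv T.φ₂ ((θ₀ + y s) 1) * v s 1) s :=
      (T.profile₂.differentiable _).hasDerivAt.comp s ((hyk 1).const_add (θ₀ 1))
    have hC : HasDerivAt (fun s => T.φ₃ ((θ₀ + y s) 2))
        (deriv T.φ₃ ((θ₀ + y s) 2) * v s 2) s :=
      (differentiableAt_φ₃ h2s).hasDerivAt.comp s ((hyk 2).const_add (θ₀ 2))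
    refine hasDerivAt_integrals hA hB hC ?_ ?_ ?_ rfl rfl rfl h3s.1 h3s.2
    · refine (hp 0).congr_deriv ?_
      rw [fderiv_form h2s _ rfl rfl rfl]; simp
    · refine (hp 1).congr_deriv ?_
      rw [fderiv_form h2s _ rfl rfl rfl]; simp
    · refine (hp 2).congr_deriv ?_
      rw [fderiv_form h2s _ rfl rfl rfl]; simp

end ClassicalLBT

/-! ### Persistence of signs along geodesics -/

namespace ClassicalLBT

variable (T : ClassicalLBT)

/-- The covector `(θ, p)` has unit length and the integrals `I₁`, `I₂` take the values
`c₁`, `c₂` there, in separated variables. -/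
def Sep (c₁ c₂ : ℝ) (θ p : Fin 3 → ℝ) : Prop :=
  p 0 ^ 2 = quad c₁ c₂ (T.φ₁ (θ 0)) ∧ p 1 ^ 2 = -quad c₁ c₂ (T.φ₂ (θ 1)) ∧
    p 2 ^ 2 = quad c₁ c₂ (T.φ₃ (θ 2))

/-- A function of the covectors on the cylinder which is invariant under deck transformations and
does not vanish on a level set of the integrals. -/
structure IsSignFunction (c₁ c₂ : ℝ) (E : (Fin 3 → ℝ) → (Fin 3 → ℝ) → ℝ) : Prop where
  continuous : Continuous fun z : (Fin 3 → ℝ) × (Fin 3 → ℝ) => E z.1 z.2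
  deck : ∀ θ p θ' p', T.Deck θ p θ' p' → E θ' p' = E θ p
  ne_zero : ∀ θ p, θ 2 ∈ Icc (-T.N) T.N → T.Sep c₁ c₂ θ p → E θ p ≠ 0

variable {T} {c₁ c₂ : ℝ}

lemma Sep.ints_eq {θ p : Fin 3 → ℝ} (h1 : T.φ₂ (θ 1) < T.φ₁ (θ 0))
    (h2 : T.φ₃ (θ 2) < T.φ₂ (θ 1)) : T.Sep c₁ c₂ θ p ↔ T.ints θ p = (1, c₁, c₂) := by
  simp only [Sep, ints, Prod.mk.injEq]
  exact (separation h1 h2).symm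

/-- Covectors on such a level avoid the branch set: there two of the `φ`'s share the value `ν₁` or
`0`, at which `quad` would have to be both `≥ 0` and `≤ 0`. -/
lemma Sep.lt (h0 : quad c₁ c₂ 0 ≠ 0) (hν : quad c₁ c₂ T.ν₁ ≠ 0) {θ p : Fin 3 → ℝ}
    (hθ : θ 2 ∈ Icc (-T.N) T.N) (h : T.Sep c₁ c₂ θ p) :
    T.φ₂ (θ 1) < T.φ₁ (θ 0) ∧ T.φ₃ (θ 2) < T.φ₂ (θ 1) := by
  obtain ⟨k0, k1, k2⟩ := h
  constructor
  · refine lt_of_le_of_ne (T.le₂₁ _ _) fun he => hν ?_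
    have e1 : T.φ₁ (θ 0) = T.ν₁ := by linarith [T.ν₁_le_φ₁ (θ 0), T.φ₂_le_ν₁ (θ 1)]
    rw [he, e1] at k1
    rw [e1] at k0
    nlinarith [sq_nonneg (p 0), sq_nonneg (p 1)]
  · refine lt_of_le_of_ne (T.φ₃_le_φ₂ hθ _) fun he => h0 ?_
    have e1 : T.φ₂ (θ 1) = 0 := by linarith [T.nonneg₂ (θ 1), T.nonpos₃ _ hθ]
    rw [he, e1] at k2
    rw [e1] at k1
    nlinarith [sq_nonneg (p 1), sq_nonneg (p 2)]

lemma Deck.sep {θ p θ' p' : Fin 3 → ℝ} (h : T.Deck θ p θ' p') (hθ : θ 2 ∈ Icc (-T.N) T.N)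
    (hs : T.Sep c₁ c₂ θ p) : T.Sep c₁ c₂ θ' p' := by
  have := h.sq_eq
  obtain ⟨b, b', hb, -⟩ := h
  simpa only [Sep, hb.φ₁_eq, hb.φ₂_eq, hb.φ₃_eq hθ, this] using hs

lemma pos_of_continuousOn {f : ℝ → ℝ} {I : Set ℝ} (hI : IsPreconnected I) (hf : ContinuousOn f I)
    (h0 : ∀ s ∈ I, f s ≠ 0) {s s' : ℝ} (hs : s ∈ I) (hs' : s' ∈ I) (h : 0 < f s) : 0 < f s' := by
  by_contra hn
  obtain ⟨r, hr, hr0⟩ := hI.intermediate_value hs' hs hf ⟨not_lt.1 hn, h.le⟩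
  exact h0 r hr hr0

lemma eqOn_of_hasDerivAt_zero {F : Type*} [NormedAddCommGroup F] [NormedSpace ℝ F] {f : ℝ → F}
    {a b : ℝ} (h : ∀ s ∈ Ioo a b, HasDerivAt f 0 s) {s s' : ℝ} (hs : s ∈ Ioo a b)
    (hs' : s' ∈ Ioo a b) : f s = f s' := by
  refine isOpen_Ioo.is_const_of_deriv_eq_zero isPreconnected_Ioo
    (fun r hr => (h r hr).differentiableAt.differentiableWithinAt) (fun r hr => (h r hr).deriv)
    hs hs'

variable (T) in
/-- The curve `c` has at the time `t` a covector on the given level with `E > 0`. -/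
def PosAt (c₁ c₂ : ℝ) (E : (Fin 3 → ℝ) → (Fin 3 → ℝ) → ℝ) (c : ℝ → T.X) (t : ℝ) : Prop :=
  ∃ θ p, T.LiftAt c t θ p ∧ T.Sep c₁ c₂ θ p ∧ 0 < E θ p

variable {E : (Fin 3 → ℝ) → (Fin 3 → ℝ) → ℝ} {c : ℝ → T.X}

/-- Along the local lift the integrals are constant, so the lift stays on the level, where the
continuous function `E` has no zeros and thus keeps its sign. Deck invariance makes the given lift
at time `s` as good as the local one. -/
lemma IsGeodesicAt.exists_nhds_posAt (hE : T.IsSignFunction c₁ c₂ E) {t : ℝ}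
    (h : T.IsGeodesicAt c t) (hS : c t ∉ T.proj '' T.S) :
    ∃ W ∈ 𝓝 t, ∀ s ∈ W, ∀ s' ∈ W, T.PosAt c₁ c₂ E c s → T.PosAt c₁ c₂ E c s' := by
  obtain ⟨ϑ, p, hev⟩ := h.exists_flow hS
  obtain ⟨δ, hδ, hball⟩ := Metric.eventually_nhds_iff_ball.1 hev
  rw [Real.ball_eq_Ioo] at hball
  refine ⟨Ioo (t - δ) (t + δ), Ioo_mem_nhds (by linarith) (by linarith), ?_⟩
  rintro s hs s' hs' ⟨θ, q, hl, hsep, hpos⟩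
  have hD := hl.deck (hball s hs).1
  have hsep' := hD.sep hl.over.1 hsep
  have hint : ∀ r ∈ Ioo (t - δ) (t + δ), T.Sep c₁ c₂ (ϑ r) (p r) := by
    intro r hr
    obtain ⟨-, -, -, -, h1, h2⟩ := hball s hs
    obtain ⟨-, -, -, -, h1', h2'⟩ := hball r hr
    rw [Sep.ints_eq h1' h2']
    rw [Sep.ints_eq h1 h2] at hsep'
    rw [← hsep']
    exact eqOn_of_hasDerivAt_zero (fun r hr => (hball r hr).2.2.2.1) hr hs
  refine ⟨ϑ s', p s', (hball s' hs').1, hint s' hs', ?_⟩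
  refine pos_of_continuousOn (f := fun r => E (ϑ r) (p r)) isPreconnected_Ioo
    (fun r hr => ContinuousAt.continuousWithinAt ?_)
    (fun r hr => hE.ne_zero _ _ (hball r hr).1.over.1 (hint r hr)) hs hs' ?_
  · exact ContinuousAt.comp (x := r) (f := fun r => (ϑ r, p r))
      (g := fun z : (Fin 3 → ℝ) × (Fin 3 → ℝ) => E z.1 z.2) hE.continuous.continuousAt
      ((hball r hr).2.1.prodMk (hball r hr).2.2.1)
  · simpa only [hE.deck _ _ _ _ hD] using hpos

/-- A geodesic on the level cannot run into the branch set. The inequalities `quad (φ₁) ≥ 0`, `quad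
(φ₂) ≤ 0`, `quad (φ₃) ≥ 0` need no momenta, so they pass to the limit along a lift which is merely
continuous at `t`. -/
lemma IsGeodesicAt.notMem_of_frequently (h0 : quad c₁ c₂ 0 ≠ 0) (hν : quad c₁ c₂ T.ν₁ ≠ 0)
    {t : ℝ} (h : T.IsGeodesicAt c t) (hf : ∃ᶠ s in 𝓝 t, T.PosAt c₁ c₂ E c s) :
    c t ∉ T.proj '' T.S := by
  obtain ⟨ϑ, hc, ho⟩ := h.exists_lift
  rw [ho.self_of_nhds.mem_proj_S_iff]
  have hk := fun k => (continuous_apply (A := fun _ : Fin 3 => ℝ) k).continuousAt.comp hc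
  have hf' : ∃ᶠ s in 𝓝 t, 0 ≤ quad c₁ c₂ (T.φ₁ (ϑ s 0)) ∧ quad c₁ c₂ (T.φ₂ (ϑ s 1)) ≤ 0 ∧
      0 ≤ quad c₁ c₂ (T.φ₃ (ϑ s 2)) := by
    refine (hf.and_eventually ho).mono ?_
    rintro s ⟨⟨θ, p, hl, ⟨s0, s1, s2⟩, -⟩, hs⟩
    obtain ⟨b, b', hb⟩ := hl.over.exists_deckPt hs
    rw [hb.φ₁_eq, hb.φ₂_eq, hb.φ₃_eq hl.over.1]
    exact ⟨s0 ▸ sq_nonneg _, by linarith [sq_nonneg (p 1)], s2 ▸ sq_nonneg _⟩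
  have l0 : Tendsto (fun s => quad c₁ c₂ (T.φ₁ (ϑ s 0))) (𝓝 t) (𝓝 (quad c₁ c₂ (T.φ₁ (ϑ t 0)))) :=
    ((continuous_quad c₁ c₂).comp T.smooth₁.continuous).continuousAt.comp (hk 0)
  have l1 : Tendsto (fun s => quad c₁ c₂ (T.φ₂ (ϑ s 1))) (𝓝 t) (𝓝 (quad c₁ c₂ (T.φ₂ (ϑ t 1)))) :=
    ((continuous_quad c₁ c₂).comp T.smooth₂.continuous).continuousAt.comp (hk 1)
  have l2 : Tendsto (fun s => quad c₁ c₂ (T.φ₃ (ϑ s 2))) (𝓝 t) (𝓝 (quad c₁ c₂ (T.φ₃ (ϑ t 2)))) := by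
    refine ((continuous_quad c₁ c₂).tendsto _).comp ?_
    refine (T.smooth₃.continuousOn _ ho.self_of_nhds.1).tendsto.comp ?_
    exact tendsto_nhdsWithin_iff.2 ⟨hk 2, ho.mono fun s hs => hs.1⟩
  have m0 := ge_of_tendsto_of_frequently l0 (hf'.mono fun s hs => hs.1)
  have m1 := le_of_tendsto_of_frequently l1 (hf'.mono fun s hs => hs.2.1)
  have m2 := ge_of_tendsto_of_frequently l2 (hf'.mono fun s hs => hs.2.2)
  rintro (he | he)
  · refine hν ?_
    have e1 : T.φ₁ (ϑ t 0) = T.ν₁ := by linarith [T.ν₁_le_φ₁ (ϑ t 0), T.φ₂_le_ν₁ (ϑ t 1)]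
    rw [← he, e1] at m1
    rw [e1] at m0
    exact le_antisymm m1 m0
  · refine h0 ?_
    have e1 : T.φ₂ (ϑ t 1) = 0 := by
      linarith [T.nonneg₂ (ϑ t 1), T.nonpos₃ _ ho.self_of_nhds.1]
    rw [← he, e1] at m2
    rw [e1] at m1
    exact le_antisymm m1 m2

/-- The set of good times is open and relatively closed: a limit of good times is off the branch
set, where the property is locally constant. -/
lemma posAt_of_posAt (h0 : quad c₁ c₂ 0 ≠ 0) (hν : quad c₁ c₂ T.ν₁ ≠ 0)
    (hE : T.IsSignFunction c₁ c₂ E) {t₁ : ℝ} (hgeo : ∀ t ∈ Ioo 0 t₁, T.IsGeodesicAt c t)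
    {s : ℝ} (hs : s ∈ Ioo 0 t₁) (h : T.PosAt c₁ c₂ E c s) {t : ℝ} (ht : t ∈ Ioo 0 t₁) :
    T.PosAt c₁ c₂ E c t := by
  set u : Set ℝ := {r | r ∈ Ioo 0 t₁ ∧ T.PosAt c₁ c₂ E c r}
  have key : ∀ r ∈ Ioo 0 t₁, r ∈ closure u → u ∈ 𝓝 r := by
    intro r hr hru
    have hf : ∃ᶠ s in 𝓝 r, T.PosAt c₁ c₂ E c s :=
      (mem_closure_iff_frequently.1 hru).mono fun s hs => hs.2
    obtain ⟨W, hW, hWW⟩ := (hgeo r hr).exists_nhds_posAt hE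
      ((hgeo r hr).notMem_of_frequently h0 hν hf)
    obtain ⟨s, hs, hsW⟩ := (hf.and_eventually hW).exists
    filter_upwards [hW, isOpen_Ioo.mem_nhds hr] with s' hs' hs''
    exact ⟨hs'', hWW s hsW s' hs' hs⟩
  have hopen : IsOpen u := isOpen_iff_mem_nhds.2 fun r hr => key r hr.1 (subset_closure hr)
  have := isPreconnected_Ioo.subset_of_closure_inter_subset hopen ⟨s, hs, hs, h⟩
    (fun r hr => mem_of_mem_nhds (key r hr.2 hr.1)) ht
  exact this.2

/-! ### Invariants of the billiard ball map -/

lemma HasBoundaryCovector.eventually_liftAt {t₀ : ℝ} {u : Fin 4 → ℝ} {p₃ : ℝ} {l : Filter ℝ}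
    (hl : ∀ P : ℝ → Prop, (∀ᶠ t in l, P t) → ∀ᶠ t in l, ∀ᶠ s in 𝓝 t, P s)
    (h : T.HasBoundaryCovector c t₀ l u p₃) :
    ∃ θ p : ℝ → Fin 3 → ℝ, (∀ᶠ t in l, T.LiftAt c t (θ t) (p t)) ∧
      Tendsto θ l (𝓝 ![u 0, u 1, T.N]) ∧ Tendsto p l (𝓝 ![u 2, u 3, p₃]) := by
  obtain ⟨-, θ, v, hev, h1, h2⟩ := h
  refine ⟨θ, _, ?_, h1, h2⟩
  filter_upwards [hl _ hev] with t ht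
  exact ⟨θ, v t, rfl, ht.mono fun s hs => hs.1, ht.self_of_nhds.2, rfl⟩

lemma tendsto_φ {l : Filter ℝ} {u : Fin 4 → ℝ} {θ p : ℝ → Fin 3 → ℝ}
    (hlift : ∀ᶠ t in l, T.LiftAt c t (θ t) (p t)) (hθ : Tendsto θ l (𝓝 ![u 0, u 1, T.N])) :
    Tendsto (fun t => T.φ₁ (θ t 0)) l (𝓝 (T.φ₁ (u 0))) ∧
    Tendsto (fun t => T.φ₂ (θ t 1)) l (𝓝 (T.φ₂ (u 1))) ∧
    Tendsto (fun t => T.φ₃ (θ t 2)) l (𝓝 T.ν₃) := by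
  have h := tendsto_pi_nhds.1 hθ
  refine ⟨(T.smooth₁.continuous.tendsto _).comp (h 0), (T.smooth₂.continuous.tendsto _).comp (h 1),
    (T.smooth₃.continuousOn _ T.N_mem).tendsto.comp (tendsto_nhdsWithin_iff.2 ⟨h 2, ?_⟩)⟩
  exact hlift.mono fun t ht => ht.over.1

lemma eventually_eventually_of_isOpen {a : ℝ} {S : Set ℝ} (hS : IsOpen S) (P : ℝ → Prop)
    (h : ∀ᶠ t in 𝓝[S] a, P t) : ∀ᶠ t in 𝓝[S] a, ∀ᶠ s in 𝓝 t, P s := by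
  filter_upwards [eventually_eventually_nhdsWithin.2 h, self_mem_nhdsWithin] with t h1 h2
  rwa [hS.nhdsWithin_eq h2] at h1

lemma over_base (u : Fin 4 → ℝ) : T.Over ![u 0, u 1, T.N] (T.base (T.cover u)) := ⟨T.N_mem, rfl⟩

lemma lt_of_cover_mem_coball {u : Fin 4 → ℝ} (h : T.cover u ∈ T.coball) :
    T.φ₂ (u 1) < T.φ₁ (u 0) := ((over_base u).lt_of_notMem h.1).1

lemma ν₃_lt (t : ℝ) : T.ν₃ < T.φ₂ t := T.ν₃_neg.trans_le (T.nonneg₂ t)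

lemma Pi3_pos (s t : ℝ) : 0 < Pi3 (T.φ₁ s) (T.φ₂ t) T.ν₃ :=
  mul_pos (sub_pos.2 ((ν₃_lt t).trans_le (T.le₂₁ s t))) (sub_pos.2 (ν₃_lt t))

lemma piPlus₃_sq {u : Fin 4 → ℝ}
    (h : tangNormSq (T.φ₁ (u 0)) (T.φ₂ (u 1)) T.ν₃ (u 2) (u 3) ≤ 1) :
    T.piPlus₃ u ^ 2 = Pi3 (T.φ₁ (u 0)) (T.φ₂ (u 1)) T.ν₃ *
      (1 - tangNormSq (T.φ₁ (u 0)) (T.φ₂ (u 1)) T.ν₃ (u 2) (u 3)) := by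
  rw [piPlus₃, inwardMomentum, neg_sq, mul_pow, Real.sq_sqrt (Pi3_pos _ _).le,
    Real.sq_sqrt (by linarith)]

lemma piPlus₃_neg {u : Fin 4 → ℝ} (h : T.cover u ∈ T.coball) : T.piPlus₃ u < 0 := by
  have : tangNormSq (T.φ₁ (u 0)) (T.φ₂ (u 1)) T.ν₃ (u 2) (u 3) < 1 := h.2
  exact neg_lt_zero.2 (mul_pos (Real.sqrt_pos.2 (Pi3_pos _ _)) (Real.sqrt_pos.2 (by linarith)))

lemma sep_of_mem_level {u : Fin 4 → ℝ} (h : T.cover u ∈ T.level c₁ c₂) :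
    T.Sep c₁ c₂ ![u 0, u 1, T.N] ![u 2, u 3, T.piPlus₃ u] := by
  obtain ⟨hc, h1, h2⟩ := h
  refine (separation (lt_of_cover_mem_coball hc) (ν₃_lt _)).1 ⟨?_, h1, h2⟩
  have h3 : tangNormSq (T.φ₁ (u 0)) (T.φ₂ (u 1)) T.ν₃ (u 2) (u 3) < 1 := hc.2
  have h4 := Pi3_pos (T := T) (u 0) (u 1)
  have e := piPlus₃_sq h3.le
  simp only [energy, Matrix.cons_val, e]
  rw [mul_div_cancel_left₀ _ h4.ne', tangNormSq]
  ring

lemma Sep.of_sq_eq {θ p p' : Fin 3 → ℝ} (h : T.Sep c₁ c₂ θ p) (hp : ∀ k, p' k ^ 2 = p k ^ 2) :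
    T.Sep c₁ c₂ θ p' := by
  simpa only [Sep, hp] using h

/-- Only `p₃²` enters the integrals, so the covector before reflection can be used; `p₃ ≠ 0` makes
the tangential part shorter than one. -/
lemma mem_level_of_sep (h0 : quad c₁ c₂ 0 ≠ 0) (hν : quad c₁ c₂ T.ν₁ ≠ 0) {u : Fin 4 → ℝ}
    {p₃ : ℝ} (hp : p₃ ≠ 0) (h : T.Sep c₁ c₂ ![u 0, u 1, T.N] ![u 2, u 3, p₃]) :
    T.cover u ∈ T.level c₁ c₂ := by
  have hlt := h.lt h0 hν (θ := ![u 0, u 1, T.N]) T.N_mem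
  have h4 := Pi3_pos (T := T) (u 0) (u 1)
  have he := (separation hlt.1 hlt.2).2 h
  simp only [Matrix.cons_val] at he
  have hn : tangNormSq (T.φ₁ (u 0)) (T.φ₂ (u 1)) T.ν₃ (u 2) (u 3) +
      p₃ ^ 2 / Pi3 (T.φ₁ (u 0)) (T.φ₂ (u 1)) T.ν₃ = 1 := he.1
  have hpos : 0 < p₃ ^ 2 / Pi3 (T.φ₁ (u 0)) (T.φ₂ (u 1)) T.ν₃ := by positivity
  have hlt1 : tangNormSq (T.φ₁ (u 0)) (T.φ₂ (u 1)) T.ν₃ (u 2) (u 3) < 1 := by linarith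
  have hsq : T.piPlus₃ u ^ 2 = p₃ ^ 2 := by
    rw [piPlus₃_sq hlt1.le, ← hn, add_sub_cancel_left, mul_div_cancel₀ _ h4.ne']
  have hmem : T.cover u ∈ T.coball := by
    refine ⟨?_, hlt1⟩
    rw [(over_base u).mem_proj_S_iff, not_or]
    exact ⟨hlt.1.ne', hlt.2.ne'⟩
  have h' : T.Sep c₁ c₂ ![u 0, u 1, T.N] ![u 2, u 3, T.piPlus₃ u] :=
    h.of_sq_eq fun k => by fin_cases k <;> simp [hsq]
  exact ⟨hmem, ((separation hlt.1 hlt.2).2 h').2⟩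

/-- With the trivial sign function, the preservation of the level becomes a special case of the
persistence of signs. -/
lemma isSignFunction_one : T.IsSignFunction c₁ c₂ fun _ _ => 1 :=
  ⟨continuous_const, fun _ _ _ _ _ => rfl, fun _ _ _ _ => one_ne_zero⟩

/-- The boundary covector is only a one-sided limit. Right after the start the integrals of the
given lift agree with those of the local flows up to deck transformations, so they are constant, and
the limit at the boundary identifies the constant. -/
lemma exists_posAt_of_hasBoundaryCovector (h0 : quad c₁ c₂ 0 ≠ 0) (hν : quad c₁ c₂ T.ν₁ ≠ 0)
    {t₁ : ℝ} (ht₁ : 0 < t₁) (hgeo : ∀ t ∈ Ioo 0 t₁, T.IsGeodesicAt c t)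
    {u : Fin 4 → ℝ} {p₃ : ℝ} (h : T.HasBoundaryCovector c 0 (𝓝[>] 0) u p₃)
    (hs : T.Sep c₁ c₂ ![u 0, u 1, T.N] ![u 2, u 3, p₃]) (hE : T.IsSignFunction c₁ c₂ E)
    (hpos : 0 < E ![u 0, u 1, T.N] ![u 2, u 3, p₃]) : ∃ s ∈ Ioo 0 t₁, T.PosAt c₁ c₂ E c s := by
  obtain ⟨θ, p, hl, hθ, hp⟩ := h.eventually_liftAt (eventually_eventually_of_isOpen isOpen_Ioi)
  obtain ⟨l1, l2, l3⟩ := tendsto_φ hl hθ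
  have hlt := hs.lt h0 hν (θ := ![u 0, u 1, T.N]) T.N_mem
  have hev : ∀ᶠ t in 𝓝[>] (0 : ℝ), T.LiftAt c t (θ t) (p t) ∧ T.φ₂ (θ t 1) < T.φ₁ (θ t 0) ∧
      T.φ₃ (θ t 2) < T.φ₂ (θ t 1) ∧ t < t₁ := by
    filter_upwards [hl, l2.eventually_lt l1 hlt.1, l3.eventually_lt l2 hlt.2,
      Ioo_mem_nhdsGT ht₁] with t h1 h2 h3 h4
    exact ⟨h1, h2, h3, h4.2⟩
  obtain ⟨δ, hδ, hI⟩ := mem_nhdsGT_iff_exists_Ioo_subset.1 hev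
  have hδ' : (0 : ℝ) < δ := hδ
  have hconst : ∀ t ∈ Ioo 0 δ, HasDerivAt (fun t => T.ints (θ t) (p t)) 0 t := by
    intro t ht
    have hS : c t ∉ T.proj '' T.S := by
      rw [(hI ht).1.over.mem_proj_S_iff, not_or]
      exact ⟨(hI ht).2.1.ne', (hI ht).2.2.1.ne'⟩
    obtain ⟨ϑ, q, hf⟩ := (hgeo t ⟨ht.1, (hI ht).2.2.2⟩).exists_flow hS
    refine hf.self_of_nhds.2.2.2.1.congr_of_eventuallyEq ?_
    filter_upwards [hf, isOpen_Ioo.mem_nhds ht] with r hr hr'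
    exact (hr.1.deck (hI hr').1).ints_eq hr.1.over.1
  have hlim : Tendsto (fun t => T.ints (θ t) (p t)) (𝓝[>] 0) (𝓝 (1, c₁, c₂)) := by
    rw [← (Sep.ints_eq (θ := ![u 0, u 1, T.N]) hlt.1 hlt.2).1 hs]
    have q := tendsto_pi_nhds.1 hp
    have q0 : Tendsto (fun t => p t 0) (𝓝[>] 0) (𝓝 (u 2)) := q 0
    have q1 : Tendsto (fun t => p t 1) (𝓝[>] 0) (𝓝 (u 3)) := q 1
    have q2 : Tendsto (fun t => p t 2) (𝓝[>] 0) (𝓝 p₃) := q 2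
    have n1 : T.φ₁ (u 0) - T.φ₂ (u 1) ≠ 0 := (sub_pos.2 hlt.1).ne'
    have n2 : T.φ₂ (u 1) - T.ν₃ ≠ 0 := (sub_pos.2 hlt.2).ne'
    have n3 : T.φ₁ (u 0) - T.ν₃ ≠ 0 := (sub_pos.2 (hlt.2.trans hlt.1)).ne'
    have r1 := (l1.sub l2).mul (l1.sub l3)
    have r2 := (l1.sub l2).mul (l2.sub l3)
    have r3 := (l1.sub l3).mul (l2.sub l3)
    have m1 := mul_ne_zero n1 n3
    have m2 := mul_ne_zero n1 n2
    have m3 := mul_ne_zero n3 n2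
    refine Tendsto.prodMk_nhds ?_ (Tendsto.prodMk_nhds ?_ ?_)
    · exact (((q0.pow 2).div r1 m1).add ((q1.pow 2).div r2 m2)).add ((q2.pow 2).div r3 m3)
    · exact ((((l2.add l3).mul (q0.pow 2)).div r1 m1).add
        (((l1.add l3).mul (q1.pow 2)).div r2 m2)).add (((l1.add l2).mul (q2.pow 2)).div r3 m3)
    · exact ((((l2.mul l3).mul (q0.pow 2)).div r1 m1).add
        (((l1.mul l3).mul (q1.pow 2)).div r2 m2)).add (((l1.mul l2).mul (q2.pow 2)).div r3 m3)
  have hE' : ∀ᶠ t in 𝓝[>] (0 : ℝ), 0 < E (θ t) (p t) := by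
    have : Tendsto (fun t => E (θ t) (p t)) (𝓝[>] 0)
        (𝓝 (E ![u 0, u 1, T.N] ![u 2, u 3, p₃])) :=
      (hE.continuous.tendsto (![u 0, u 1, T.N], ![u 2, u 3, p₃])).comp (hθ.prodMk_nhds hp)
    exact this.eventually_const_lt hpos
  obtain ⟨s, hs1, hs2⟩ := (hE'.and (Ioo_mem_nhdsGT hδ')).exists
  refine ⟨s, ⟨hs2.1, (hI hs2).2.2.2⟩, θ s, p s, (hI hs2).1, ?_, hs1⟩
  rw [Sep.ints_eq (hI hs2).2.1 (hI hs2).2.2.1]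
  refine tendsto_nhds_unique (tendsto_const_nhds.congr' ?_) hlim
  filter_upwards [Ioo_mem_nhdsGT hδ'] with r hr
  exact eqOn_of_hasDerivAt_zero hconst hs2 hr

lemma HasBoundaryCovector.pos_of_posAt {t₁ : ℝ} (ht₁ : 0 < t₁)
    (hpos : ∀ t ∈ Ioo 0 t₁, T.PosAt c₁ c₂ E c t) {u : Fin 4 → ℝ} {p₃ : ℝ}
    (h : T.HasBoundaryCovector c t₁ (𝓝[<] t₁) u p₃) (hE : T.IsSignFunction c₁ c₂ E) :
    T.Sep c₁ c₂ ![u 0, u 1, T.N] ![u 2, u 3, p₃] ∧ 0 < E ![u 0, u 1, T.N] ![u 2, u 3, p₃] := by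
  obtain ⟨θ, p, hl, hθ, hp⟩ := h.eventually_liftAt (eventually_eventually_of_isOpen isOpen_Iio)
  obtain ⟨l1, l2, l3⟩ := tendsto_φ hl hθ
  have hev : ∀ᶠ t in 𝓝[<] t₁, T.Sep c₁ c₂ (θ t) (p t) ∧ 0 < E (θ t) (p t) := by
    filter_upwards [hl, Ioo_mem_nhdsLT ht₁] with t h1 h2
    obtain ⟨θ', p', hl', hs, hE'⟩ := hpos t h2
    have hD := hl'.deck h1
    exact ⟨hD.sep hl'.over.1 hs, by rwa [hE.deck _ _ _ _ hD]⟩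
  have q := tendsto_pi_nhds.1 hp
  have q0 : Tendsto (fun t => p t 0) (𝓝[<] t₁) (𝓝 (u 2)) := q 0
  have q1 : Tendsto (fun t => p t 1) (𝓝[<] t₁) (𝓝 (u 3)) := q 1
  have q2 : Tendsto (fun t => p t 2) (𝓝[<] t₁) (𝓝 p₃) := q 2
  have hq := continuous_quad c₁ c₂
  have hsep : T.Sep c₁ c₂ ![u 0, u 1, T.N] ![u 2, u 3, p₃] := by
    refine ⟨tendsto_nhds_unique ((q0.pow 2).congr' ?_) ((hq.tendsto _).comp l1),
      tendsto_nhds_unique ((q1.pow 2).congr' ?_) ((hq.tendsto _).comp l2).neg,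
      tendsto_nhds_unique ((q2.pow 2).congr' ?_) ((hq.tendsto _).comp l3)⟩
    · exact hev.mono fun t ht => ht.1.1
    · exact hev.mono fun t ht => ht.1.2.1
    · exact hev.mono fun t ht => ht.1.2.2
  refine ⟨hsep, lt_of_le_of_ne ?_ (hE.ne_zero _ _ T.N_mem hsep).symm⟩
  have : Tendsto (fun t => E (θ t) (p t)) (𝓝[<] t₁)
      (𝓝 (E ![u 0, u 1, T.N] ![u 2, u 3, p₃])) :=
    (hE.continuous.tendsto (![u 0, u 1, T.N], ![u 2, u 3, p₃])).comp (hθ.prodMk_nhds hp)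
  exact ge_of_tendsto this (hev.mono fun t ht => ht.2.le)

/-- The billiard ball map preserves the level sets of the integrals, and it preserves the signs of
sign functions. -/
lemma BilliardStep.exists_coords (h0 : quad c₁ c₂ 0 ≠ 0) (hν : quad c₁ c₂ T.ν₁ ≠ 0)
    {ξ ξ' : T.Phase} (h : T.BilliardStep ξ ξ') (hξ : ξ ∈ T.level c₁ c₂) :
    ∃ u u', T.cover u = ξ ∧ T.cover u' = ξ' ∧ ξ' ∈ T.level c₁ c₂ ∧ T.piPlus₃ u < 0 ∧
      T.piPlus₃ u' < 0 ∧ ∀ E, T.IsSignFunction c₁ c₂ E →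
        0 < E ![u 0, u 1, T.N] ![u 2, u 3, T.piPlus₃ u] →
        0 < E ![u' 0, u' 1, T.N] ![u' 2, u' 3, -T.piPlus₃ u'] := by
  obtain ⟨hc, hc', u, u', t₁, c, rfl, rfl, ht₁, hb, hgeo, hb'⟩ := h
  have hs := sep_of_mem_level hξ
  have key : ∀ E, T.IsSignFunction c₁ c₂ E → 0 < E ![u 0, u 1, T.N] ![u 2, u 3, T.piPlus₃ u] →
      T.Sep c₁ c₂ ![u' 0, u' 1, T.N] ![u' 2, u' 3, -T.piPlus₃ u'] ∧
        0 < E ![u' 0, u' 1, T.N] ![u' 2, u' 3, -T.piPlus₃ u'] := by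
    intro E hE hpos
    obtain ⟨s, hs', hsp⟩ := exists_posAt_of_hasBoundaryCovector h0 hν ht₁ hgeo hb hs hE hpos
    exact HasBoundaryCovector.pos_of_posAt ht₁
      (fun t ht => posAt_of_posAt h0 hν hE hgeo hs' hsp ht) hb' hE
  have hn := piPlus₃_neg hc'
  exact ⟨u, u', rfl, rfl, mem_level_of_sep h0 hν (neg_ne_zero.2 hn.ne)
    (key _ isSignFunction_one one_pos).1, piPlus₃_neg hc, hn, fun E hE hp => (key E hE hp).2⟩

end ClassicalLBT

namespace ClassicalLBT

variable {T : ClassicalLBT} {c₁ c₂ : ℝ}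

/-! ### Coordinates on the phase space -/

lemma invCot_invCot (x : T.CotTorus) : T.invCot (T.invCot x) = x := by simp [invCot]

lemma cover_eq_cover_iff {u u' : Fin 4 → ℝ} : T.cover u = T.cover u' ↔
    ∃ b : Bool, (∃ m : ℤ, u' 0 = sgn b * u 0 + m * T.ω₁) ∧
      (∃ m : ℤ, u' 1 = sgn b * u 1 + (if b then 0 else T.ω₂ / 2) + m * T.ω₂) ∧
      u' 2 = sgn b * u 2 ∧ u' 3 = sgn b * u 3 := by
  constructor
  · intro h
    have key : ∀ x y : T.CotTorus, Relation.EqvGen (fun u v => v = T.invCot u) x y →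
        y = x ∨ y = T.invCot x := by
      intro x y hxy
      induction hxy with
      | rel x y h1 => exact Or.inr h1
      | refl x => exact Or.inl rfl
      | symm x y _ ih =>
        rcases ih with rfl | rfl
        · exact Or.inl rfl
        · exact Or.inr (invCot_invCot _).symm
      | trans x y z _ _ ih1 ih2 =>
        rcases ih1 with rfl | rfl <;> rcases ih2 with rfl | rfl <;> simp [invCot_invCot]
    rcases key _ _ (Quot.eqvGen_exact h) with h | h
    · simp only [Prod.mk.injEq] at h
      obtain ⟨m, hm⟩ := addCircle_coe_eq_iff.1 h.1.symm
      obtain ⟨n, hn⟩ := addCircle_coe_eq_iff.1 h.2.1.symm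
      exact ⟨true, ⟨m, by simpa using hm⟩, ⟨n, by simpa using hn⟩, by simp [h.2.2.1],
        by simp [h.2.2.2]⟩
    · simp only [invCot, Prod.mk.injEq] at h
      rw [← AddCircle.coe_neg, ← AddCircle.coe_sub] at h
      obtain ⟨m, hm⟩ := addCircle_coe_eq_iff.1 h.1.symm
      obtain ⟨n, hn⟩ := addCircle_coe_eq_iff.1 h.2.1.symm
      exact ⟨false, ⟨m, by simpa using hm⟩, ⟨n, by simp; linarith⟩, by simp [h.2.2.1],
        by simp [h.2.2.2]⟩
  · rintro ⟨b, ⟨m, hm⟩, ⟨n, hn⟩, h2, h3⟩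
    cases b
    · have h0 : ((u' 0 : ℝ) : AddCircle T.ω₁) = -(u 0 : AddCircle T.ω₁) := by
        rw [← AddCircle.coe_neg, eq_comm, addCircle_coe_eq_iff]
        exact ⟨m, by simpa using hm⟩
      have h1 : ((u' 1 : ℝ) : AddCircle T.ω₂) =
          ((T.ω₂ / 2 : ℝ) : AddCircle T.ω₂) - (u 1 : AddCircle T.ω₂) := by
        rw [← AddCircle.coe_sub, eq_comm, addCircle_coe_eq_iff]
        exact ⟨n, by simp at hn; linarith⟩
      refine Quot.sound ?_
      simp [invCot, h0, h1, h2, h3]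
    · have h0 : ((u' 0 : ℝ) : AddCircle T.ω₁) = (u 0 : AddCircle T.ω₁) := by
        rw [eq_comm, addCircle_coe_eq_iff]
        exact ⟨m, by simpa using hm⟩
      have h1 : ((u' 1 : ℝ) : AddCircle T.ω₂) = (u 1 : AddCircle T.ω₂) := by
        rw [eq_comm, addCircle_coe_eq_iff]
        exact ⟨n, by simpa using hn⟩
      simp [cover, h0, h1, h2, h3]

lemma exists_cover (ξ : T.Phase) : ∃ u, T.cover u = ξ := by
  obtain ⟨⟨x, y, p, q⟩, rfl⟩ := Quot.exists_rep ξ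
  obtain ⟨x, rfl⟩ := QuotientAddGroup.mk_surjective x
  obtain ⟨y, rfl⟩ := QuotientAddGroup.mk_surjective y
  exact ⟨![x, y, p, q], rfl⟩

lemma continuous_cover : Continuous T.cover := by
  have h0 : Continuous fun u : Fin 4 → ℝ => ((u 0 : ℝ) : AddCircle T.ω₁) :=
    (AddCircle.continuous_mk' _).comp (continuous_apply 0)
  have h1 : Continuous fun u : Fin 4 → ℝ => ((u 1 : ℝ) : AddCircle T.ω₂) :=
    (AddCircle.continuous_mk' _).comp (continuous_apply 1)
  exact continuous_quot_mk.comp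
    (h0.prodMk (h1.prodMk ((continuous_apply 2).prodMk (continuous_apply 3))))

/-! ### Generic levels -/

variable (T c₁ c₂) in
/-- The values of the integrals whose level sets are unions of Liouville tori, described by the
signs of the polynomial `x² - c₁ x + c₂`. -/
structure IsGeneric : Prop where
  zero_ne : quad c₁ c₂ 0 ≠ 0
  ν₁_ne : quad c₁ c₂ T.ν₁ ≠ 0
  ν₃_pos : 0 < quad c₁ c₂ T.ν₃
  exists₁ : ∃ t, 0 < quad c₁ c₂ (T.φ₁ t)
  exists₂ : ∃ t, quad c₁ c₂ (T.φ₂ t) < 0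

namespace IsGeneric

/-- The third separated equation only determines `p₃`, and it has a nonzero solution because `quad`
is positive at `ν₃`. -/
lemma mem_level_iff (h : T.IsGeneric c₁ c₂) {u : Fin 4 → ℝ} : T.cover u ∈ T.level c₁ c₂ ↔
    u 2 ^ 2 = quad c₁ c₂ (T.φ₁ (u 0)) ∧ u 3 ^ 2 = -quad c₁ c₂ (T.φ₂ (u 1)) := by
  constructor
  · intro hu
    have := sep_of_mem_level hu
    exact ⟨this.1, this.2.1⟩
  · rintro ⟨h1, h2⟩
    refine mem_level_of_sep h.zero_ne h.ν₁_ne (p₃ := √(quad c₁ c₂ T.ν₃))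
      (Real.sqrt_pos.2 h.ν₃_pos).ne' ⟨h1, h2, Real.sq_sqrt h.ν₃_pos.le⟩

lemma quad_max_pos (h : T.IsGeneric c₁ c₂) : 0 < quad c₁ c₂ (T.φ₁ (T.ω₁ / 4)) := by
  obtain ⟨s, hs⟩ := h.exists₂
  obtain ⟨t, ht⟩ := h.exists₁
  rcases (T.profile₁.mem_Icc t).2.eq_or_lt with he | hlt
  · rwa [← he]
  · exact ht.trans (quad_lt_of_neg hs ht.le (T.le₂₁ _ _) hlt)

lemma quad_pos_of_le_zero (h : T.IsGeneric c₁ c₂) (h0 : 0 < quad c₁ c₂ 0) {x : ℝ} (hx : x ≤ 0) :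
    0 < quad c₁ c₂ x := by
  obtain ⟨s, hs⟩ := h.exists₂
  by_contra hn
  exact absurd (quad_convex (not_lt.1 hn) hs.le hx (T.nonneg₂ s)) (not_le.2 h0)

lemma quad_pos_of_ν₁_le (h : T.IsGeneric c₁ c₂) (h0 : 0 < quad c₁ c₂ T.ν₁) {x : ℝ}
    (hx : T.ν₁ ≤ x) : 0 < quad c₁ c₂ x := by
  obtain ⟨s, hs⟩ := h.exists₂
  by_contra hn
  exact absurd (quad_convex hs.le (not_lt.1 hn) (T.φ₂_le_ν₁ s) hx) (not_le.2 h0)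

end IsGeneric

lemma quad_neg_of_mem (h0 : quad c₁ c₂ 0 < 0) (hν : quad c₁ c₂ T.ν₁ < 0) {x : ℝ} (hx : 0 ≤ x)
    (hx' : x ≤ T.ν₁) : quad c₁ c₂ x < 0 := by
  have := T.ν₁_pos
  simp only [quad] at *
  -- The quantity is `x quad(ν₁) + (ν₁ - x) quad(0) - ν₁ x (ν₁ - x)`.
  have h1 : T.ν₁ * (x ^ 2 - c₁ * x + c₂) < 0 := by
    rcases hx.eq_or_lt with rfl | hx0
    · nlinarith
    · nlinarith [mul_pos hx0 (neg_pos.2 hν), mul_nonneg (sub_nonneg.2 hx') (neg_pos.2 h0).le,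
        mul_nonneg (mul_nonneg hx (sub_nonneg.2 hx')) this.le]
  by_contra hn
  exact absurd (mul_nonneg this.le (not_lt.1 hn)) (not_le.2 h1)

/-! ### Sign functions -/

section Trig

lemma sin_period_eq_zero {l θ : ℝ} (hl : 0 < l) (h : Real.sin (2 * Real.pi / l * θ) = 0) :
    ∃ k : ℤ, θ = k * (l / 2) := by
  obtain ⟨k, hk⟩ := Real.sin_eq_zero_iff.1 h
  refine ⟨k, ?_⟩
  have := Real.pi_pos
  field_simp at hk
  linarith

lemma cos_period_eq_zero {l θ : ℝ} (hl : 0 < l) (h : Real.cos (2 * Real.pi / l * θ) = 0) :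
    ∃ k : ℤ, θ = l / 4 + k * (l / 2) := by
  obtain ⟨k, hk⟩ := Real.cos_eq_zero_iff.1 h
  refine ⟨k, ?_⟩
  have := Real.pi_pos
  field_simp at hk
  linarith

lemma sin_deck {l θ θ' : ℝ} (hl : 0 < l) (b b' : Bool) {m : ℤ}
    (h : θ' - sgn b * sgn b' * θ - (if b then 0 else l / 2) = m * l) :
    Real.sin (2 * Real.pi / l * θ') = sgn b' * Real.sin (2 * Real.pi / l * θ) := by
  have e : 2 * Real.pi / l * θ' = sgn b * sgn b' * (2 * Real.pi / l * θ) +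
      (if b then 0 else Real.pi) + m * (2 * Real.pi) := by
    rw [show θ' = sgn b * sgn b' * θ + (if b then 0 else l / 2) + m * l by linarith]
    cases b <;> simp <;> field_simp
  rw [e, Real.sin_add_int_mul_two_pi]
  cases b <;> cases b' <;> simp [Real.sin_add_pi]

lemma cos_deck {l θ θ' : ℝ} (hl : 0 < l) (b b' : Bool) {m : ℤ}
    (h : θ' - sgn b * sgn b' * θ - (if b then 0 else l / 2) = m * l) :
    Real.cos (2 * Real.pi / l * θ') = sgn b * Real.cos (2 * Real.pi / l * θ) := by
  have e : 2 * Real.pi / l * θ' = sgn b * sgn b' * (2 * Real.pi / l * θ) +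
      (if b then 0 else Real.pi) + m * (2 * Real.pi) := by
    rw [show θ' = sgn b * sgn b' * θ + (if b then 0 else l / 2) + m * l by linarith]
    cases b <;> simp <;> field_simp
  rw [e, Real.cos_add_int_mul_two_pi]
  cases b <;> cases b' <;> simp [Real.cos_add_pi]

lemma sin_neg_deck {l θ θ' : ℝ} (hl : 0 < l) (b : Bool) {m : ℤ} (h : θ' - sgn b * θ = m * l) :
    Real.sin (2 * Real.pi / l * θ') = sgn b * Real.sin (2 * Real.pi / l * θ) := by
  have e : 2 * Real.pi / l * θ' = sgn b * (2 * Real.pi / l * θ) + m * (2 * Real.pi) := by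
    rw [show θ' = sgn b * θ + m * l by linarith]
    field_simp
  rw [e, Real.sin_add_int_mul_two_pi]
  cases b <;> simp

end Trig

variable (T) in
/-- `sin (2πθ₂/ω₂)` -/
def sin₂ (x : ℝ) : ℝ := Real.sin (2 * Real.pi / T.ω₂ * x)

variable (T) in
/-- `cos (2πθ₂/ω₂)` -/
def cos₂ (x : ℝ) : ℝ := Real.cos (2 * Real.pi / T.ω₂ * x)

variable (T) in
/-- `sin (2πθ₁/ω₁)` -/
def sin₁ (x : ℝ) : ℝ := Real.sin (2 * Real.pi / T.ω₁ * x)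

/-- Here `quad > 0` on all of `x ≤ 0`, so `p₃` never vanishes, and `φ₂ = 0` is forbidden, so neither
does `sin₂`. Both factors change by `sgn b'` under the deck group. The scalar `e` serves to make the
initial value positive. -/
lemma isSignFunction_sin₂ (h : T.IsGeneric c₁ c₂) (h0 : 0 < quad c₁ c₂ 0) {e : ℝ} (he : e ≠ 0) :
    T.IsSignFunction c₁ c₂ fun θ p => e * (T.sin₂ (θ 1) * p 2) where
  continuous := by unfold sin₂; fun_prop
  deck := by
    rintro θ p θ' p' ⟨b, b', ⟨-, ⟨m, hm⟩, -⟩, rfl⟩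
    simp only [sin₂, sin_deck T.ω₂_pos b b' hm, Matrix.cons_val]
    linear_combination (e * Real.sin (2 * Real.pi / T.ω₂ * θ 1) * p 2) * sgn_mul_self b'
  ne_zero := by
    rintro θ p hθ ⟨-, h1, h2⟩
    refine mul_ne_zero he (mul_ne_zero ?_ ?_)
    · intro hs
      rw [(T.min₂_iff _).2 (sin_period_eq_zero T.ω₂_pos hs)] at h1
      nlinarith [sq_nonneg (p 1)]
    · intro hs
      rw [hs] at h2
      have := h.quad_pos_of_le_zero h0 (T.nonpos₃ _ hθ)
      rw [← h2] at this
      norm_num at this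

/-- Now `p₁` never vanishes, and `φ₂ = ν₁` is forbidden, which are the zeros of `cos₂`. Both factors
change by `sgn b`. -/
lemma isSignFunction_cos₂ (h : T.IsGeneric c₁ c₂) (h0 : 0 < quad c₁ c₂ T.ν₁) {e : ℝ}
    (he : e ≠ 0) : T.IsSignFunction c₁ c₂ fun θ p => e * (p 0 * T.cos₂ (θ 1)) where
  continuous := by unfold cos₂; fun_prop
  deck := by
    rintro θ p θ' p' ⟨b, b', ⟨-, ⟨m, hm⟩, -⟩, rfl⟩
    simp only [cos₂, cos_deck T.ω₂_pos b b' hm, Matrix.cons_val]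
    linear_combination (e * Real.cos (2 * Real.pi / T.ω₂ * θ 1) * p 0) * sgn_mul_self b
  ne_zero := by
    rintro θ p hθ ⟨h1, h2, -⟩
    refine mul_ne_zero he (mul_ne_zero ?_ ?_)
    · intro hs
      rw [hs] at h1
      have := h.quad_pos_of_ν₁_le h0 (T.ν₁_le_φ₁ (θ 0))
      rw [← h1] at this
      norm_num at this
    · intro hs
      rw [(T.max₂_iff _).2 (cos_period_eq_zero T.ω₂_pos hs)] at h2
      nlinarith [sq_nonneg (p 1)]

/-- Since `quad < 0` on `[0, ν₁]`, `p₂` never vanishes, `φ₁ = ν₁` is forbidden, and so is `φ₃ = 0`,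
that is `θ₃ = 0`. The deck signs `sgn b`, `sgn b sgn b'` and `sgn b'` of the three factors multiply
to one. -/
lemma isSignFunction_sin₁ (h0 : quad c₁ c₂ 0 < 0) (hν : quad c₁ c₂ T.ν₁ < 0) {e : ℝ}
    (he : e ≠ 0) : T.IsSignFunction c₁ c₂ fun θ p => e * (T.sin₁ (θ 0) * p 1 * θ 2) where
  continuous := by unfold sin₁; fun_prop
  deck := by
    rintro θ p θ' p' ⟨b, b', ⟨⟨m, hm⟩, -, h2⟩, rfl⟩
    rw [show θ' 2 = sgn b' * θ 2 by linarith]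
    simp only [sin₁, sin_neg_deck T.ω₁_pos b hm, Matrix.cons_val]
    cases b <;> cases b' <;> simp
  ne_zero := by
    rintro θ p hθ ⟨h1, h2, h3⟩
    refine mul_ne_zero he (mul_ne_zero (mul_ne_zero ?_ ?_) ?_)
    · intro hs
      rw [(T.min₁_iff _).2 (sin_period_eq_zero T.ω₁_pos hs)] at h1
      nlinarith [sq_nonneg (p 0)]
    · intro hs
      have := quad_neg_of_mem h0 hν (T.nonneg₂ (θ 1)) (T.φ₂_le_ν₁ (θ 1))
      rw [hs] at h2
      linarith
    · intro hs
      rw [(T.max₃_iff _ hθ).2 hs] at h3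
      nlinarith [sq_nonneg (p 2)]

variable (T c₁ c₂) in
/-- Two covectors of `Γ` with coordinates `u` and `u'` agree in the signs which distinguish the
components of a level set, except that the sign of `sin (2πθ₂/ω₂)` is multiplied by `e`. -/
def SameSigns (e : ℝ) (u u' : Fin 4 → ℝ) : Prop :=
  (0 < quad c₁ c₂ 0 → 0 < e * (T.sin₂ (u 1) * T.sin₂ (u' 1))) ∧
  (0 < quad c₁ c₂ T.ν₁ → 0 < u 2 * T.cos₂ (u 1) * (u' 2 * T.cos₂ (u' 1))) ∧
  (quad c₁ c₂ 0 < 0 → quad c₁ c₂ T.ν₁ < 0 →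
    0 < T.sin₁ (u 0) * u 3 * (T.sin₁ (u' 0) * u' 3))

lemma SameSigns.congr {e : ℝ} {u u' v v' : Fin 4 → ℝ} (h : T.SameSigns c₁ c₂ e u u')
    (hu : T.cover u = T.cover v) (hu' : T.cover u' = T.cover v') : T.SameSigns c₁ c₂ e v v' := by
  have key : ∀ u v, T.cover u = T.cover v → T.sin₂ (v 1) = T.sin₂ (u 1) ∧
      v 2 * T.cos₂ (v 1) = u 2 * T.cos₂ (u 1) ∧ T.sin₁ (v 0) * v 3 = T.sin₁ (u 0) * u 3 := by
    intro u v huv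
    obtain ⟨b, ⟨m, hm⟩, ⟨n, hn⟩, h2, h3⟩ := cover_eq_cover_iff.1 huv
    have hn' : v 1 - sgn b * sgn true * u 1 - (if b then 0 else T.ω₂ / 2) = n * T.ω₂ := by
      simp only [sgn_true]; linarith
    have hm' : v 0 - sgn b * u 0 = m * T.ω₁ := by linarith
    simp only [sin₂, cos₂, sin₁, sin_deck T.ω₂_pos b true hn', cos_deck T.ω₂_pos b true hn',
      sin_neg_deck T.ω₁_pos b hm', h2, h3]
    cases b <;> simp
  obtain ⟨a1, a2, a3⟩ := key u v hu
  obtain ⟨b1, b2, b3⟩ := key u' v' hu'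
  unfold SameSigns
  rw [a1, a2, a3, b1, b2, b3]
  exact h

lemma SameSigns.trans {e e' : ℝ} {u v w : Fin 4 → ℝ} (h : T.SameSigns c₁ c₂ e u v)
    (h' : T.SameSigns c₁ c₂ e' v w) : T.SameSigns c₁ c₂ (e * e') u w := by
  have key : ∀ x y z : ℝ, 0 < x * y → 0 < y * z → 0 < x * z := by
    intro x y z h1 h2
    by_contra hn
    nlinarith [mul_pos h1 h2, mul_nonneg (neg_nonneg.2 (not_lt.1 hn)) (sq_nonneg y)]
  refine ⟨fun h0 => ?_, fun h0 => key _ _ _ (h.2.1 h0) (h'.2.1 h0),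
    fun h0 h1 => key _ _ _ (h.2.2 h0 h1) (h'.2.2 h0 h1)⟩
  have h1 := h.1 h0
  have h2 := h'.1 h0
  have := key (e * T.sin₂ (u 1)) (T.sin₂ (v 1)) (e' * T.sin₂ (w 1)) (by linarith) (by linarith)
  linarith

/-- A geodesic leaves with `p₃ < 0` and arrives with `p₃ > 0`. Hence the persistence of `sin₂ · p₃`
flips `sin₂`, while the other two functions contain no `p₃` and have `θ₃ = N` at both ends. This is
the factor `-1`, and the reason for using `B²`. -/
lemma BilliardStep.sameSigns (hg : T.IsGeneric c₁ c₂) {u u' : Fin 4 → ℝ}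
    (h : T.BilliardStep (T.cover u) (T.cover u')) (hu : T.cover u ∈ T.level c₁ c₂) :
    T.cover u' ∈ T.level c₁ c₂ ∧ T.SameSigns c₁ c₂ (-1) u u' := by
  obtain ⟨v, v', hv, hv', hl, hn, hn', hE⟩ := h.exists_coords hg.zero_ne hg.ν₁_ne hu
  refine ⟨hl, SameSigns.congr ?_ hv hv'⟩
  have hs := sep_of_mem_level (hv ▸ hu)
  refine ⟨fun h0 => ?_, fun h0 => ?_, fun h0 h1 => ?_⟩
  · have hne := (isSignFunction_sin₂ hg h0 one_ne_zero).ne_zero _ _ T.N_mem hs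
    -- The scalar is the initial value of the function itself, so that the scaled function starts at
    -- a positive square.
    have := hE _ (isSignFunction_sin₂ hg h0 (right_ne_zero_of_mul hne)) ?_
    · simp only [Matrix.cons_val] at this
      have e : T.sin₂ (v 1) * T.piPlus₃ v * (T.sin₂ (v' 1) * -T.piPlus₃ v') =
        -1 * (T.sin₂ (v 1) * T.sin₂ (v' 1)) * (T.piPlus₃ v * T.piPlus₃ v') := by ring
      rw [e] at this
      exact pos_of_mul_pos_left this (mul_pos_of_neg_of_neg hn hn').le
    · exact mul_self_pos.2 (right_ne_zero_of_mul hne)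
  · have hne := (isSignFunction_cos₂ hg h0 one_ne_zero).ne_zero _ _ T.N_mem hs
    exact hE _ (isSignFunction_cos₂ hg h0 (right_ne_zero_of_mul hne))
      (mul_self_pos.2 (right_ne_zero_of_mul hne))
  · have hne := (isSignFunction_sin₁ h0 h1 one_ne_zero).ne_zero _ _ T.N_mem hs
    have := hE _ (isSignFunction_sin₁ h0 h1 (right_ne_zero_of_mul hne))
      (mul_self_pos.2 (right_ne_zero_of_mul hne))
    simp only [Matrix.cons_val] at this
    have e : T.sin₁ (v 0) * v 3 * T.N * (T.sin₁ (v' 0) * v' 3 * T.N) =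
      T.sin₁ (v 0) * v 3 * (T.sin₁ (v' 0) * v' 3) * (T.N * T.N) := by ring
    rw [e] at this
    exact pos_of_mul_pos_left this (mul_self_nonneg _)

end ClassicalLBT

/-! ### Gluing of the quarters and signs of sine and cosine on them -/

lemma quarterPt_not_zero (l : ℝ) (s : Bool) : quarterPt l (!s) true 0 = quarterPt l s true 0 := by
  simp [quarterPt]

lemma quarterPt_not_quarter (l : ℝ) (s s' : Bool) :
    quarterPt l s (!s') (l / 4) = quarterPt l s s' (l / 4) := by
  cases s' <;> simp [quarterPt] <;> left <;> ring

lemma sin_quarterPt {l : ℝ} (hl : 0 < l) (s s' : Bool) (t : ℝ) :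
    Real.sin (2 * Real.pi / l * quarterPt l s s' t) = sgn s * Real.sin (2 * Real.pi / l * t) := by
  have e : 2 * Real.pi / l * (l / 2 - t) = Real.pi - 2 * Real.pi / l * t := by field_simp
  have e' : 2 * Real.pi / l * (t - l / 2) = 2 * Real.pi / l * t - Real.pi := by field_simp
  cases s <;> cases s' <;> simp [quarterPt, e, e', Real.sin_pi_sub, Real.sin_sub_pi]

lemma cos_quarterPt {l : ℝ} (hl : 0 < l) (s s' : Bool) (t : ℝ) :
    Real.cos (2 * Real.pi / l * quarterPt l s s' t) = sgn s' * Real.cos (2 * Real.pi / l * t) := by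
  have e : 2 * Real.pi / l * (l / 2 - t) = Real.pi - 2 * Real.pi / l * t := by field_simp
  have e' : 2 * Real.pi / l * (t - l / 2) = 2 * Real.pi / l * t - Real.pi := by field_simp
  cases s <;> cases s' <;> simp [quarterPt, e, e', Real.cos_pi_sub, Real.cos_sub_pi]

lemma sin_quarter_nonneg {l t : ℝ} (hl : 0 < l) (ht : t ∈ Icc 0 (l / 4)) :
    0 ≤ Real.sin (2 * Real.pi / l * t) := by
  have := Real.pi_pos
  refine Real.sin_nonneg_of_nonneg_of_le_pi (mul_nonneg (by positivity) ht.1) ?_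
  have := ht.2
  rw [div_mul_eq_mul_div, div_le_iff₀ hl]
  nlinarith

lemma cos_quarter_nonneg {l t : ℝ} (hl : 0 < l) (ht : t ∈ Icc 0 (l / 4)) :
    0 ≤ Real.cos (2 * Real.pi / l * t) := by
  have := Real.pi_pos
  have h1 : 0 ≤ 2 * Real.pi / l * t := mul_nonneg (by positivity) ht.1
  refine Real.cos_nonneg_of_mem_Icc ⟨by linarith, ?_⟩
  have := ht.2
  rw [div_mul_eq_mul_div, div_le_iff₀ hl]
  nlinarith

lemma sgn_eq_of_mul_pos {b b' : Bool} {x y : ℝ} (hx : 0 ≤ x) (hy : 0 ≤ y)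
    (h : 0 < sgn b * x * (sgn b' * y)) : b = b' := by
  have := mul_nonneg hx hy
  cases b <;> cases b' <;> simp at h ⊢ <;> linarith

namespace ClassicalLBT

variable {T : ClassicalLBT} {c₁ c₂ : ℝ}

/-! ### Connected components of generic levels -/

variable (T c₁ c₂) in
/-- The first coordinates, in the first quarter of the period, of the points of a level set. -/
def dom₁ : Set ℝ := {t ∈ Icc 0 (T.ω₁ / 4) | 0 ≤ quad c₁ c₂ (T.φ₁ t)}

variable (T c₁ c₂) in
/-- The second coordinates, in the first quarter of the period, of the points of a level set. -/
def dom₂ : Set ℝ := {t ∈ Icc 0 (T.ω₂ / 4) | quad c₁ c₂ (T.φ₂ t) ≤ 0}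

variable (T c₁ c₂) in
/-- Parametrizations of the level sets of the integrals by points of the first quarters of the
periods; the signs select quarters and branches of the square roots. -/
def piecePt (i j : Bool × Bool × Bool) (z : ℝ × ℝ) : Fin 4 → ℝ :=
  ![quarterPt T.ω₁ i.1 i.2.1 z.1, quarterPt T.ω₂ j.1 j.2.1 z.2,
    sgn i.2.2 * √(quad c₁ c₂ (T.φ₁ z.1)), sgn j.2.2 * √(-quad c₁ c₂ (T.φ₂ z.2))]

lemma continuous_piecePt (i j : Bool × Bool × Bool) : Continuous (T.piecePt c₁ c₂ i j) := by
  have h1 := continuous_quarterPt T.ω₁ i.1 i.2.1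
  have h2 := continuous_quarterPt T.ω₂ j.1 j.2.1
  have h3 := T.smooth₁.continuous
  have h4 := T.smooth₂.continuous
  have h5 := continuous_quad c₁ c₂
  refine continuous_pi fun k => ?_
  fin_cases k <;> simp only [piecePt] <;> simp <;> fun_prop

namespace IsGeneric

lemma dom₁_ordConnected (h : T.IsGeneric c₁ c₂) : (T.dom₁ c₁ c₂).OrdConnected := by
  obtain ⟨s, hs⟩ := h.exists₂
  refine ⟨fun x hx y hy z hz => ⟨⟨hx.1.1.trans hz.1, hz.2.trans hy.1.2⟩, ?_⟩⟩
  have hm := T.profile₁.strictMonoOn.monotoneOn hx.1 ⟨hx.1.1.trans hz.1, hz.2.trans hy.1.2⟩ hz.1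
  rcases hm.eq_or_lt with he | hlt
  · rw [← he]; exact hx.2
  · exact hx.2.trans (quad_lt_of_neg hs hx.2 (T.le₂₁ _ _) hlt).le

lemma dom₂_ordConnected : (T.dom₂ c₁ c₂).OrdConnected := by
  refine ⟨fun x hx y hy z hz => ⟨⟨hx.1.1.trans hz.1, hz.2.trans hy.1.2⟩, ?_⟩⟩
  have hz' : z ∈ Icc 0 (T.ω₂ / 4) := ⟨hx.1.1.trans hz.1, hz.2.trans hy.1.2⟩
  exact quad_convex hx.2 hy.2 (T.profile₂.strictMonoOn.monotoneOn hx.1 hz' hz.1)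
    (T.profile₂.strictMonoOn.monotoneOn hz' hy.1 hz.2)

lemma piecePt_mem (h : T.IsGeneric c₁ c₂) (i j : Bool × Bool × Bool) {z : ℝ × ℝ}
    (hz : z ∈ T.dom₁ c₁ c₂ ×ˢ T.dom₂ c₁ c₂) : T.cover (T.piecePt c₁ c₂ i j z) ∈ T.level c₁ c₂ := by
  rw [h.mem_level_iff]
  simp only [piecePt, Matrix.cons_val, T.profile₁.apply_quarterPt, T.profile₂.apply_quarterPt,
    mul_pow, sgn_sq, one_mul]
  exact ⟨Real.sq_sqrt hz.1.2, Real.sq_sqrt (neg_nonneg.2 hz.2.2)⟩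

lemma exists_piecePt (h : T.IsGeneric c₁ c₂) {u : Fin 4 → ℝ} (hu : T.cover u ∈ T.level c₁ c₂) :
    ∃ i j, ∃ z ∈ T.dom₁ c₁ c₂ ×ˢ T.dom₂ c₁ c₂,
      T.cover (T.piecePt c₁ c₂ i j z) = T.cover u := by
  obtain ⟨h1, h2⟩ := h.mem_level_iff.1 hu
  obtain ⟨s, s', t, ht, m, hm⟩ := exists_quarterPt T.ω₁_pos (u 0)
  obtain ⟨r, r', q, hq, n, hn⟩ := exists_quarterPt T.ω₂_pos (u 1)
  rw [hm, T.profile₁.apply_add_int, T.profile₁.apply_quarterPt] at h1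
  rw [hn, T.profile₂.apply_add_int, T.profile₂.apply_quarterPt] at h2
  have key : ∀ p : ℝ, ∃ e : Bool, p = sgn e * √(p ^ 2) := by
    intro p
    rw [Real.sqrt_sq_eq_abs]
    rcases le_total 0 p with hp | hp
    · exact ⟨true, by simp [abs_of_nonneg hp]⟩
    · exact ⟨false, by simp [abs_of_nonpos hp]⟩
  obtain ⟨e, he⟩ := key (u 2)
  obtain ⟨f, hf⟩ := key (u 3)
  refine ⟨(s, s', e), (r, r', f), (t, q), ⟨⟨ht, by rw [← h1]; positivity⟩, hq,
    by nlinarith [sq_nonneg (u 3)]⟩, ?_⟩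
  rw [cover_eq_cover_iff]
  exact ⟨true, ⟨m, by simpa [piecePt] using hm⟩, ⟨n, by simpa [piecePt] using hn⟩,
    by simpa [piecePt, h1] using he, by simpa [piecePt, h2] using hf⟩

lemma isCompact_level (h : T.IsGeneric c₁ c₂) : IsCompact (T.level c₁ c₂) := by
  have e : T.level c₁ c₂ = ⋃ ij : (Bool × Bool × Bool) × (Bool × Bool × Bool),
      (fun z => T.cover (T.piecePt c₁ c₂ ij.1 ij.2 z)) '' (T.dom₁ c₁ c₂ ×ˢ T.dom₂ c₁ c₂) := by
    apply Subset.antisymm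
    · intro ξ hξ
      obtain ⟨u, rfl⟩ := exists_cover ξ
      obtain ⟨i, j, z, hz, hzu⟩ := h.exists_piecePt hξ
      exact mem_iUnion.2 ⟨(i, j), z, hz, hzu⟩
    · refine iUnion_subset fun ij => ?_
      rintro _ ⟨z, hz, rfl⟩
      exact h.piecePt_mem _ _ hz
  rw [e]
  have k1 : IsCompact (T.dom₁ c₁ c₂) := isCompact_Icc.inter_right
    (isClosed_le continuous_const ((continuous_quad c₁ c₂).comp T.smooth₁.continuous))
  have k2 : IsCompact (T.dom₂ c₁ c₂) := isCompact_Icc.inter_right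
    (isClosed_le ((continuous_quad c₁ c₂).comp T.smooth₂.continuous) continuous_const)
  exact isCompact_iUnion fun ij =>
    (k1.prod k2).image (continuous_cover.comp (continuous_piecePt _ _))

lemma connectedComponentIn_piecePt (h : T.IsGeneric c₁ c₂) (i j : Bool × Bool × Bool) {z z' : ℝ × ℝ}
    (hz : z ∈ T.dom₁ c₁ c₂ ×ˢ T.dom₂ c₁ c₂) (hz' : z' ∈ T.dom₁ c₁ c₂ ×ˢ T.dom₂ c₁ c₂) :
    connectedComponentIn (T.level c₁ c₂) (T.cover (T.piecePt c₁ c₂ i j z)) =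
      connectedComponentIn (T.level c₁ c₂) (T.cover (T.piecePt c₁ c₂ i j z')) := by
  have hp : IsPreconnected ((fun z => T.cover (T.piecePt c₁ c₂ i j z)) ''
      (T.dom₁ c₁ c₂ ×ˢ T.dom₂ c₁ c₂)) :=
    (h.dom₁_ordConnected.isPreconnected.prod dom₂_ordConnected.isPreconnected).image _
      (continuous_cover.comp (continuous_piecePt _ _)).continuousOn
  refine (connectedComponentIn_eq (hp.subset_connectedComponentIn ⟨z, hz, rfl⟩ ?_ ⟨z', hz', rfl⟩))
  rintro _ ⟨w, hw, rfl⟩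
  exact h.piecePt_mem _ _ hw

lemma quarter_mem_dom₁ (h : T.IsGeneric c₁ c₂) : T.ω₁ / 4 ∈ T.dom₁ c₁ c₂ :=
  ⟨T.profile₁.quarter_mem, h.quad_max_pos.le⟩

/-- This is a turning point: the branches `p₁ = ±√quad` meet there, which connects pieces with
opposite signs of `p₁`. -/
lemma exists_zero_dom₁ (h : T.IsGeneric c₁ c₂) (hν : quad c₁ c₂ T.ν₁ < 0) :
    ∃ t ∈ T.dom₁ c₁ c₂, quad c₁ c₂ (T.φ₁ t) = 0 := by
  have := intermediate_value_Icc T.profile₁.quarter_mem.1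
    ((continuous_quad c₁ c₂).comp T.smooth₁.continuous).continuousOn
  obtain ⟨t, ht, ht'⟩ := this ⟨by simp [T.φ₁_zero, hν.le], h.quad_max_pos.le⟩
  exact ⟨t, ⟨ht, ht'.ge⟩, ht'⟩

lemma exists_neg_quarter (h : T.IsGeneric c₁ c₂) :
    ∃ t ∈ Icc 0 (T.ω₂ / 4), quad c₁ c₂ (T.φ₂ t) < 0 := by
  obtain ⟨θ, hθ⟩ := h.exists₂
  obtain ⟨s, s', t, ht, m, rfl⟩ := exists_quarterPt T.ω₂_pos θ
  rw [T.profile₂.apply_add_int, T.profile₂.apply_quarterPt] at hθ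
  exact ⟨t, ht, hθ⟩

lemma exists_zero_dom₂ (h : T.IsGeneric c₁ c₂) (h0 : 0 < quad c₁ c₂ 0 ∨ 0 < quad c₁ c₂ T.ν₁) :
    ∃ t ∈ T.dom₂ c₁ c₂, quad c₁ c₂ (T.φ₂ t) = 0 := by
  obtain ⟨s, hs, hs'⟩ := h.exists_neg_quarter
  have hc : Continuous (quad c₁ c₂ ∘ T.φ₂) := (continuous_quad c₁ c₂).comp T.smooth₂.continuous
  rcases h0 with h0 | h0
  · obtain ⟨t, ht, ht'⟩ := intermediate_value_Icc' hs.1 hc.continuousOn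
      ⟨hs'.le, by simp [T.φ₂_zero, h0.le]⟩
    exact ⟨t, ⟨⟨ht.1, ht.2.trans hs.2⟩, ht'.le⟩, ht'⟩
  · obtain ⟨t, ht, ht'⟩ := intermediate_value_Icc hs.2 hc.continuousOn
      ⟨hs'.le, by simp [T.φ₂_quarter, h0.le]⟩
    exact ⟨t, ⟨⟨hs.1.trans ht.1, ht.2⟩, ht'.le⟩, ht'⟩

end IsGeneric

lemma cover_piecePt_inv (s s' e r r' f : Bool) (z : ℝ × ℝ) :
    T.cover (T.piecePt c₁ c₂ (s, s', e) (r, r', f) z) =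
      T.cover (T.piecePt c₁ c₂ (!s, s', !e) (r, !r', !f) z) := by
  rw [cover_eq_cover_iff]
  -- On the negative quarters the reflection `ω₂/2 - θ₂` leaves `[-ω₂/2, ω₂/2]` and returns after
  -- subtracting one period.
  refine ⟨false, ⟨0, ?_⟩, ⟨if r then 0 else -1, ?_⟩, ?_, ?_⟩ <;>
    cases s <;> cases s' <;> cases r <;> cases r' <;> simp [piecePt, quarterPt] <;> ring

/-- The component of a piece of a level set depends only on the signs which are invariant under
the billiard ball map. -/
lemma IsGeneric.connectedComponentIn_eq_of_signs (h : T.IsGeneric c₁ c₂) {z z' : ℝ × ℝ}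
    (hz : z ∈ T.dom₁ c₁ c₂ ×ˢ T.dom₂ c₁ c₂) (hz' : z' ∈ T.dom₁ c₁ c₂ ×ˢ T.dom₂ c₁ c₂)
    {s₁ s₁' e₁ r₁ r₁' f₁ s₂ s₂' e₂ r₂ r₂' f₂ : Bool}
    (h1 : 0 < quad c₁ c₂ 0 → r₁ = r₂)
    (h2 : 0 < quad c₁ c₂ T.ν₁ → (e₁ == r₁') = (e₂ == r₂'))
    (h3 : quad c₁ c₂ 0 < 0 → quad c₁ c₂ T.ν₁ < 0 → (s₁ == f₁) = (s₂ == f₂)) :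
    connectedComponentIn (T.level c₁ c₂) (T.cover (T.piecePt c₁ c₂ (s₁, s₁', e₁) (r₁, r₁', f₁) z)) =
    connectedComponentIn (T.level c₁ c₂)
      (T.cover (T.piecePt c₁ c₂ (s₂, s₂', e₂) (r₂, r₂', f₂) z')) := by
  -- The component as a function of six signs. Each fact below frees one sign by moving to a point
  -- where two pieces meet: an endpoint of a quarter or a turning point, according to the signs of
  -- `quad` at `0` and `ν₁`.
  set K : Bool → Bool → Bool → Bool → Bool → Bool → Set T.Phase := fun s s' e r r' f =>
    connectedComponentIn (T.level c₁ c₂) (T.cover (T.piecePt c₁ c₂ (s, s', e) (r, r', f) z)) with hK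
  have hKz : ∀ w ∈ T.dom₁ c₁ c₂ ×ˢ T.dom₂ c₁ c₂, ∀ s s' e r r' f, K s s' e r r' f =
      connectedComponentIn (T.level c₁ c₂)
        (T.cover (T.piecePt c₁ c₂ (s, s', e) (r, r', f) w)) := fun w hw s s' e r r' f =>
    h.connectedComponentIn_piecePt _ _ hz hw
  rw [← hKz z' hz']
  change K s₁ s₁' e₁ r₁ r₁' f₁ = K s₂ s₂' e₂ r₂ r₂' f₂
  have hσ : ∀ s s' e r r' f, K s s' e r r' f = K (!s) s' (!e) r (!r') (!f) := fun s s' e r r' f => by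
    simp only [hK]; rw [cover_piecePt_inv]
  have hs' : ∀ s s' e r r' f, K s s' e r r' f = K s true e r r' f := by
    intro s s' e r r' f
    have hw : (T.ω₁ / 4, z.2) ∈ T.dom₁ c₁ c₂ ×ˢ T.dom₂ c₁ c₂ := ⟨h.quarter_mem_dom₁, hz.2⟩
    rw [hKz _ hw, hKz _ hw]
    cases s'
    · simp only [piecePt]; rw [← quarterPt_not_quarter]; rfl
    · rfl
  have he : quad c₁ c₂ T.ν₁ < 0 → ∀ s s' e r r' f, K s s' e r r' f = K s s' true r r' f := by
    intro hν s s' e r r' f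
    obtain ⟨t, ht, ht'⟩ := h.exists_zero_dom₁ hν
    have hw : (t, z.2) ∈ T.dom₁ c₁ c₂ ×ˢ T.dom₂ c₁ c₂ := ⟨ht, hz.2⟩
    rw [hKz _ hw, hKz _ hw]
    simp [piecePt, ht']
  have hs : 0 < quad c₁ c₂ T.ν₁ → ∀ s s' e r r' f, K s s' e r r' f = K true s' e r r' f := by
    intro hν s s' e r r' f
    have hw : (0, z.2) ∈ T.dom₁ c₁ c₂ ×ˢ T.dom₂ c₁ c₂ :=
      ⟨⟨T.profile₁.zero_mem, by rw [T.φ₁_zero]; exact hν.le⟩, hz.2⟩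
    rw [hs' s, hs' true, hKz _ hw, hKz _ hw]
    cases s
    · simp only [piecePt]; rw [← quarterPt_not_zero]; rfl
    · rfl
  have hr' : quad c₁ c₂ T.ν₁ < 0 → ∀ s s' e r r' f, K s s' e r r' f = K s s' e r true f := by
    intro hν s s' e r r' f
    have hw : (z.1, T.ω₂ / 4) ∈ T.dom₁ c₁ c₂ ×ˢ T.dom₂ c₁ c₂ :=
      ⟨hz.1, T.profile₂.quarter_mem, by rw [T.φ₂_quarter]; exact hν.le⟩
    rw [hKz _ hw, hKz _ hw]
    cases r'
    · simp only [piecePt]; rw [← quarterPt_not_quarter]; rfl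
    · rfl
  have hf : (0 < quad c₁ c₂ 0 ∨ 0 < quad c₁ c₂ T.ν₁) → ∀ s s' e r r' f,
      K s s' e r r' f = K s s' e r r' true := by
    intro h0 s s' e r r' f
    obtain ⟨t, ht, ht'⟩ := h.exists_zero_dom₂ h0
    have hw : (z.1, t) ∈ T.dom₁ c₁ c₂ ×ˢ T.dom₂ c₁ c₂ := ⟨hz.1, ht⟩
    rw [hKz _ hw, hKz _ hw]
    simp [piecePt, ht']
  have hr : quad c₁ c₂ 0 < 0 → ∀ s s' e r f, K s s' e r true f = K s s' e true true f := by
    intro h0 s s' e r f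
    have hw : (z.1, 0) ∈ T.dom₁ c₁ c₂ ×ˢ T.dom₂ c₁ c₂ :=
      ⟨hz.1, T.profile₂.zero_mem, by rw [T.φ₂_zero]; exact h0.le⟩
    rw [hKz _ hw, hKz _ hw]
    cases r
    · simp only [piecePt]; rw [← quarterPt_not_zero]; rfl
    · rfl
  -- In each case the free signs are set to `true`, and, except where this is unnecessary, the
  -- involution of the cotangent torus removes one more; what remains are the invariants of the
  -- hypotheses.
  rcases h.zero_ne.lt_or_gt with h0 | h0 <;> rcases h.ν₁_ne.lt_or_gt with hν | hν
  · have h3 := h3 h0 hν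
    have key : ∀ s s' e r r' f, K s s' e r r' f = K true true true true true (s == f) := by
      intro s s' e r r' f
      rw [hs', he hν, hr' hν, hr h0]
      cases s
      · rw [hσ, he hν, hr' hν]; cases f <;> rfl
      · cases f <;> rfl
    rw [key, key s₂, h3]
  · have h2 := h2 hν
    have key : ∀ s s' e r r' f, K s s' e r r' f = K true true (e == r') true true true := by
      intro s s' e r r' f
      rw [hs', hs hν, hf (.inr hν)]
      cases r'
      · rw [hσ, hf (.inr hν), hs hν]
        simp only [Bool.not_false]
        rw [hr h0]; cases e <;> rfl
      · rw [hr h0]; cases e <;> rfl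
    rw [key, key s₂, h2]
  · have h1 := h1 h0
    have key : ∀ s s' e r r' f, K s s' e r r' f = K true true true r true true := by
      intro s s' e r r' f
      rw [hs', he hν, hr' hν, hf (.inl h0)]
      cases s
      · rw [hσ, he hν, hr' hν, hf (.inl h0)]; rfl
      · rfl
    rw [key, key s₂, h1]
  · have h1 := h1 h0
    have h2 := h2 hν
    have key : ∀ s s' e r r' f, K s s' e r r' f = K true true (e == r') r true true := by
      intro s s' e r r' f
      rw [hs', hs hν, hf (.inl h0)]
      cases r'
      · rw [hσ, hf (.inl h0), hs hν]; cases e <;> rfl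
      · cases e <;> rfl
    rw [key, key s₂, h1, h2]

lemma IsGeneric.connectedComponentIn_eq (h : T.IsGeneric c₁ c₂) {u u' : Fin 4 → ℝ}
    (hu : T.cover u ∈ T.level c₁ c₂) (hu' : T.cover u' ∈ T.level c₁ c₂)
    (hs : T.SameSigns c₁ c₂ 1 u u') : connectedComponentIn (T.level c₁ c₂) (T.cover u) =
      connectedComponentIn (T.level c₁ c₂) (T.cover u') := by
  obtain ⟨⟨s₁, s₁', e₁⟩, ⟨r₁, r₁', f₁⟩, z, hz, hzu⟩ := h.exists_piecePt hu
  obtain ⟨⟨s₂, s₂', e₂⟩, ⟨r₂, r₂', f₂⟩, z', hz', hzu'⟩ := h.exists_piecePt hu'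
  obtain ⟨k1, k2, k3⟩ := hs.congr hzu.symm hzu'.symm
  rw [← hzu, ← hzu']
  have mulsgn : ∀ a b : Bool, sgn a * sgn b = sgn (a == b) := by
    intro a b; cases a <;> cases b <;> simp
  simp only [piecePt, Matrix.cons_val, sin₂, cos₂, sin₁, sin_quarterPt T.ω₂_pos,
    cos_quarterPt T.ω₂_pos, sin_quarterPt T.ω₁_pos] at k1 k2 k3
  refine h.connectedComponentIn_eq_of_signs hz hz' (fun h0 => ?_) (fun h0 => ?_) fun h0 hν => ?_
  · have := k1 h0
    rw [one_mul] at this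
    exact sgn_eq_of_mul_pos (sin_quarter_nonneg T.ω₂_pos hz.2.1)
      (sin_quarter_nonneg T.ω₂_pos hz'.2.1) this
  · have := k2 h0
    refine sgn_eq_of_mul_pos (mul_nonneg (Real.sqrt_nonneg (quad c₁ c₂ (T.φ₁ z.1)))
      (cos_quarter_nonneg T.ω₂_pos hz.2.1)) (mul_nonneg (Real.sqrt_nonneg (quad c₁ c₂ (T.φ₁ z'.1)))
      (cos_quarter_nonneg T.ω₂_pos hz'.2.1)) (this.trans_eq ?_)
    rw [← mulsgn, ← mulsgn]; ring
  · have := k3 h0 hν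
    refine sgn_eq_of_mul_pos (mul_nonneg (sin_quarter_nonneg T.ω₁_pos hz.1.1) 
      (Real.sqrt_nonneg (-quad c₁ c₂ (T.φ₂ z.2))))
      (mul_nonneg (sin_quarter_nonneg T.ω₁_pos hz'.1.1) 
      (Real.sqrt_nonneg (-quad c₁ c₂ (T.φ₂ z'.2)))) (this.trans_eq ?_)
    rw [← mulsgn, ← mulsgn]; ring

/-- The second iterate of the billiard ball map preserves the components of generic levels. -/
lemma IsGeneric.billiardIter_mem (h : T.IsGeneric c₁ c₂) {ξ η ζ : T.Phase}
    (hη : η ∈ connectedComponentIn (T.level c₁ c₂) ξ) (hi : T.BilliardIter 2 η ζ) :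
    ζ ∈ connectedComponentIn (T.level c₁ c₂) ξ := by
  obtain ⟨η', ⟨_, rfl, h1⟩, h2⟩ := hi
  obtain ⟨u, rfl⟩ := exists_cover η
  obtain ⟨u', rfl⟩ := exists_cover η'
  obtain ⟨u'', rfl⟩ := exists_cover ζ
  have hu := connectedComponentIn_subset _ _ hη
  obtain ⟨hu', s1⟩ := h1.sameSigns h hu
  obtain ⟨hu'', s2⟩ := h2.sameSigns h hu'
  have s3 := s1.trans s2
  norm_num at s3
  rw [_root_.connectedComponentIn_eq hη, h.connectedComponentIn_eq hu hu'' s3]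
  exact mem_connectedComponentIn hu''

end ClassicalLBT

/-! ### Uniqueness of the quarter coordinates in the interior -/

lemma quarterPt_mem {l t : ℝ} (ht : t ∈ Ioo 0 (l / 4)) (s s' : Bool) :
    quarterPt l s s' t ∈ Ioo (-(l / 2)) (l / 2) := by
  obtain ⟨h1, h2⟩ := ht
  cases s <;> cases s' <;> simp [quarterPt] <;> constructor <;> linarith

lemma quarterPt_injective {l t t' : ℝ} (ht : t ∈ Ioo 0 (l / 4)) (ht' : t' ∈ Ioo 0 (l / 4))
    {s s' r r' : Bool} {m : ℤ} (h : quarterPt l r r' t' = quarterPt l s s' t + m * l) :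
    s = r ∧ s' = r' ∧ t = t' := by
  have h1 := quarterPt_mem ht s s'
  have h2 := quarterPt_mem ht' r r'
  have hl : 0 < l := by linarith [ht.1, ht.2]
  have hm : m = 0 := by
    have h3 : (m : ℝ) * l < 1 * l := by linarith [h1.1, h2.2]
    have h4 : (-1 : ℝ) * l < m * l := by linarith [h1.2, h2.1]
    have h5 := lt_of_mul_lt_mul_right h3 hl.le
    have h6 := lt_of_mul_lt_mul_right h4 hl.le
    have h7 : m < 1 := by exact_mod_cast h5
    have h8 : -1 < m := by exact_mod_cast h6
    omega
  subst hm
  obtain ⟨a1, a2⟩ := ht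
  obtain ⟨b1, b2⟩ := ht'
  cases s <;> cases s' <;> cases r <;> cases r' <;> simp [quarterPt] at h ⊢ <;> linarith

namespace ClassicalLBT

variable {T : ClassicalLBT} {c₁ c₂ : ℝ}

/-! ### The differentials of the integrals -/

variable (T c₁) in
/-- The differential of `p₁² - φ₁² + c₁ φ₁ - c₂`. -/
def η₁ (u v : Fin 4 → ℝ) : ℝ := 2 * u 2 * v 2 - (2 * T.φ₁ (u 0) - c₁) * deriv T.φ₁ (u 0) * v 0

variable (T c₁) in
/-- The differential of `p₂² + φ₂² - c₁ φ₂ + c₂`. -/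
def η₂ (u v : Fin 4 → ℝ) : ℝ := 2 * u 3 * v 3 + (2 * T.φ₂ (u 1) - c₁) * deriv T.φ₂ (u 1) * v 1

lemma eventually_mem_coball {u : Fin 4 → ℝ} (h : T.cover u ∈ T.coball) :
    ∀ᶠ z in 𝓝 u, T.cover z ∈ T.coball := by
  have h1 := lt_of_cover_mem_coball h
  have c1 : ContinuousAt (fun z : Fin 4 → ℝ => T.φ₁ (z 0)) u :=
    (T.smooth₁.continuous.comp (continuous_apply 0)).continuousAt
  have c2 : ContinuousAt (fun z : Fin 4 → ℝ => T.φ₂ (z 1)) u :=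
    (T.smooth₂.continuous.comp (continuous_apply 1)).continuousAt
  have n1 : T.φ₁ (u 0) - T.φ₂ (u 1) ≠ 0 := (sub_pos.2 h1).ne'
  have n2 : T.φ₂ (u 1) - T.ν₃ ≠ 0 := (sub_pos.2 (ν₃_lt _)).ne'
  have n3 : T.φ₁ (u 0) - T.ν₃ ≠ 0 := (sub_pos.2 ((ν₃_lt _).trans h1)).ne'
  have hn : ContinuousAt (fun z : Fin 4 → ℝ =>
      tangNormSq (T.φ₁ (z 0)) (T.φ₂ (z 1)) T.ν₃ (z 2) (z 3)) u := by
    unfold tangNormSq Pi1 Pi2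
    refine ContinuousAt.add (ContinuousAt.div ?_ ?_ (mul_ne_zero n1 n3))
      (ContinuousAt.div ?_ ?_ (mul_ne_zero n1 n2))
    · exact ((continuous_apply 2).pow 2).continuousAt
    · exact (c1.sub c2).mul (c1.sub continuousAt_const)
    · exact ((continuous_apply 3).pow 2).continuousAt
    · exact (c1.sub c2).mul (c2.sub continuousAt_const)
  filter_upwards [c2.eventually_lt c1 h1, hn.eventually_lt continuousAt_const h.2] with z hz hz'
  refine ⟨?_, hz'⟩
  rw [(over_base z).mem_proj_S_iff, not_or]
  exact ⟨hz.ne', (ν₃_lt _).ne'⟩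

/-- Adding the separated equations for `p₁²` and `p₂²` eliminates `c₂`. The formula is free of the
square root in `π⁺`, so it shows differentiability. -/
lemma F₁_cover {u : Fin 4 → ℝ} (h : T.cover u ∈ T.coball) : T.F₁ (T.cover u) =
    T.φ₁ (u 0) + T.φ₂ (u 1) - (u 2 ^ 2 + u 3 ^ 2) / (T.φ₁ (u 0) - T.φ₂ (u 1)) := by
  have hs := sep_of_mem_level (c₁ := T.F₁ (T.cover u)) (c₂ := T.F₂ (T.cover u)) ⟨h, rfl, rfl⟩
  have n1 : T.φ₁ (u 0) - T.φ₂ (u 1) ≠ 0 := (sub_pos.2 (lt_of_cover_mem_coball h)).ne'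
  have h1 := hs.1
  have h2 := hs.2.1
  simp only [quad, Matrix.cons_val] at h1 h2
  field_simp
  linear_combination h1 + h2

lemma F₂_cover {u : Fin 4 → ℝ} (h : T.cover u ∈ T.coball) : T.F₂ (T.cover u) =
    T.φ₁ (u 0) * T.φ₂ (u 1) - (T.φ₂ (u 1) * u 2 ^ 2 + T.φ₁ (u 0) * u 3 ^ 2) /
      (T.φ₁ (u 0) - T.φ₂ (u 1)) := by
  have hs := sep_of_mem_level (c₁ := T.F₁ (T.cover u)) (c₂ := T.F₂ (T.cover u)) ⟨h, rfl, rfl⟩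
  have n1 : T.φ₁ (u 0) - T.φ₂ (u 1) ≠ 0 := (sub_pos.2 (lt_of_cover_mem_coball h)).ne'
  have h1 := hs.1
  have h2 := hs.2.1
  simp only [quad, Matrix.cons_val] at h1 h2
  field_simp
  linear_combination T.φ₂ (u 1) * h1 + T.φ₁ (u 0) * h2

lemma differentiableAt_F {u : Fin 4 → ℝ} (h : T.cover u ∈ T.coball) :
    DifferentiableAt ℝ (fun z => T.F₁ (T.cover z)) u ∧
      DifferentiableAt ℝ (fun z => T.F₂ (T.cover z)) u := by
  have n1 : T.φ₁ (u 0) - T.φ₂ (u 1) ≠ 0 := (sub_pos.2 (lt_of_cover_mem_coball h)).ne'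
  have hev := eventually_mem_coball h
  have d1 : Differentiable ℝ T.φ₁ := T.profile₁.differentiable
  have d2 : Differentiable ℝ T.φ₂ := T.profile₂.differentiable
  constructor
  · refine DifferentiableAt.congr_of_eventuallyEq ?_ (hev.mono fun z hz => F₁_cover hz)
    fun_prop (disch := exact n1)
  · refine DifferentiableAt.congr_of_eventuallyEq ?_ (hev.mono fun z hz => F₂_cover hz)
    fun_prop (disch := exact n1)

/-- Differentiating the separated equations with `cₖ = Fₖ` gives `η₁ = -φ₁ dF₁ + dF₂` and `η₂ = φ₂
dF₁ - dF₂`, a change of basis of determinant `φ₁ - φ₂`. -/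
lemma dFdF_eq {u : Fin 4 → ℝ} (h : T.cover u ∈ T.level c₁ c₂) (v w : Fin 4 → ℝ) :
    (T.φ₁ (u 0) - T.φ₂ (u 1)) * T.dFdF u v w =
      T.η₁ c₁ u v * T.η₂ c₁ u w - T.η₁ c₁ u w * T.η₂ c₁ u v := by
  obtain ⟨hc, rfl, rfl⟩ := h
  obtain ⟨d1, d2⟩ := differentiableAt_F hc
  have hpr : ∀ k : Fin 4, HasFDerivAt (fun z : Fin 4 → ℝ => z k)
      (ContinuousLinearMap.proj (R := ℝ) (φ := fun _ : Fin 4 => ℝ) k) u := fun k =>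
    (ContinuousLinearMap.proj (R := ℝ) (φ := fun _ : Fin 4 => ℝ) k).hasFDerivAt
  have hA := ((T.profile₁.differentiable (u 0)).hasDerivAt).comp_hasFDerivAt u (hpr 0)
  have hB := ((T.profile₂.differentiable (u 1)).hasDerivAt).comp_hasFDerivAt u (hpr 1)
  have hF1 := d1.hasFDerivAt
  have hF2 := d2.hasFDerivAt
  have k1 := ((((hpr 2).pow 2).sub (hA.pow 2)).add (hF1.mul hA)).sub hF2
  have k2 := ((((hpr 3).pow 2).add (hB.pow 2)).sub (hF1.mul hB)).add hF2
  have hev := eventually_mem_coball hc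
  have z1 := k1.unique ((hasFDerivAt_const (0 : ℝ) u).congr_of_eventuallyEq (hev.mono fun z hz => by
    have := (sep_of_mem_level (c₁ := T.F₁ (T.cover z)) (c₂ := T.F₂ (T.cover z)) ⟨hz, rfl, rfl⟩).1
    simp only [quad, Matrix.cons_val] at this
    simp only [Pi.sub_apply, Pi.add_apply, Pi.mul_apply, Function.comp]
    linarith))
  have z2 := k2.unique ((hasFDerivAt_const (0 : ℝ) u).congr_of_eventuallyEq (hev.mono fun z hz => by
    have := (sep_of_mem_level (c₁ := T.F₁ (T.cover z)) (c₂ := T.F₂ (T.cover z)) ⟨hz, rfl, rfl⟩).2.1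
    simp only [quad, Matrix.cons_val] at this
    simp only [Pi.sub_apply, Pi.add_apply, Pi.mul_apply, Function.comp]
    linarith))
  have key1 : ∀ v, T.η₁ (T.F₁ (T.cover u)) u v =
      -T.φ₁ (u 0) * fderiv ℝ (fun z => T.F₁ (T.cover z)) u v +
        fderiv ℝ (fun z => T.F₂ (T.cover z)) u v := by
    intro v
    have := congrArg (fun L => L v) z1
    simp at this
    simp only [η₁]
    linarith
  have key2 : ∀ v, T.η₂ (T.F₁ (T.cover u)) u v =
      T.φ₂ (u 1) * fderiv ℝ (fun z => T.F₁ (T.cover z)) u v -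
        fderiv ℝ (fun z => T.F₂ (T.cover z)) u v := by
    intro v
    have := congrArg (fun L => L v) z2
    simp at this
    simp only [η₂]
    linarith
  rw [key1, key1, key2, key2, dFdF]
  ring

namespace IsGeneric

/-- Turning points are simple: `quad` has a simple root, being negative somewhere, and `φ₁` is not
at an extremal value, where `quad` does not vanish. -/
lemma φ₁_coeff_ne_zero (h : T.IsGeneric c₁ c₂) {θ : ℝ} (hθ : quad c₁ c₂ (T.φ₁ θ) = 0) :
    (2 * T.φ₁ θ - c₁) * deriv T.φ₁ θ ≠ 0 := by
  obtain ⟨s, hs⟩ := h.exists₂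
  refine mul_ne_zero (two_mul_sub_ne_zero hs hθ) (T.profile₁.deriv_ne_zero ?_ ?_)
  · intro he; rw [he, T.φ₁_zero] at hθ; exact h.ν₁_ne hθ
  · intro he; rw [he] at hθ; exact h.quad_max_pos.ne' hθ

lemma φ₂_coeff_ne_zero (h : T.IsGeneric c₁ c₂) {θ : ℝ} (hθ : quad c₁ c₂ (T.φ₂ θ) = 0) :
    (2 * T.φ₂ θ - c₁) * deriv T.φ₂ θ ≠ 0 := by
  obtain ⟨s, hs⟩ := h.exists₂
  refine mul_ne_zero (two_mul_sub_ne_zero hs hθ) (T.profile₂.deriv_ne_zero ?_ ?_)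
  · intro he; rw [he, T.φ₂_zero] at hθ; exact h.zero_ne hθ
  · intro he; rw [he, T.φ₂_quarter] at hθ; exact h.ν₁_ne hθ

/-- `η₁` involves only `(θ₁, p₁)` and `η₂` only `(θ₂, p₂)`; neither vanishes, because turning points
are simple. -/
lemma exists_dFdF_ne_zero (h : T.IsGeneric c₁ c₂) {u : Fin 4 → ℝ}
    (hu : T.cover u ∈ T.level c₁ c₂) : ∃ v w, T.dFdF u v w ≠ 0 := by
  obtain ⟨h1, h2⟩ := h.mem_level_iff.1 hu
  have hv : ∃ v, T.η₁ c₁ u v ≠ 0 ∧ T.η₂ c₁ u v = 0 := by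
    by_cases hp : u 2 = 0
    · refine ⟨Pi.single 0 1, ?_, by simp [η₂]⟩
      simpa [η₁, hp] using h.φ₁_coeff_ne_zero (θ := u 0) (by rw [← h1, hp]; norm_num)
    · exact ⟨Pi.single 2 1, by simp [η₁, hp], by simp [η₂]⟩
  have hw : ∃ w, T.η₂ c₁ u w ≠ 0 ∧ T.η₁ c₁ u w = 0 := by
    by_cases hp : u 3 = 0
    · refine ⟨Pi.single 1 1, ?_, by simp [η₁]⟩
      simpa [η₂, hp] using h.φ₂_coeff_ne_zero (θ := u 1) (by rw [hp] at h2; linarith)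
    · exact ⟨Pi.single 3 1, by simp [η₂, hp], by simp [η₁]⟩
  obtain ⟨v, hv1, hv2⟩ := hv
  obtain ⟨w, hw1, hw2⟩ := hw
  refine ⟨v, w, fun h0 => ?_⟩
  have := dFdF_eq hu v w
  rw [h0, hv2, hw2] at this
  simp only [mul_zero, sub_zero] at this
  exact mul_ne_zero hv1 hw1 this.symm

/-- The components of generic levels are invariant Liouville tori. -/
lemma component_mem_tori (h : T.IsGeneric c₁ c₂) {ξ : T.Phase} (hξ : ξ ∈ T.level c₁ c₂) :
    connectedComponentIn (T.level c₁ c₂) ξ ∈ T.tori := by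
  refine ⟨⟨c₁, c₂, ξ, hξ, rfl⟩, ?_, ?_, 2, by norm_num, fun η hη ζ hζ => h.billiardIter_mem hη hζ⟩
  · rw [connectedComponentIn_eq_image hξ]
    have := isCompact_iff_compactSpace.1 h.isCompact_level
    exact isClosed_connectedComponent.isCompact.image continuous_subtype_val
  · intro u hu
    exact h.exists_dFdF_ne_zero (connectedComponentIn_subset _ _ hu)

end IsGeneric

/-! ### The Leray form in the coordinates of the base -/

/-- Evaluate the defining identity on `v, w` tangent to the level and on `∂/∂p₁, ∂/∂p₂`. On the
right only `α(v, w)` times `dF₁ ∧ dF₂ (∂/∂p₁, ∂/∂p₂) = 4 p₁ p₂ / (φ₁ - φ₂)` survives, and the left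
side is `-2 v₀ w₁`. -/
lemma abs_lerayForm {Λ : Set T.Phase} {α : (Fin 4 → ℝ) → (Fin 4 → ℝ) [⋀^Fin 2]→ₗ[ℝ] ℝ}
    (hα : T.IsLerayForm Λ α) {u : Fin 4 → ℝ} (hu : T.cover u ∈ Λ)
    (hl : T.cover u ∈ T.level c₁ c₂) (h2 : u 2 ≠ 0) (h3 : u 3 ≠ 0) {v w : Fin 4 → ℝ}
    (hv : T.η₁ c₁ u v = 0 ∧ T.η₂ c₁ u v = 0) (hw : T.η₁ c₁ u w = 0 ∧ T.η₂ c₁ u w = 0)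
    (hv0 : |v 0| = 1) (hv1 : v 1 = 0) (hw0 : w 0 = 0) (hw1 : |w 1| = 1) :
    |α u ![v, w]| = (T.φ₁ (u 0) - T.φ₂ (u 1)) / (2 * (|u 2| * |u 3|)) := by
  have hab : 0 < T.φ₁ (u 0) - T.φ₂ (u 1) := sub_pos.2 (lt_of_cover_mem_coball hl.1)
  have hz : ∀ x y, T.η₁ c₁ u x = 0 ∧ T.η₂ c₁ u x = 0 → T.dFdF u x y = 0 := by
    intro x y hx
    have := dFdF_eq hl x y
    rw [hx.1, hx.2] at this
    simpa [hab.ne'] using this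
  set e : Fin 4 → ℝ := Pi.single 2 1
  set f : Fin 4 → ℝ := Pi.single 3 1
  have hef : (T.φ₁ (u 0) - T.φ₂ (u 1)) * T.dFdF u e f = 4 * (u 2 * u 3) := by
    rw [dFdF_eq hl]; simp [η₁, η₂, e, f]; ring
  have := hα u hu v w e f
  simp only [wedge, hz v _ hv, hz w _ hw, mul_zero] at this
  simp [symp, e, f, hv1, hw0] at this
  have hmul : (α u ![v, w]) * (4 * (u 2 * u 3)) =
      -2 * (v 0 * w 1) * (T.φ₁ (u 0) - T.φ₂ (u 1)) := by
    rw [← hef]; linear_combination (-(T.φ₁ (u 0) - T.φ₂ (u 1))) * this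
  have habs := congrArg abs hmul
  simp only [abs_mul, hv0, hw1, abs_of_pos hab] at habs
  norm_num at habs
  have p2 := abs_pos.2 h2
  have p3 := abs_pos.2 h3
  field_simp
  linarith

end ClassicalLBT

/-! ### Local parametrizations of the curves `p² = g θ` -/

/-- Where `p ≠ 0`, use `θ` as the parameter and `p = ±√g`; at a turning point use `p`, solving for
`θ` by the inverse function theorem. The linear map `κ` reads off the parameter. The countable set
is recorded because it will carry no measure. -/
lemma exists_local_param {g : ℝ → ℝ} (hg : ContDiff ℝ ∞ g) {θ p : ℝ} (h : p ^ 2 = g θ)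
    (hnd : p ≠ 0 ∨ deriv g θ ≠ 0) {l : ℝ} (hl : ∀ k : ℤ, deriv g (k * l) = 0) :
    ∃ (x y : ℝ → ℝ) (κ : ℝ × ℝ →L[ℝ] ℝ) (J : Set ℝ), IsOpen J ∧ κ (θ, p) ∈ J ∧
      ContDiffOn ℝ ∞ x J ∧ ContDiffOn ℝ ∞ y J ∧ (∀ s ∈ J, y s ^ 2 = g (x s)) ∧
      (∀ s ∈ J, κ (x s, y s) = s) ∧ {s ∈ J | y s = 0 ∨ ∃ k : ℤ, x s = k * l}.Countable ∧
      ∀ᶠ z in 𝓝 (θ, p), z.2 ^ 2 = g z.1 → (x (κ z), y (κ z)) = z := by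
  by_cases hp : p = 0
  · subst hp
    have hd : deriv g θ ≠ 0 := hnd.resolve_left (by simp)
    have hstrict : HasStrictDerivAt g (deriv g θ) θ :=
      hg.contDiffAt.hasStrictDerivAt (by simp)
    set e := (hstrict.hasStrictFDerivAt_equiv hd).toOpenPartialHomeomorph g with he
    have hθe : θ ∈ e.source :=
      (hstrict.hasStrictFDerivAt_equiv hd).mem_toOpenPartialHomeomorph_source
    have heg : ∀ z, e z = g z := fun z => rfl
    have hdc : Continuous (deriv g) := hg.continuous_deriv (by simp)
    -- Restricting to `g' ≠ 0` makes the inverse smooth throughout and excludes the multiples of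
    -- `l`.
    set W : Set ℝ := e.source ∩ {z | deriv g z ≠ 0} with hW
    have hWo : IsOpen W := e.open_source.inter (isOpen_ne.preimage hdc)
    set e' := e.restrOpen {z | deriv g z ≠ 0} (isOpen_ne.preimage hdc) with he'
    have hsrc : e'.source = W := rfl
    have heg' : ∀ z, e' z = g z := fun z => rfl
    have hθ : θ ∈ e'.source := by rw [hsrc]; exact ⟨hθe, hd⟩
    set J : Set ℝ := (fun s => s ^ 2) ⁻¹' e'.target with hJ
    have hJo : IsOpen J := e'.open_target.preimage (continuous_pow 2)
    have hJ0 : (0 : ℝ) ∈ J := by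
      have := e'.map_source hθ
      rw [heg', ← h] at this
      exact this
    have hdx : ∀ s ∈ J, deriv g (e'.symm (s ^ 2)) ≠ 0 := by
      intro s hs
      have := e'.map_target hs
      rw [hsrc] at this
      exact this.2
    refine ⟨fun s => e'.symm (s ^ 2), id, ContinuousLinearMap.snd ℝ ℝ ℝ, J, hJo, hJ0, ?_,
      contDiffOn_id, ?_, fun s _ => rfl, ?_, ?_⟩
    · intro s hs
      have h1 : ContDiffAt ℝ ∞ e'.symm (s ^ 2) :=
        e'.contDiffAt_symm_deriv (hdx s hs) hs
          (hg.differentiable (by simp) _).hasDerivAt hg.contDiffAt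
      have h2 : ContDiff ℝ ∞ fun s : ℝ => s ^ 2 := contDiff_id.pow 2
      exact (ContDiffAt.comp (f := fun s : ℝ => s ^ 2) s h1 h2.contDiffAt).contDiffWithinAt
    · intro s hs
      have := e'.right_inv hs
      rw [heg'] at this
      exact this.symm
    · refine (countable_singleton (0 : ℝ)).mono ?_
      rintro s ⟨hs, hs0 | ⟨k, hk⟩⟩
      · exact hs0
      · exact absurd (hl k) (hk ▸ hdx s hs)
    · have h1 : ∀ᶠ z : ℝ × ℝ in 𝓝 (θ, 0), z.1 ∈ e'.source :=
        continuousAt_fst.eventually_mem (e'.open_source.mem_nhds hθ)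
      filter_upwards [h1] with z hz hz2
      have : e'.symm (z.2 ^ 2) = z.1 := by rw [hz2, ← heg', e'.left_inv hz]
      exact Prod.ext this rfl
  · obtain ⟨ε, hε, hball⟩ : ∃ ε : ℝ, (ε = 1 ∨ ε = -1) ∧ 0 < ε * p := by
      rcases lt_or_gt_of_ne hp with h | h
      · exact ⟨-1, .inr rfl, by linarith⟩
      · exact ⟨1, .inl rfl, by linarith⟩
    have hε2 : ε ^ 2 = 1 := by rcases hε with rfl | rfl <;> norm_num
    set J : Set ℝ := {s | 0 < g s} with hJ
    have hJo : IsOpen J := isOpen_lt continuous_const hg.continuous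
    refine ⟨id, fun s => ε * √(g s), ContinuousLinearMap.fst ℝ ℝ ℝ, J, hJo, ?_, contDiffOn_id,
      ?_, ?_, fun s _ => rfl, ?_, ?_⟩
    · change 0 < g θ
      rw [← h]; positivity
    · exact contDiffOn_const.mul (hg.contDiffOn.sqrt fun s hs => (ne_of_gt hs))
    · intro s hs
      rw [mul_pow, hε2, one_mul, Real.sq_sqrt (le_of_lt hs)]
      rfl
    · refine (countable_range fun k : ℤ => (k : ℝ) * l).mono ?_
      rintro s ⟨hs, hs0 | ⟨k, hk⟩⟩
      · have := (Real.sqrt_pos.2 hs).ne'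
        rcases hε with rfl | rfl <;> simp [this] at hs0
      · exact ⟨k, hk.symm⟩
    · have h1 : ∀ᶠ z : ℝ × ℝ in 𝓝 (θ, p), 0 < ε * z.2 :=
        (continuousAt_const.mul continuousAt_snd).eventually_const_lt hball
      filter_upwards [h1] with z hz hz2
      refine Prod.ext rfl ?_
      change ε * √(g z.1) = z.2
      rw [← hz2, show z.2 ^ 2 = (ε * z.2) ^ 2 by rw [mul_pow, hε2, one_mul], Real.sqrt_sq hz.le,
        ← mul_assoc, ← sq, hε2, one_mul]

lemma injective_fderiv_of_leftInverse {E F : Type*} [NormedAddCommGroup E] [NormedSpace ℝ E]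
    [NormedAddCommGroup F] [NormedSpace ℝ F] {r : E → F} {U : Set E} (hU : IsOpen U) {s : E}
    (hs : s ∈ U) (hr : DifferentiableAt ℝ r s) (L : F →L[ℝ] E) (w : E)
    (h : ∀ s ∈ U, L (r s) = s + w) : Function.Injective (fderiv ℝ r s) := by
  have h1 : HasFDerivAt (fun s => L (r s)) (L.comp (fderiv ℝ r s)) s :=
    L.hasFDerivAt.comp s hr.hasFDerivAt
  have h2 : HasFDerivAt (fun s => L (r s)) (ContinuousLinearMap.id ℝ E) s :=
    ((hasFDerivAt_id s).add_const w).congr_of_eventuallyEq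
      ((hU.eventually_mem hs).mono fun z hz => h z hz)
  have h3 := h1.unique h2
  intro a b hab
  have ha := congrArg (fun L => L a) h3
  have hb := congrArg (fun L => L b) h3
  simp only [ContinuousLinearMap.comp_apply, ContinuousLinearMap.id_apply] at ha hb
  rw [← ha, ← hb, hab]

namespace ClassicalLBT

variable {T : ClassicalLBT} {c₁ c₂ : ℝ}

/-- Off the branch set `sin₁ (θ₁)` or `cos₂ (θ₂)` is nonzero, and the involution changes the sign of
both, so it identifies no two nearby points. Distances below half a period exclude the translations.
-/
lemma exists_nhds_injOn_cover {u : Fin 4 → ℝ} (h : T.cover u ∈ T.coball) :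
    ∃ V ∈ 𝓝 u, InjOn T.cover V := by
  have hlt := lt_of_cover_mem_coball h
  have hcont : ∀ k, Continuous fun z : Fin 4 → ℝ => z k := continuous_apply
  have c1 : Continuous fun z : Fin 4 → ℝ => T.sin₁ (z 0) := by unfold sin₁; fun_prop
  have c2 : Continuous fun z : Fin 4 → ℝ => T.cos₂ (z 1) := by unfold cos₂; fun_prop
  have hne : T.sin₁ (u 0) ≠ 0 ∨ T.cos₂ (u 1) ≠ 0 := by
    by_contra hcon
    push Not at hcon
    rw [(T.min₁_iff _).2 (sin_period_eq_zero T.ω₁_pos hcon.1),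
      (T.max₂_iff _).2 (cos_period_eq_zero T.ω₂_pos hcon.2)] at hlt
    exact lt_irrefl _ hlt
  have hev : ∀ᶠ z in 𝓝 u, (0 < T.sin₁ (u 0) * T.sin₁ (z 0) ∨ T.sin₁ (u 0) = 0) ∧
      (0 < T.cos₂ (u 1) * T.cos₂ (z 1) ∨ T.cos₂ (u 1) = 0) ∧ |z 0 - u 0| < T.ω₁ / 2 ∧
      |z 1 - u 1| < T.ω₂ / 2 := by
    refine .and ?_ (.and ?_ (.and ?_ ?_))
    · by_cases h0 : T.sin₁ (u 0) = 0
      · exact .of_forall fun z => .inr h0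
      · exact ((continuous_const.mul c1).continuousAt.eventually_const_lt
          (mul_self_pos.2 h0)).mono fun z hz => .inl hz
    · by_cases h0 : T.cos₂ (u 1) = 0
      · exact .of_forall fun z => .inr h0
      · exact ((continuous_const.mul c2).continuousAt.eventually_const_lt
          (mul_self_pos.2 h0)).mono fun z hz => .inl hz
    · refine ((hcont 0).sub continuous_const).abs.continuousAt.eventually_lt_const ?_
      simpa using T.ω₁_pos
    · refine ((hcont 1).sub continuous_const).abs.continuousAt.eventually_lt_const ?_
      simpa using T.ω₂_pos
  refine ⟨_, hev, ?_⟩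
  rintro z ⟨z1, z2, z3, z4⟩ z' ⟨z1', z2', z3', z4'⟩ hzz
  obtain ⟨b, ⟨m, hm⟩, ⟨n, hn⟩, h2, h3⟩ := cover_eq_cover_iff.1 hzz
  have hint : ∀ {l x y w : ℝ} {m : ℤ}, 0 < l → y = x + m * l → |x - w| < l / 2 →
      |y - w| < l / 2 → y = x := by
    intro l x y w m hl hy hx hy'
    rw [abs_lt] at hx hy'
    have h5 : (m : ℝ) * l < 1 * l := by linarith [hx.1, hy'.2]
    have h6 : (-1 : ℝ) * l < m * l := by linarith [hx.2, hy'.1]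
    have h7 : m < 1 := by exact_mod_cast lt_of_mul_lt_mul_right h5 hl.le
    have h8 : -1 < m := by exact_mod_cast lt_of_mul_lt_mul_right h6 hl.le
    have h9 : m = 0 := by omega
    rw [hy, h9]; simp
  cases b
  · exfalso
    have hn' : z' 1 - sgn false * sgn true * z 1 - (if false then 0 else T.ω₂ / 2) = n * T.ω₂ := by
      simp at hn ⊢; linarith
    have hm' : z' 0 - sgn false * z 0 = m * T.ω₁ := by linarith
    have e1 : T.sin₁ (z' 0) = -T.sin₁ (z 0) := by
      simpa [sin₁] using sin_neg_deck T.ω₁_pos false hm'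
    have e2 : T.cos₂ (z' 1) = -T.cos₂ (z 1) := by
      simpa [cos₂] using cos_deck T.ω₂_pos false true hn'
    rw [e1] at z1'
    rw [e2] at z2'
    rcases hne with h0 | h0
    · have a := z1.resolve_right h0
      have b := z1'.resolve_right h0
      linarith
    · have a := z2.resolve_right h0
      have b := z2'.resolve_right h0
      linarith
  · simp at hm hn h2 h3
    have e0 := hint T.ω₁_pos hm z3 z3'
    have e1 := hint T.ω₂_pos hn z4 z4'
    funext k
    fin_cases k
    exacts [e0.symm, e1.symm, h2.symm, h3.symm]

/-! ### The turning curves have measure zero -/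

variable (T) in
/-- The covectors with a vanishing momentum or over the boundary of a quarter of the periods. -/
def IsExceptional (u : Fin 4 → ℝ) : Prop :=
  (u 2 = 0 ∨ ∃ k : ℤ, u 0 = k * (T.ω₁ / 4)) ∨ (u 3 = 0 ∨ ∃ k : ℤ, u 1 = k * (T.ω₂ / 4))

variable {Λ : Set T.Phase} {α : (Fin 4 → ℝ) → (Fin 4 → ℝ) [⋀^Fin 2]→ₗ[ℝ] ℝ}
  {lam : Measure T.Phase}

lemma deriv_quad_comp₁ (θ : ℝ) : deriv (fun t => quad c₁ c₂ (T.φ₁ t)) θ =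
    (2 * T.φ₁ θ - c₁) * deriv T.φ₁ θ :=
  ((hasDerivAt_quad c₁ c₂ _).comp θ (T.profile₁.differentiable θ).hasDerivAt).deriv

lemma deriv_quad_comp₂ (θ : ℝ) : deriv (fun t => -quad c₁ c₂ (T.φ₂ t)) θ =
    -((2 * T.φ₂ θ - c₁) * deriv T.φ₂ θ) :=
  ((hasDerivAt_quad c₁ c₂ _).comp θ (T.profile₂.differentiable θ).hasDerivAt).neg.deriv

/-- A component of a level set contains the image of every connected set of coordinates which
meets it. -/
lemma mem_component_of_isPreconnected {X : Type*} [TopologicalSpace X] {L : Set X} {x : X}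
    {V : Type*} [TopologicalSpace V] {U : Set V} (hU : IsPreconnected U) {ρ : V → X}
    (hρ : ContinuousOn ρ U) (hL : ∀ s ∈ U, ρ s ∈ L) {s₀ : V} (hs₀ : s₀ ∈ U)
    (h : ρ s₀ ∈ connectedComponentIn L x) : ∀ s ∈ U, ρ s ∈ connectedComponentIn L x := by
  intro s hs
  rw [_root_.connectedComponentIn_eq h]
  exact (hU.image ρ hρ).subset_connectedComponentIn ⟨s₀, hs₀, rfl⟩
    (by rintro _ ⟨w, hw, rfl⟩; exact hL w hw) ⟨s, hs, rfl⟩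

/-- Locally the torus is a product of two curves `p² = g(θ)`. In a product chart the exceptional
points lie over countably many lines parallel to the axes, a Lebesgue null set, and the Leray
measure has a density in this chart. -/
lemma IsGeneric.exists_nhds_null (h : T.IsGeneric c₁ c₂) {ξ : T.Phase}
    (hΛ : Λ = connectedComponentIn (T.level c₁ c₂) ξ) (hvol : T.IsVolumeOn Λ α lam)
    {u : Fin 4 → ℝ} (hu : T.cover u ∈ Λ) :
    ∃ V ∈ 𝓝 u, lam (T.cover '' (V ∩ {z | T.cover z ∈ Λ ∧ T.IsExceptional z})) = 0 := by
  have hΛl : Λ ⊆ T.level c₁ c₂ := hΛ ▸ connectedComponentIn_subset _ _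
  obtain ⟨hu1, hu2⟩ := h.mem_level_iff.1 (hΛl hu)
  obtain ⟨x₁, y₁, κ₁, J₁, hJ₁, hs₁, hx₁, hy₁, hg₁, hκ₁, hc₁, hev₁⟩ :=
    exists_local_param (g := fun t => quad c₁ c₂ (T.φ₁ t))
      ((contDiff_quad c₁ c₂).comp T.smooth₁) hu1
      (by
        by_cases hp : u 2 = 0
        · right
          rw [deriv_quad_comp₁]
          exact h.φ₁_coeff_ne_zero (by rw [← hu1, hp]; norm_num)
        · exact .inl hp) (l := T.ω₁ / 4)
      (fun k => by rw [deriv_quad_comp₁, T.profile₁.deriv_zero_of_quarter_int, mul_zero])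
  obtain ⟨x₂, y₂, κ₂, J₂, hJ₂, hs₂, hx₂, hy₂, hg₂, hκ₂, hc₂, hev₂⟩ :=
    exists_local_param (g := fun t => -quad c₁ c₂ (T.φ₂ t))
      ((contDiff_quad c₁ c₂).comp T.smooth₂).neg hu2
      (by
        by_cases hp : u 3 = 0
        · right
          rw [deriv_quad_comp₂]
          exact neg_ne_zero.2 (h.φ₂_coeff_ne_zero (by rw [hp] at hu2; linarith))
        · exact .inl hp) (l := T.ω₂ / 4)
      (fun k => by rw [deriv_quad_comp₂, T.profile₂.deriv_zero_of_quarter_int, mul_zero, neg_zero])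
  obtain ⟨V₀, hV₀, hinj⟩ := exists_nhds_injOn_cover (hΛl hu).1
  set r : ℝ × ℝ → Fin 4 → ℝ := fun s => ![x₁ s.1, x₂ s.2, y₁ s.1, y₂ s.2] with hr
  set s₀ : ℝ × ℝ := (κ₁ (u 0, u 2), κ₂ (u 1, u 3)) with hs₀
  have hrs₀ : r s₀ = u := by
    have e1 := hev₁.self_of_nhds hu1
    have e2 := hev₂.self_of_nhds hu2
    simp only [Prod.mk.injEq] at e1 e2
    funext k
    fin_cases k
    exacts [e1.1, e2.1, e1.2, e2.2]
  have hrc : ContDiffOn ℝ ∞ r (J₁ ×ˢ J₂) := by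
    refine contDiffOn_pi.2 fun k => ?_
    have f1 : ContDiffOn ℝ ∞ (fun s : ℝ × ℝ => x₁ s.1) (J₁ ×ˢ J₂) :=
      hx₁.comp contDiffOn_fst fun s hs => hs.1
    have f2 : ContDiffOn ℝ ∞ (fun s : ℝ × ℝ => x₂ s.2) (J₁ ×ˢ J₂) :=
      hx₂.comp contDiffOn_snd fun s hs => hs.2
    have f3 : ContDiffOn ℝ ∞ (fun s : ℝ × ℝ => y₁ s.1) (J₁ ×ˢ J₂) :=
      hy₁.comp contDiffOn_fst fun s hs => hs.1
    have f4 : ContDiffOn ℝ ∞ (fun s : ℝ × ℝ => y₂ s.2) (J₁ ×ˢ J₂) :=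
      hy₂.comp contDiffOn_snd fun s hs => hs.2
    fin_cases k
    exacts [f1, f2, f3, f4]
  have hJ : J₁ ×ˢ J₂ ∈ 𝓝 s₀ := (hJ₁.prod hJ₂).mem_nhds ⟨hs₁, hs₂⟩
  have hpre : r ⁻¹' V₀ ∈ 𝓝 s₀ :=
    (hrc.continuousOn.continuousAt hJ).preimage_mem_nhds (hrs₀ ▸ hV₀)
  obtain ⟨ε, hε, hball⟩ := Metric.mem_nhds_iff.1 (inter_mem hJ hpre)
  set U := Metric.ball s₀ ε with hU
  have hUo : IsOpen U := Metric.isOpen_ball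
  have hUJ : U ⊆ J₁ ×ˢ J₂ := fun s hs => (hball hs).1
  have hrU := hrc.mono hUJ
  have hrΛ : ∀ s ∈ U, T.cover (r s) ∈ Λ := by
    rw [hΛ] at hu ⊢
    refine mem_component_of_isPreconnected (convex_ball s₀ ε).isPreconnected
      (ρ := fun s => T.cover (r s)) (continuous_cover.comp_continuousOn hrU.continuousOn)
      (fun s hs => h.mem_level_iff.2 ⟨hg₁ _ (hUJ hs).1, hg₂ _ (hUJ hs).2⟩)
      (Metric.mem_ball_self hε) ?_
    rwa [hrs₀]
  set κ : (Fin 4 → ℝ) →L[ℝ] ℝ × ℝ :=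
    (κ₁.comp ((ContinuousLinearMap.proj 0).prod (ContinuousLinearMap.proj 2))).prod
      (κ₂.comp ((ContinuousLinearMap.proj 1).prod (ContinuousLinearMap.proj 3))) with hκ
  have hκr : ∀ s ∈ U, κ (r s) = s := fun s hs =>
    Prod.ext (hκ₁ _ (hUJ hs).1) (hκ₂ _ (hUJ hs).2)
  set N₁ := {s ∈ J₁ | y₁ s = 0 ∨ ∃ k : ℤ, x₁ s = k * (T.ω₁ / 4)} with hN₁
  set N₂ := {s ∈ J₂ | y₂ s = 0 ∨ ∃ k : ℤ, x₂ s = k * (T.ω₂ / 4)} with hN₂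
  set E : Set (ℝ × ℝ) := U ∩ (N₁ ×ˢ univ ∪ univ ×ˢ N₂) with hE
  have hEm : MeasurableSet E := hUo.measurableSet.inter
    ((hc₁.measurableSet.prod MeasurableSet.univ).union (MeasurableSet.univ.prod hc₂.measurableSet))
  have hE0 : (volume : Measure (ℝ × ℝ)) E = 0 := by
    refine measure_mono_null inter_subset_right (measure_union_null ?_ ?_)
    · rw [Measure.volume_eq_prod, Measure.prod_prod, hc₁.measure_zero, zero_mul]
    · rw [Measure.volume_eq_prod, Measure.prod_prod, hc₂.measure_zero, mul_zero]
  have hlam := hvol.2 U r hUo hrU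
    (fun s hs => injective_fderiv_of_leftInverse hUo hs
      ((hrU.contDiffAt (hUo.mem_nhds hs)).differentiableAt (by simp)) κ 0
      (fun s hs => by rw [hκr s hs, add_zero]))
    (fun s hs s' hs' hss => by
      have := hinj (hball hs).2 (hball hs').2 hss
      rw [← hκr s hs, ← hκr s' hs', this]) hrΛ E inter_subset_left hEm
  rw [Measure.restrict_eq_zero.2 hE0, lintegral_zero_measure] at hlam
  have t1 : Tendsto (fun z : Fin 4 → ℝ => (z 0, z 2)) (𝓝 u) (𝓝 (u 0, u 2)) :=
    ((continuous_apply 0).prodMk (continuous_apply 2)).tendsto u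
  have t2 : Tendsto (fun z : Fin 4 → ℝ => (z 1, z 3)) (𝓝 u) (𝓝 (u 1, u 3)) :=
    ((continuous_apply 1).prodMk (continuous_apply 3)).tendsto u
  have hκU : ∀ᶠ z in 𝓝 u, κ z ∈ U :=
    κ.continuous.continuousAt.eventually_mem (hUo.mem_nhds (Metric.mem_ball_self hε))
  refine ⟨_, (t1.eventually hev₁).and ((t2.eventually hev₂).and hκU), measure_mono_null ?_ hlam⟩
  rintro _ ⟨z, ⟨⟨hz1, hz2, hzU⟩, hzΛ, hexc⟩, rfl⟩
  obtain ⟨hl1, hl2⟩ := h.mem_level_iff.1 (hΛl hzΛ)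
  have e1 := hz1 hl1
  have e2 := hz2 hl2
  simp only [Prod.mk.injEq] at e1 e2
  have hrz : r (κ z) = z := by
    funext k
    fin_cases k
    exacts [e1.1, e2.1, e1.2, e2.2]
  refine ⟨κ z, ⟨hzU, ?_⟩, by simp only [hrz]⟩
  rcases hexc with hx | hx
  · left
    refine ⟨⟨(hUJ hzU).1, ?_⟩, mem_univ _⟩
    change y₁ (κ₁ (z 0, z 2)) = 0 ∨ ∃ k : ℤ, x₁ (κ₁ (z 0, z 2)) = _
    rwa [e1.1, e1.2]
  · right
    refine ⟨mem_univ _, (hUJ hzU).2, ?_⟩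
    change y₂ (κ₂ (z 1, z 3)) = 0 ∨ ∃ k : ℤ, x₂ (κ₂ (z 1, z 3)) = _
    rwa [e2.1, e2.2]

/-- The local statement is globalised by a countable subcover of the preimage of `Λ` in the
coordinate space. -/
lemma IsGeneric.measure_exceptional (h : T.IsGeneric c₁ c₂) {ξ : T.Phase}
    (hΛ : Λ = connectedComponentIn (T.level c₁ c₂) ξ) (hvol : T.IsVolumeOn Λ α lam) :
    lam (T.cover '' {z | T.cover z ∈ Λ ∧ T.IsExceptional z}) = 0 := by
  have key : ∀ u, ∃ V : Set (Fin 4 → ℝ), T.cover u ∈ Λ →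
      V ∈ 𝓝 u ∧ lam (T.cover '' (V ∩ {z | T.cover z ∈ Λ ∧ T.IsExceptional z})) = 0 := by
    intro u
    by_cases hu : T.cover u ∈ Λ
    · obtain ⟨V, hV, hV'⟩ := h.exists_nhds_null hΛ hvol hu
      exact ⟨V, fun _ => ⟨hV, hV'⟩⟩
    · exact ⟨∅, fun h => absurd h hu⟩
  choose V hV using key
  obtain ⟨t, hts, htc, htU⟩ := TopologicalSpace.countable_cover_nhdsWithin
    (s := T.cover ⁻¹' Λ) (f := V) fun u hu => mem_nhdsWithin_of_mem_nhds (hV u hu).1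
  refine measure_mono_null (t := ⋃ u ∈ t, T.cover '' (V u ∩ {z | T.cover z ∈ Λ ∧
    T.IsExceptional z})) ?_ ((measure_biUnion_null_iff htc).2 fun u hu => (hV u (hts hu)).2)
  rintro _ ⟨z, hz, rfl⟩
  obtain ⟨u, hu, hzu⟩ := mem_iUnion₂.1 (htU hz.1)
  exact mem_iUnion₂.2 ⟨u, hu, z, ⟨hzu, hz⟩, rfl⟩

end ClassicalLBT

namespace ClassicalLBT

variable {T : ClassicalLBT} {c₁ c₂ : ℝ}

/-! ### The pieces of the tori -/

variable (T) in
/-- The open fundamental cell of the symmetries of the torus. -/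
def cell : Set (ℝ × ℝ) := Ioo 0 (T.ω₁ / 4) ×ˢ Ioo 0 (T.ω₂ / 4)

variable (T c₁ c₂) in
/-- The projection of a level set to the fundamental cell. -/
def openDom : Set (ℝ × ℝ) :=
  {z ∈ T.cell | 0 < quad c₁ c₂ (T.φ₁ z.1) ∧ quad c₁ c₂ (T.φ₂ z.2) < 0}

variable (T c₁ c₂) in
/-- The density of the Leray measure in the coordinates of the base. -/
def lerayDensity (z : ℝ × ℝ) : ℝ :=
  (T.φ₁ z.1 - T.φ₂ z.2) /
    (2 * (√(quad c₁ c₂ (T.φ₁ z.1)) * √(-quad c₁ c₂ (T.φ₂ z.2))))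

lemma isOpen_cell : IsOpen T.cell := isOpen_Ioo.prod isOpen_Ioo

lemma isOpen_openDom : IsOpen (T.openDom c₁ c₂) := by
  have h1 : Continuous fun z : ℝ × ℝ => quad c₁ c₂ (T.φ₁ z.1) :=
    (continuous_quad c₁ c₂).comp (T.smooth₁.continuous.comp continuous_fst)
  have h2 : Continuous fun z : ℝ × ℝ => quad c₁ c₂ (T.φ₂ z.2) :=
    (continuous_quad c₁ c₂).comp (T.smooth₂.continuous.comp continuous_snd)
  exact isOpen_cell.inter ((isOpen_lt continuous_const h1).inter (isOpen_lt h2 continuous_const))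

lemma measurable_lerayDensity : Measurable (T.lerayDensity c₁ c₂) := by
  have h1 := T.smooth₁.continuous
  have h2 := T.smooth₂.continuous
  have h3 := continuous_quad c₁ c₂
  refine Measurable.div ?_ ?_ <;> refine Continuous.measurable ?_ <;> fun_prop

lemma openDom_subset : T.openDom c₁ c₂ ⊆ T.dom₁ c₁ c₂ ×ˢ T.dom₂ c₁ c₂ := fun _ hz =>
  ⟨⟨Ioo_subset_Icc_self hz.1.1, hz.2.1.le⟩, Ioo_subset_Icc_self hz.1.2, hz.2.2.le⟩

lemma lerayDensity_pos {z : ℝ × ℝ} (hz : z ∈ T.openDom c₁ c₂) : 0 < T.lerayDensity c₁ c₂ z := by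
  have hlt : T.φ₂ z.2 < T.φ₁ z.1 :=
    (T.le₂₁ _ _).lt_of_ne fun he => (hz.2.2.trans hz.2.1).ne (he ▸ rfl)
  exact div_pos (sub_pos.2 hlt) (mul_pos two_pos
    (mul_pos (Real.sqrt_pos.2 hz.2.1) (Real.sqrt_pos.2 (neg_pos.2 hz.2.2))))

lemma contDiffOn_piecePt (i j : Bool × Bool × Bool) :
    ContDiffOn ℝ ∞ (T.piecePt c₁ c₂ i j) (T.openDom c₁ c₂) := by
  refine contDiffOn_pi.2 fun k => ?_
  obtain ⟨k₁, h1⟩ := quarterPt_eq_affine T.ω₁ i.1 i.2.1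
  obtain ⟨k₂, h2⟩ := quarterPt_eq_affine T.ω₂ j.1 j.2.1
  have f1 : ContDiff ℝ ∞ fun z : ℝ × ℝ => quarterPt T.ω₁ i.1 i.2.1 z.1 := by
    simp only [h1]; fun_prop
  have f2 : ContDiff ℝ ∞ fun z : ℝ × ℝ => quarterPt T.ω₂ j.1 j.2.1 z.2 := by
    simp only [h2]; fun_prop
  have g1 : ContDiff ℝ ∞ fun z : ℝ × ℝ => quad c₁ c₂ (T.φ₁ z.1) :=
    (contDiff_quad c₁ c₂).comp (T.smooth₁.comp contDiff_fst)
  have g2 : ContDiff ℝ ∞ fun z : ℝ × ℝ => -quad c₁ c₂ (T.φ₂ z.2) :=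
    ((contDiff_quad c₁ c₂).comp (T.smooth₂.comp contDiff_snd)).neg
  fin_cases k
  exacts [f1.contDiffOn, f2.contDiffOn,
    contDiffOn_const.mul (g1.contDiffOn.sqrt fun z hz => hz.2.1.ne'),
    contDiffOn_const.mul (g2.contDiffOn.sqrt fun z hz => (neg_pos.2 hz.2.2).ne')]

/-- The involution reverses `p₁`, so the condition `p₁ > 0` selects one representative of each
orbit. -/
lemma piecePt_injective {i j i' j' : Bool × Bool × Bool} {z z' : ℝ × ℝ}
    (hz : z ∈ T.openDom c₁ c₂) (hz' : z' ∈ T.openDom c₁ c₂) (hi : i.2.2 = true)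
    (hi' : i'.2.2 = true)
    (h : T.cover (T.piecePt c₁ c₂ i j z) = T.cover (T.piecePt c₁ c₂ i' j' z')) :
    i = i' ∧ j = j' ∧ z = z' := by
  obtain ⟨s, s', e⟩ := i
  obtain ⟨p, p', e'⟩ := i'
  obtain ⟨r, r', f⟩ := j
  obtain ⟨q, q', f'⟩ := j'
  simp only at hi hi'
  subst hi hi'
  obtain ⟨b, ⟨m, hm⟩, ⟨n, hn⟩, h2, h3⟩ := cover_eq_cover_iff.1 h
  have x1 := Real.sqrt_pos.2 hz.2.1
  have x2 := Real.sqrt_pos.2 hz'.2.1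
  have y1 := Real.sqrt_pos.2 (neg_pos.2 hz.2.2)
  have y2 := Real.sqrt_pos.2 (neg_pos.2 hz'.2.2)
  simp only [piecePt, Matrix.cons_val, sgn_true, one_mul] at hm hn h2 h3
  cases b
  · simp only [sgn_false] at h2
    linarith
  · simp only [if_true, sgn_true, one_mul, add_zero] at hm hn h3
    obtain ⟨rfl, rfl, ht⟩ := quarterPt_injective hz.1.1 hz'.1.1 hm
    obtain ⟨rfl, rfl, hq⟩ := quarterPt_injective hz.1.2 hz'.1.2 hn
    refine ⟨rfl, ?_, Prod.ext ht hq⟩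
    cases f <;> cases f' <;> simp at h3 ⊢ <;> linarith

lemma abs_lerayForm_piecePt (h : T.IsGeneric c₁ c₂) {Λ : Set T.Phase}
    {α : (Fin 4 → ℝ) → (Fin 4 → ℝ) [⋀^Fin 2]→ₗ[ℝ] ℝ} (hα : T.IsLerayForm Λ α)
    (i j : Bool × Bool × Bool) {z : ℝ × ℝ} (hz : z ∈ T.openDom c₁ c₂)
    (hΛ : T.cover (T.piecePt c₁ c₂ i j z) ∈ Λ) :
    |α (T.piecePt c₁ c₂ i j z) ![fderiv ℝ (T.piecePt c₁ c₂ i j) z (1, 0),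
      fderiv ℝ (T.piecePt c₁ c₂ i j) z (0, 1)]| = T.lerayDensity c₁ c₂ z := by
  have hU := isOpen_openDom (T := T) (c₁ := c₁) (c₂ := c₂)
  have hd : HasFDerivAt (T.piecePt c₁ c₂ i j) (fderiv ℝ (T.piecePt c₁ c₂ i j) z) z :=
    (((contDiffOn_piecePt i j).contDiffAt (hU.mem_nhds hz)).differentiableAt (by simp)).hasFDerivAt
  set D := fderiv ℝ (T.piecePt c₁ c₂ i j) z with hD
  have hk := fun k => hasFDerivAt_pi'.1 hd k
  obtain ⟨k₁, h1⟩ := quarterPt_eq_affine T.ω₁ i.1 i.2.1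
  obtain ⟨k₂, h2⟩ := quarterPt_eq_affine T.ω₂ j.1 j.2.1
  have f0 : ∀ x, D x 0 = sgn i.1 * sgn i.2.1 * x.1 := by
    intro x
    have e : HasFDerivAt (fun z : ℝ × ℝ => quarterPt T.ω₁ i.1 i.2.1 z.1)
        ((sgn i.1 * sgn i.2.1) • ContinuousLinearMap.fst ℝ ℝ ℝ) z := by
      simp only [h1]
      exact (hasFDerivAt_fst.const_mul _).add_const _
    exact congrArg (fun L => L x) ((hk 0).unique e)
  have f1 : ∀ x, D x 1 = sgn j.1 * sgn j.2.1 * x.2 := by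
    intro x
    have e : HasFDerivAt (fun z : ℝ × ℝ => quarterPt T.ω₂ j.1 j.2.1 z.2)
        ((sgn j.1 * sgn j.2.1) • ContinuousLinearMap.snd ℝ ℝ ℝ) z := by
      simp only [h2]
      exact (hasFDerivAt_snd.const_mul _).add_const _
    exact congrArg (fun L => L x) ((hk 1).unique e)
  have hlev : ∀ w ∈ T.openDom c₁ c₂, _ := fun w hw =>
    h.mem_level_iff.1 (h.piecePt_mem i j (openDom_subset hw))
  have g1 : ∀ x, T.η₁ c₁ (T.piecePt c₁ c₂ i j z) (D x) = 0 := by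
    intro x
    have e1 := (hk 2).pow 2
    have e2 := (hasDerivAt_quad c₁ c₂ _).comp_hasFDerivAt z
      ((T.profile₁.differentiable _).hasDerivAt.comp_hasFDerivAt z (hk 0))
    have e3 := congrArg (fun L => L x) (e1.unique (e2.congr_of_eventuallyEq
      ((hU.eventually_mem hz).mono fun w hw => (hlev w hw).1)))
    simp at e3
    simp only [η₁]
    linarith
  have g2 : ∀ x, T.η₂ c₁ (T.piecePt c₁ c₂ i j z) (D x) = 0 := by
    intro x
    have e1 := (hk 3).pow 2
    have e2 := ((hasDerivAt_quad c₁ c₂ _).comp_hasFDerivAt z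
      ((T.profile₂.differentiable _).hasDerivAt.comp_hasFDerivAt z (hk 1))).neg
    have e3 := congrArg (fun L => L x) (e1.unique (e2.congr_of_eventuallyEq
      ((hU.eventually_mem hz).mono fun w hw => (hlev w hw).2)))
    simp at e3
    simp only [η₂]
    linarith
  have x1 := Real.sqrt_pos.2 hz.2.1
  have y1 := Real.sqrt_pos.2 (neg_pos.2 hz.2.2)
  rw [abs_lerayForm hα hΛ (h.piecePt_mem i j (openDom_subset hz)) (c₁ := c₁) (c₂ := c₂) ?_ ?_
    ⟨g1 _, g2 _⟩ ⟨g1 _, g2 _⟩ (by rw [f0]; simp [abs_mul]) (by rw [f1]; simp) (by rw [f0]; simp)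
    (by rw [f1]; simp [abs_mul])]
  · simp only [piecePt, Matrix.cons_val, T.profile₁.apply_quarterPt, T.profile₂.apply_quarterPt,
      abs_mul, abs_sgn, one_mul, abs_of_pos x1, abs_of_pos y1, lerayDensity]
  · simpa [piecePt, sgn_ne_zero] using x1.ne'
  · simpa [piecePt, sgn_ne_zero] using y1.ne'

/-! ### Measurability of the pieces -/

lemma measurable_cover : Measurable T.cover := by
  refine measurable_quot_mk.comp ?_
  have h1 : Measurable fun u : Fin 4 → ℝ => (u 0 : AddCircle T.ω₁) :=
    AddCircle.measurable_mk'.comp (measurable_pi_apply 0)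
  have h2 : Measurable fun u : Fin 4 → ℝ => (u 1 : AddCircle T.ω₂) :=
    AddCircle.measurable_mk'.comp (measurable_pi_apply 1)
  exact h1.prodMk (h2.prodMk ((measurable_pi_apply 2).prodMk (measurable_pi_apply 3)))

/-- In the quotient σ-algebra this is measurability of the preimage in the cotangent torus, which is
the union of two injective continuous images of `E` (Lusin-Souslin), interchanged by the involution.
-/
lemma measurableSet_image_piecePt {i : Bool × Bool × Bool} (j : Bool × Bool × Bool)
    (hi : i.2.2 = true) {E : Set (ℝ × ℝ)} (hE : MeasurableSet E) (hEU : E ⊆ T.openDom c₁ c₂) :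
    MeasurableSet ((fun z => T.cover (T.piecePt c₁ c₂ i j z)) '' E) := by
  set q : (Fin 4 → ℝ) → T.CotTorus := fun u =>
    ((u 0 : AddCircle T.ω₁), (u 1 : AddCircle T.ω₂), u 2, u 3) with hq
  have hqc : Continuous q := by
    have h1 : Continuous fun u : Fin 4 → ℝ => (u 0 : AddCircle T.ω₁) :=
      (AddCircle.continuous_mk' _).comp (continuous_apply 0)
    have h2 : Continuous fun u : Fin 4 → ℝ => (u 1 : AddCircle T.ω₂) :=
      (AddCircle.continuous_mk' _).comp (continuous_apply 1)
    exact h1.prodMk (h2.prodMk ((continuous_apply 2).prodMk (continuous_apply 3)))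
  have hic : Continuous T.invCot := by unfold invCot; fun_prop
  have hmk : ∀ u v : T.CotTorus, (Quot.mk _ u : T.Phase) = Quot.mk _ v → v = u ∨ v = T.invCot u := by
    intro u v huv
    have := Quot.eqvGen_exact huv
    induction this with
    | rel x y hxy => exact .inr hxy
    | refl x => exact .inl rfl
    | symm x y _ ih =>
      rcases ih (Quot.eqvGen_sound ‹_›) with rfl | rfl
      · exact .inl rfl
      · exact .inr (invCot_invCot _).symm
    | trans x y z _ _ ih1 ih2 =>
      rcases ih1 (Quot.eqvGen_sound ‹_›) with rfl | rfl <;>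
        rcases ih2 (Quot.eqvGen_sound ‹_›) with rfl | rfl
      · exact .inl rfl
      · exact .inr rfl
      · exact .inr rfl
      · exact .inl (invCot_invCot _)
  have hinj : InjOn (fun z => T.cover (T.piecePt c₁ c₂ i j z)) E := fun z hz z' hz' hzz =>
    (piecePt_injective (hEU hz) (hEU hz') hi hi hzz).2.2
  have hρc := (continuous_piecePt (T := T) (c₁ := c₁) (c₂ := c₂) i j)
  have m1 : MeasurableSet ((fun z => q (T.piecePt c₁ c₂ i j z)) '' E) :=
    hE.image_of_continuousOn_injOn (hqc.comp hρc).continuousOn fun z hz z' hz' hzz =>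
      hinj hz hz' (congrArg (Quot.mk _) hzz)
  have m2 : MeasurableSet ((fun z => T.invCot (q (T.piecePt c₁ c₂ i j z))) '' E) :=
    hE.image_of_continuousOn_injOn (hic.comp (hqc.comp hρc)).continuousOn fun z hz z' hz' hzz =>
      hinj hz hz' (congrArg (Quot.mk _)
        ((Function.LeftInverse.injective invCot_invCot) hzz : q _ = q _))
  change MeasurableSet ((Quot.mk _ : T.CotTorus → T.Phase) ⁻¹'
    ((fun z => T.cover (T.piecePt c₁ c₂ i j z)) '' E))
  convert m1.union m2 using 1
  ext v
  constructor
  · rintro ⟨z, hz, hzv⟩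
    rcases hmk _ _ hzv with rfl | rfl
    · exact .inl ⟨z, hz, rfl⟩
    · exact .inr ⟨z, hz, rfl⟩
  · rintro (⟨z, hz, rfl⟩ | ⟨z, hz, rfl⟩)
    · exact ⟨z, hz, rfl⟩
    · exact ⟨z, hz, Quot.sound rfl⟩

end ClassicalLBT

namespace ClassicalLBT

variable {T : ClassicalLBT} {c₁ c₂ : ℝ}

/-! ### Invariant functions on the boundary -/

/-- A function on the boundary in the coordinates of the torus. -/
def onTorus (K : C(T.Γ, ℝ)) (x y : ℝ) : ℝ := K (T.base (T.cover ![x, y, 0, 0]))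

lemma apply_base_cover (K : C(T.Γ, ℝ)) (u : Fin 4 → ℝ) :
    K (T.base (T.cover u)) = onTorus K (u 0) (u 1) := rfl

lemma continuous_onTorus (K : C(T.Γ, ℝ)) : Continuous fun z : ℝ × ℝ => onTorus K z.1 z.2 := by
  refine K.continuous.comp (Continuous.subtype_mk (continuous_quot_mk.comp ?_) _)
  have h1 : Continuous fun z : ℝ × ℝ => (z.1 : AddCircle T.ω₁) :=
    (AddCircle.continuous_mk' _).comp continuous_fst
  have h2 : Continuous fun z : ℝ × ℝ => (z.2 : AddCircle T.ω₂) :=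
    (AddCircle.continuous_mk' _).comp continuous_snd
  exact h1.prodMk (h2.prodMk continuous_const)

lemma onTorus_sigma (K : C(T.Γ, ℝ)) (x y : ℝ) : onTorus K (-x) (T.ω₂ / 2 - y) = onTorus K x y := by
  have : T.cover ![-x, T.ω₂ / 2 - y, 0, 0] = T.cover ![x, y, 0, 0] := by
    rw [eq_comm, cover_eq_cover_iff]
    exact ⟨false, ⟨0, by simp⟩, ⟨0, by simp; ring⟩, by simp, by simp⟩
  simp only [onTorus, this]

lemma onTorus_add_int (K : C(T.Γ, ℝ)) (x y : ℝ) (m n : ℤ) :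
    onTorus K (x + m * T.ω₁) (y + n * T.ω₂) = onTorus K x y := by
  have : T.cover ![x + m * T.ω₁, y + n * T.ω₂, 0, 0] = T.cover ![x, y, 0, 0] := by
    rw [eq_comm, cover_eq_cover_iff]
    exact ⟨true, ⟨m, by simp⟩, ⟨n, by simp⟩, by simp, by simp⟩
  simp only [onTorus, this]

lemma IsInvariant.onTorus_neg_fst {K : C(T.Γ, ℝ)} (hK : T.IsInvariant K) (x y : ℝ) :
    onTorus K (-x) y = onTorus K x y :=
  hK _ (Subgroup.subset_closure (.inl rfl)) _ _ rfl

lemma IsInvariant.onTorus_half_sub_fst {K : C(T.Γ, ℝ)} (hK : T.IsInvariant K) (x y : ℝ) :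
    onTorus K (T.ω₁ / 2 - x) y = onTorus K x y :=
  hK _ (Subgroup.subset_closure (.inr (.inl rfl))) _ _ rfl

lemma IsInvariant.onTorus_neg_snd {K : C(T.Γ, ℝ)} (hK : T.IsInvariant K) (x y : ℝ) :
    onTorus K x (-y) = onTorus K x y :=
  hK _ (Subgroup.subset_closure (.inr (.inr rfl))) _ _ rfl

lemma IsInvariant.onTorus_quarterPt {K : C(T.Γ, ℝ)} (hK : T.IsInvariant K) (s s' r r' : Bool)
    (x y : ℝ) : onTorus K (quarterPt T.ω₁ s s' x) (quarterPt T.ω₂ r r' y) = onTorus K x y := by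
  have h1 := hK.onTorus_neg_fst
  have h2 := hK.onTorus_half_sub_fst
  have h3 := hK.onTorus_neg_snd
  -- This reflection is not among the generators of `G`; it comes from `θ₁ ↦ -θ₁` and the deck
  -- transformation `σ₁`.
  have h4 : ∀ x y, onTorus K x (T.ω₂ / 2 - y) = onTorus K x y := fun x y => by
    rw [← h1, onTorus_sigma]
  cases s <;> cases s' <;> cases r <;> cases r' <;>
    simp only [quarterPt, sgn_true, sgn_false, neg_one_mul, one_mul, h1, h2, h3, h4, if_true,
      Bool.false_eq_true, if_false]

/-- Images of the closed cell cover the torus `θ₃ = N`, and `σ₂` identifies the other end `θ₃ = -N`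
with it. -/
lemma IsInvariant.eq_zero {K : C(T.Γ, ℝ)} (hK : T.IsInvariant K)
    (h : ∀ z ∈ T.cell, onTorus K z.1 z.2 = 0) : K = 0 := by
  have h' : ∀ z ∈ closure T.cell, onTorus K z.1 z.2 = 0 := fun z hz =>
    closure_minimal h (isClosed_eq (continuous_onTorus K) continuous_const) hz
  have hcl : closure T.cell = Icc 0 (T.ω₁ / 4) ×ˢ Icc 0 (T.ω₂ / 4) := by
    have h1 := T.ω₁_pos
    have h2 := T.ω₂_pos
    rw [cell, closure_prod_eq, closure_Ioo (by positivity), closure_Ioo (by positivity)]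
  rw [hcl] at h'
  have key : ∀ x y, onTorus K x y = 0 := by
    intro x y
    obtain ⟨s, s', t, ht, m, rfl⟩ := exists_quarterPt T.ω₁_pos x
    obtain ⟨r, r', q, hq, n, rfl⟩ := exists_quarterPt T.ω₂_pos y
    rw [onTorus_add_int, hK.onTorus_quarterPt]
    exact h' (t, q) ⟨ht, hq⟩
  ext ⟨x, p, hp, rfl⟩
  have main : ∀ a : AddCircle T.ω₁, ∀ b : AddCircle T.ω₂, ∀ hab,
      K ⟨T.proj (a, b, T.top), hab⟩ = 0 := by
    intro a b hab
    induction a using QuotientAddGroup.induction_on with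
    | H a =>
      induction b using QuotientAddGroup.induction_on with
      | H b => exact key a b
  obtain ⟨a, b, s⟩ := p
  rcases hp with hp | hp
  · obtain rfl : s = T.top := Subtype.ext hp
    exact main a b _
  · have hs : T.negIcc s = T.top := Subtype.ext (by
      change -s.1 = T.N
      rw [show s.1 = -T.N from hp, neg_neg])
    have he : T.proj (a, b, s) = T.proj (a, -b, T.top) :=
      Quot.sound (.inr (by simp [inv₂, hs]))
    have : ∀ (x y : T.X) (hx : x ∈ T.Γ) (hy : y ∈ T.Γ), x = y → K ⟨x, hx⟩ = K ⟨y, hy⟩ := by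
      rintro x _ hx hy rfl; rfl
    exact (this _ _ _ ⟨_, .inl rfl, rfl⟩ he).trans (main a (-b) _)

/-! ### The Radon transform in the coordinates of the base -/

/-- The restriction of the Leray measure to a piece of a torus. -/
lemma IsVolumeOn.exists_embedding (h : T.IsGeneric c₁ c₂) {Λ : Set T.Phase}
    {α : (Fin 4 → ℝ) → (Fin 4 → ℝ) [⋀^Fin 2]→ₗ[ℝ] ℝ} {lam : Measure T.Phase}
    (hα : T.IsLerayForm Λ α) (hvol : T.IsVolumeOn Λ α lam) {i : Bool × Bool × Bool}
    (j : Bool × Bool × Bool) (hi : i.2.2 = true)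
    (hΛ : ∀ z ∈ T.openDom c₁ c₂, T.cover (T.piecePt c₁ c₂ i j z) ∈ Λ) :
    MeasurableEmbedding (fun z : T.openDom c₁ c₂ => T.cover (T.piecePt c₁ c₂ i j z)) ∧
    lam.restrict ((fun z => T.cover (T.piecePt c₁ c₂ i j z)) '' T.openDom c₁ c₂) =
      Measure.map (fun z : T.openDom c₁ c₂ => T.cover (T.piecePt c₁ c₂ i j z))
        (Measure.comap Subtype.val
          (volume.withDensity fun z => ENNReal.ofReal (T.lerayDensity c₁ c₂ z))) := by
  have hU := isOpen_openDom (T := T) (c₁ := c₁) (c₂ := c₂)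
  have hinj : InjOn (fun z => T.cover (T.piecePt c₁ c₂ i j z)) (T.openDom c₁ c₂) :=
    fun z hz z' hz' hzz => (piecePt_injective hz hz' hi hi hzz).2.2
  have hm : Measurable fun z => T.cover (T.piecePt c₁ c₂ i j z) :=
    measurable_cover.comp (continuous_piecePt i j).measurable
  have hemb : MeasurableEmbedding
      (fun z : T.openDom c₁ c₂ => T.cover (T.piecePt c₁ c₂ i j z)) := by
    refine ⟨fun z z' hzz => Subtype.ext (hinj z.2 z'.2 hzz), hm.comp measurable_subtype_coe, ?_⟩
    intro s hs
    have := measurableSet_image_piecePt (T := T) (c₁ := c₁) (c₂ := c₂) j hi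
      (MeasurableSet.subtype_image hU.measurableSet hs) (Subtype.coe_image_subset _ _)
    rwa [image_image] at this
  have hc := contDiffOn_piecePt (T := T) (c₁ := c₁) (c₂ := c₂) i j
  refine ⟨hemb, Measure.ext fun s hs => ?_⟩
  rw [Measure.restrict_apply hs, hemb.map_apply, comap_subtype_coe_apply hU.measurableSet]
  have e1 : s ∩ (fun z => T.cover (T.piecePt c₁ c₂ i j z)) '' T.openDom c₁ c₂ =
      (fun z => T.cover (T.piecePt c₁ c₂ i j z)) ''
        (T.openDom c₁ c₂ ∩ (fun z => T.cover (T.piecePt c₁ c₂ i j z)) ⁻¹' s) := by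
    rw [image_inter_preimage, inter_comm]
  have e2 : Subtype.val '' ((fun z : T.openDom c₁ c₂ => T.cover (T.piecePt c₁ c₂ i j z)) ⁻¹' s) =
      T.openDom c₁ c₂ ∩ (fun z => T.cover (T.piecePt c₁ c₂ i j z)) ⁻¹' s :=
    Subtype.image_preimage_coe (T.openDom c₁ c₂)
      ((fun z => T.cover (T.piecePt c₁ c₂ i j z)) ⁻¹' s)
  have hE := hU.measurableSet.inter (hm hs)
  obtain ⟨k₁, h1⟩ := quarterPt_eq_affine T.ω₁ i.1 i.2.1
  obtain ⟨k₂, h2⟩ := quarterPt_eq_affine T.ω₂ j.1 j.2.1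
  set L : (Fin 4 → ℝ) →L[ℝ] ℝ × ℝ :=
    ((sgn i.1 * sgn i.2.1) • ContinuousLinearMap.proj 0).prod
      ((sgn j.1 * sgn j.2.1) • ContinuousLinearMap.proj 1) with hL
  rw [e1, e2, hvol.2 _ (T.piecePt c₁ c₂ i j) hU hc
    (fun z hz => injective_fderiv_of_leftInverse hU hz
      ((hc.contDiffAt (hU.mem_nhds hz)).differentiableAt (by simp)) L
      (sgn i.1 * sgn i.2.1 * k₁, sgn j.1 * sgn j.2.1 * k₂) fun z _ => ?_) hinj hΛ _
    inter_subset_left hE, withDensity_apply _ hE]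
  · refine setLIntegral_congr_fun hE fun z hz => ?_
    rw [abs_lerayForm_piecePt h hα i j hz.1 (hΛ z hz.1)]
  · have q : ∀ a b : Bool, sgn a * sgn b * (sgn a * sgn b) = 1 := by
      intro a b; cases a <;> cases b <;> simp
    refine Prod.ext ?_ ?_
    · change sgn i.1 * sgn i.2.1 * quarterPt T.ω₁ i.1 i.2.1 z.1 = z.1 + _
      rw [h1, mul_add, ← mul_assoc, q, one_mul]
    · change sgn j.1 * sgn j.2.1 * quarterPt T.ω₂ j.1 j.2.1 z.2 = z.2 + _
      rw [h2, mul_add, ← mul_assoc, q, one_mul]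

lemma quarterPt_zero_or_quarter {l t : ℝ} (ht : t ∈ Icc 0 (l / 4)) (ht' : t ∉ Ioo 0 (l / 4))
    (s s' : Bool) : ∃ k : ℤ, quarterPt l s s' t = k * (l / 4) := by
  have : t = 0 ∨ t = l / 4 := by
    by_contra hc
    push Not at hc
    exact ht' ⟨ht.1.lt_of_ne' hc.1, ht.2.lt_of_ne hc.2⟩
  rcases this with rfl | rfl
  · refine ⟨if s' then 0 else if s then 2 else -2, ?_⟩
    cases s <;> cases s' <;> simp [quarterPt] <;> ring
  · refine ⟨if s then 1 else -1, ?_⟩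
    cases s <;> cases s' <;> simp [quarterPt] <;> ring

lemma IsGeneric.exists_piecePt_openDom (h : T.IsGeneric c₁ c₂) {ξ : T.Phase}
    (hξ : ξ ∈ T.level c₁ c₂)
    (hexc : ξ ∉ T.cover '' {z | T.cover z = ξ ∧ T.IsExceptional z}) :
    ∃ i j, i.2.2 = true ∧ ∃ z ∈ T.openDom c₁ c₂, T.cover (T.piecePt c₁ c₂ i j z) = ξ := by
  obtain ⟨u, rfl⟩ := exists_cover ξ
  obtain ⟨i, j, z, hz, hzu⟩ := h.exists_piecePt hξ
  have hn : ¬ T.IsExceptional (T.piecePt c₁ c₂ i j z) := fun he => hexc ⟨_, ⟨hzu, he⟩, hzu⟩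
  simp only [IsExceptional, not_or] at hn
  obtain ⟨⟨n1, n2⟩, n3, n4⟩ := hn
  have hzU : z ∈ T.openDom c₁ c₂ := by
    refine ⟨⟨?_, ?_⟩, hz.1.2.lt_of_ne fun h0 => n1 ?_, hz.2.2.lt_of_ne fun h0 => n3 ?_⟩
    · by_contra hc
      exact n2 (quarterPt_zero_or_quarter hz.1.1 hc _ _)
    · by_contra hc
      exact n4 (quarterPt_zero_or_quarter hz.2.1 hc _ _)
    · simp [piecePt, ← h0]
    · simp [piecePt, h0]
  obtain ⟨s, s', e⟩ := i
  obtain ⟨r, r', f⟩ := j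
  cases e
  · rw [cover_piecePt_inv] at hzu
    exact ⟨_, _, rfl, z, hzU, hzu⟩
  · exact ⟨_, _, rfl, z, hzU, hzu⟩

/-- If the Radon transform vanishes, then so do the integrals over the fundamental cell. -/
lemma IsGeneric.integral_eq_zero (h : T.IsGeneric c₁ c₂) (hne : (T.openDom c₁ c₂).Nonempty)
    (hint : IntegrableOn (T.lerayDensity c₁ c₂) (T.openDom c₁ c₂)) {K : C(T.Γ, ℝ)}
    (hK : T.IsInvariant K) {μ : T.Phase → ℝ} (hR : ∀ Λ ∈ T.tori, T.HasRadonTransform K μ Λ 0)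
    {w : ℝ × ℝ → ℝ} (hw : Continuous w) {κ : ℝ} (hκ : κ ≠ 0)
    (hμ : ∀ i j, ∀ z ∈ T.openDom c₁ c₂, μ (T.cover (T.piecePt c₁ c₂ i j z)) = κ * w z) :
    ∫ z in T.openDom c₁ c₂, onTorus K z.1 z.2 * w z * T.lerayDensity c₁ c₂ z = 0 := by
  classical
  obtain ⟨z₀, hz₀⟩ := hne
  have hU := isOpen_openDom (T := T) (c₁ := c₁) (c₂ := c₂)
  set i₀ : Bool × Bool × Bool := (true, true, true) with hi₀
  set ρ : Bool × Bool × Bool → Bool × Bool × Bool → ℝ × ℝ → T.Phase :=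
    fun i j z => T.cover (T.piecePt c₁ c₂ i j z) with hρ
  set ξ₀ := ρ i₀ i₀ z₀ with hξ₀
  have hlev : ∀ i j, ∀ z ∈ T.openDom c₁ c₂, ρ i j z ∈ T.level c₁ c₂ := fun i j z hz =>
    h.piecePt_mem i j (openDom_subset hz)
  set Λ := connectedComponentIn (T.level c₁ c₂) ξ₀ with hΛ
  have hΛl : Λ ⊆ T.level c₁ c₂ := connectedComponentIn_subset _ _
  obtain ⟨α, lam, hα, hvol, h0⟩ := hR Λ (h.component_mem_tori (hlev i₀ i₀ z₀ hz₀))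
  -- The pieces with `p₁ > 0` which meet `Λ`; being connected, they lie in `Λ`. They are disjoint
  -- and fill `Λ` up to exceptional points.
  set I : Finset ((Bool × Bool × Bool) × (Bool × Bool × Bool)) :=
    Finset.univ.filter fun p => p.1.2.2 = true ∧ ∃ z ∈ T.openDom c₁ c₂, ρ p.1 p.2 z ∈ Λ with hI
  have hmem : ∀ p ∈ I, ∀ z ∈ T.openDom c₁ c₂, ρ p.1 p.2 z ∈ Λ := by
    intro p hp z hz
    obtain ⟨-, -, w, hw, hwΛ⟩ := Finset.mem_filter.1 hp
    rw [hΛ, _root_.connectedComponentIn_eq (hΛ ▸ hwΛ : ρ p.1 p.2 w ∈ connectedComponentIn _ _),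
      h.connectedComponentIn_piecePt p.1 p.2 (openDom_subset hw) (openDom_subset hz)]
    exact mem_connectedComponentIn (hlev _ _ z hz)
  have hpI : (i₀, i₀) ∈ I := Finset.mem_filter.2
    ⟨Finset.mem_univ _, rfl, z₀, hz₀, mem_connectedComponentIn (hlev _ _ z₀ hz₀)⟩
  have hsgn : ∀ p ∈ I, p.1.2.2 = true := fun p hp => (Finset.mem_filter.1 hp).2.1
  set P : (Bool × Bool × Bool) × (Bool × Bool × Bool) → Set T.Phase :=
    fun p => ρ p.1 p.2 '' T.openDom c₁ c₂ with hP
  set ν : Measure (ℝ × ℝ) :=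
    volume.withDensity fun z => ENNReal.ofReal (T.lerayDensity c₁ c₂ z) with hν
  have hPm : ∀ p ∈ I, MeasurableSet (P p) := fun p hp =>
    measurableSet_image_piecePt p.2 (hsgn p hp) hU.measurableSet le_rfl
  have hPd : (I : Set _).Pairwise (Function.onFun Disjoint P) := by
    intro p hp q hq hpq
    refine Set.disjoint_left.2 ?_
    rintro _ ⟨z, hz, rfl⟩ ⟨z', hz', hzz⟩
    obtain ⟨e1, e2, -⟩ := piecePt_injective hz' hz (hsgn q hq) (hsgn p hp) hzz
    exact hpq (Prod.ext e1.symm e2.symm)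
  have hnull : lam (Λ \ ⋃ p ∈ I, P p) = 0 := by
    refine measure_mono_null ?_ (h.measure_exceptional hΛ hvol)
    rintro ξ ⟨hξ, hξP⟩
    by_contra hexc
    obtain ⟨i, j, hi, z, hz, hzξ⟩ := h.exists_piecePt_openDom (hΛl hξ)
      (fun ⟨u, ⟨hu, hue⟩, _⟩ => hexc ⟨u, ⟨hu ▸ hξ, hue⟩, hu⟩)
    exact hξP (mem_iUnion₂.2 ⟨(i, j), Finset.mem_filter.2 ⟨Finset.mem_univ _, hi, z, hz,
      (hzξ.symm ▸ hξ : T.cover (T.piecePt c₁ c₂ i j z) ∈ Λ)⟩, z, hz, hzξ⟩)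
  have hsub : (⋃ p ∈ I, P p) ⊆ Λ := by
    refine iUnion₂_subset fun p hp => ?_
    rintro _ ⟨z, hz, rfl⟩
    exact hmem p hp z hz
  have hae : Λ =ᵐ[lam] ⋃ p ∈ I, P p := by
    refine Filter.EventuallyLE.antisymm ?_ hsub.eventuallyLE
    exact ae_le_set.2 hnull
  have hνU : ν (T.openDom c₁ c₂) = ∫⁻ z in T.openDom c₁ c₂,
      ENNReal.ofReal (T.lerayDensity c₁ c₂ z) := withDensity_apply _ hU.measurableSet
  have hνfin : ν (T.openDom c₁ c₂) ≠ ⊤ := by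
    rw [hνU]
    have := (hasFiniteIntegral_iff_ofReal ((ae_restrict_iff' hU.measurableSet).2
      (.of_forall fun z hz => (lerayDensity_pos hz).le))).1 hint.2
    exact this.ne
  have hνpos : ν (T.openDom c₁ c₂) ≠ 0 := by
    rw [hνU]
    intro h0
    rw [lintegral_eq_zero_iff (measurable_lerayDensity.ennreal_ofReal),
      Filter.EventuallyEq, ae_restrict_iff' hU.measurableSet] at h0
    have hz : (volume : Measure (ℝ × ℝ)) (T.openDom c₁ c₂) = 0 := by
      refine measure_mono_null (fun z hz => ?_) h0
      intro hc
      have := hc hz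
      simp only [Pi.zero_apply, ENNReal.ofReal_eq_zero] at this
      exact absurd (lerayDensity_pos hz) (not_lt.2 this)
    exact (hU.measure_pos volume ⟨z₀, hz₀⟩).ne' hz
  have hemb := fun p (hp : p ∈ I) =>
    hvol.exists_embedding h hα p.2 (hsgn p hp) (hmem p hp)
  have hlamP : ∀ p ∈ I, lam (P p) = ν (T.openDom c₁ c₂) := by
    intro p hp
    obtain ⟨e1, e2⟩ := hemb p hp
    have := congrArg (fun m => m (P p)) e2
    rw [show (lam.restrict _) (P p) = lam (P p) from Measure.restrict_apply_self _ _, e1.map_apply, comap_subtype_coe_apply hU.measurableSet] at this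
    rw [this]
    congr 1
    rw [show ((fun z : T.openDom c₁ c₂ => T.cover (T.piecePt c₁ c₂ p.1 p.2 z)) ⁻¹' P p) =
      Subtype.val ⁻¹' ((fun z => T.cover (T.piecePt c₁ c₂ p.1 p.2 z)) ⁻¹' P p) from rfl, Subtype.image_preimage_coe]
    exact inter_eq_left.2 fun z hz => ⟨z, hz, rfl⟩
  have hlamΛ : lam Λ = ∑ p ∈ I, lam (P p) := by
    rw [measure_congr hae, measure_biUnion_finset hPd hPm]
  -- For infinite or zero total mass the factor `(lam Λ).toReal⁻¹` would be `0`, and a vanishing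
  -- mean value would carry no information.
  have hlamfin : lam Λ ≠ ⊤ := by
    rw [hlamΛ]
    exact ENNReal.sum_ne_top.2 fun p hp => by rw [hlamP p hp]; exact hνfin
  have hlampos : lam Λ ≠ 0 := by
    rw [hlamΛ]
    intro h0
    rw [Finset.sum_eq_zero_iff] at h0
    exact hνpos (by rw [← hlamP _ hpI, h0 _ hpI])
  have hint0 : ∫ ξ in Λ, K (T.base ξ) * μ ξ ∂lam = 0 := by
    refine (mul_eq_zero.1 h0.symm).resolve_left (inv_ne_zero ?_)
    exact (ENNReal.toReal_ne_zero).2 ⟨hlampos, hlamfin⟩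
  set g : T.Phase → ℝ := fun ξ => K (T.base ξ) * μ ξ with hg
  set G : ℝ × ℝ → ℝ := fun z => onTorus K z.1 z.2 * (κ * w z) with hG
  have hgG : ∀ p : (Bool × Bool × Bool) × (Bool × Bool × Bool), ∀ z ∈ T.openDom c₁ c₂, g (ρ p.1 p.2 z) = G z := by
    intro p z hz
    simp only [hg, hG, hρ, hμ p.1 p.2 z hz, apply_base_cover]
    congr 1
    exact hK.onTorus_quarterPt _ _ _ _ _ _
  have hGc : Continuous G := (continuous_onTorus K).mul (continuous_const.mul hw)
  have hGint : IntegrableOn G (T.openDom c₁ c₂) ν := by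
    obtain ⟨M, hM⟩ := (isCompact_Icc.prod isCompact_Icc :
      IsCompact (Icc 0 (T.ω₁ / 4) ×ˢ Icc 0 (T.ω₂ / 4))).exists_bound_of_continuousOn
      hGc.continuousOn
    refine Measure.integrableOn_of_bounded hνfin hGc.aestronglyMeasurable (M := M)
      ((ae_restrict_iff' hU.measurableSet).2 (.of_forall fun z hz => hM z ?_))
    exact ⟨Ioo_subset_Icc_self hz.1.1, Ioo_subset_Icc_self hz.1.2⟩
  have hcomp : ∀ p : (Bool × Bool × Bool) × (Bool × Bool × Bool), (g ∘ fun z : T.openDom c₁ c₂ => ρ p.1 p.2 z) = G ∘ Subtype.val :=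
    fun p => funext fun z => hgG p z z.2
  have hgi : ∀ p ∈ I, IntegrableOn g (P p) lam := by
    intro p hp
    obtain ⟨e1, e2⟩ := hemb p hp
    rw [IntegrableOn, show lam.restrict (P p) = _ from e2, e1.integrable_map_iff]
    change Integrable (g ∘ fun z : T.openDom c₁ c₂ => ρ p.1 p.2 z) _
    rw [hcomp, ← integrableOn_iff_comap_subtypeVal hU.measurableSet]
    exact hGint
  have hgI : ∀ p ∈ I, ∫ ξ in P p, g ξ ∂lam = ∫ z in T.openDom c₁ c₂, G z ∂ν := by
    intro p hp
    obtain ⟨e1, e2⟩ := hemb p hp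
    rw [show lam.restrict (P p) = _ from e2, e1.integral_map, ← integral_subtype_comap
      hU.measurableSet]
    exact integral_congr_ae (.of_forall fun z => hgG p z z.2)
  -- All pieces contribute equally, since `K` is invariant and the weight depends only on `z`.
  have hsum : (I.card : ℝ) * ∫ z in T.openDom c₁ c₂, G z ∂ν = 0 := by
    rw [← hint0, setIntegral_congr_set hae, integral_biUnion_finset I hPm hPd hgi,
      Finset.sum_congr rfl hgI, Finset.sum_const, nsmul_eq_mul]
  have hG0 := (mul_eq_zero.1 hsum).resolve_left
    (Nat.cast_ne_zero.2 (Finset.card_pos.2 ⟨_, hpI⟩).ne')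
  rw [hν, setIntegral_withDensity_eq_setIntegral_toReal_smul
    measurable_lerayDensity.ennreal_ofReal (.of_forall fun z => ENNReal.ofReal_lt_top) _
    hU.measurableSet] at hG0
  refine (mul_eq_zero.1 (?_ : κ * _ = 0)).resolve_left hκ
  rw [← hG0, ← integral_const_mul]
  refine setIntegral_congr_fun hU.measurableSet fun z hz => ?_
  simp only [hG, smul_eq_mul, ENNReal.toReal_ofReal (lerayDensity_pos hz).le]
  ring

/-- On a level `|p₃| = √quad(ν₃)` is constant over `θ₃ = N`, so the second weight is a constant of
the torus times a positive function of the base point. -/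
lemma normalPairing_piecePt (h : T.IsGeneric c₁ c₂) (i j : Bool × Bool × Bool) {z : ℝ × ℝ}
    (hz : z ∈ T.openDom c₁ c₂) : (T.normalPairing (T.cover (T.piecePt c₁ c₂ i j z)))⁻¹ =
      (√(quad c₁ c₂ T.ν₃))⁻¹ * √(Pi3 (T.φ₁ z.1) (T.φ₂ z.2) T.ν₃) := by
  have hl := h.piecePt_mem i j (openDom_subset hz)
  set u := T.piecePt c₁ c₂ i j z with hu
  have h1 : T.φ₁ (u 0) = T.φ₁ z.1 := T.profile₁.apply_quarterPt _ _ _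
  have h2 : T.φ₂ (u 1) = T.φ₂ z.2 := T.profile₂.apply_quarterPt _ _ _
  have hs : T.piPlus₃ u ^ 2 = quad c₁ c₂ T.ν₃ := (sep_of_mem_level hl).2.2
  have hn := piPlus₃_neg hl.1
  have he : √(quad c₁ c₂ T.ν₃) = -T.piPlus₃ u := by
    rw [← hs, Real.sqrt_sq_eq_abs, abs_of_neg hn]
  have hp : T.normalPairing (T.cover u) =
      T.piPlus₃ u * (-(√(Pi3 (T.φ₁ (u 0)) (T.φ₂ (u 1)) T.ν₃))⁻¹) := rfl
  rw [hp, he, h1, h2, mul_inv, inv_neg, inv_inv, inv_neg]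
  ring

end ClassicalLBT

/-! ### Symmetric moments -/

/-- Moments of total degree `i + 2 j` whose weighted sums with positive symmetric weights vanish
are antisymmetric. -/
lemma moment_add_swap_eq_zero {M : ℕ → ℕ → ℝ} {m : ℕ → ℕ → ℕ → ℝ} (hm : ∀ j k l, 0 < m j k l)
    (hs : ∀ j k l, m j k l = m j l k)
    (h : ∀ i j, ∑ p ∈ Finset.HasAntidiagonal.antidiagonal i,
      (i.choose p.1 : ℝ) * m j p.1 p.2 * M (p.1 + j) (p.2 + j) = 0) (k l : ℕ) :
    M k l + M l k = 0 := by
  have h2 : ∀ i j, ∑ p ∈ Finset.HasAntidiagonal.antidiagonal i, (i.choose p.1 : ℝ) * m j p.1 p.2 *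
      (M (p.1 + j) (p.2 + j) + M (p.2 + j) (p.1 + j)) = 0 := by
    intro i j
    have e := Finset.Nat.sum_antidiagonal_swap (n := i)
      (f := fun p => (i.choose p.1 : ℝ) * m j p.1 p.2 * M (p.1 + j) (p.2 + j))
    rw [h i j] at e
    simp only [mul_add, Finset.sum_add_distrib, h i j, zero_add]
    rw [← e]
    refine Finset.sum_congr rfl fun p hp => ?_
    have hp' := Finset.HasAntidiagonal.mem_antidiagonal.1 hp
    rw [Prod.fst_swap, Prod.snd_swap, hs j p.1, Nat.choose_symm_of_eq_add hp'.symm]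
  -- Induction on the difference of the two exponents: the inner terms of the relation have a
  -- smaller difference and vanish, leaving the two extreme ones.
  have main : ∀ i, ∀ j, M (i + j) j + M j (i + j) = 0 := by
    intro i
    induction i using Nat.strong_induction_on with
    | _ i ih =>
      intro j
      have hterm : ∀ p ∈ Finset.HasAntidiagonal.antidiagonal i, p ≠ (i, 0) → p ≠ (0, i) →
          M (p.1 + j) (p.2 + j) + M (p.2 + j) (p.1 + j) = 0 := by
        rintro ⟨a, b⟩ hp h1 h2
        have hp' : a + b = i := Finset.HasAntidiagonal.mem_antidiagonal.1 hp
        have ha : a ≠ 0 := by rintro rfl; exact h2 (by simp at hp'; simp [hp'])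
        have hb : b ≠ 0 := by rintro rfl; exact h1 (by simp at hp'; simp [hp'])
        rcases le_total a b with hab | hab
        · have := ih (b - a) (by omega) (a + j)
          rw [show b - a + (a + j) = b + j by omega] at this
          rw [add_comm]; exact this
        · have := ih (a - b) (by omega) (b + j)
          rw [show a - b + (b + j) = a + j by omega] at this
          exact this
      have hsum := h2 i j
      -- The total coefficient of the extreme terms, written as one sum because the two coincide for
      -- `i = 0`.
      have hpos : 0 < ∑ p ∈ Finset.HasAntidiagonal.antidiagonal i,
          if p = (i, 0) ∨ p = (0, i) then (i.choose p.1 : ℝ) * m j p.1 p.2 else 0 := by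
        refine Finset.sum_pos' (fun p hp => ?_) ⟨(i, 0), by simp, ?_⟩
        · split_ifs
          · exact mul_nonneg (Nat.cast_nonneg _) (hm _ _ _).le
          · exact le_rfl
        · simp [hm]
      refine (mul_eq_zero.1 (?_ : _ * (M (i + j) j + M j (i + j)) = 0)).resolve_left hpos.ne'
      rw [Finset.sum_mul]
      refine Eq.trans ?_ hsum
      refine Finset.sum_congr rfl fun p hp => ?_
      split_ifs with hc
      · rcases hc with rfl | rfl
        · simp
        · simp only [zero_add]; rw [add_comm (M (i + j) j)]
      · rw [not_or] at hc
        rw [hterm p hp hc.1 hc.2, zero_mul, mul_zero]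
  rcases le_total k l with hkl | hkl
  · have := main (l - k) k
    rw [Nat.sub_add_cancel hkl] at this
    rw [add_comm]; exact this
  · have := main (k - l) l
    rwa [Nat.sub_add_cancel hkl] at this

/-! ### Moments of a Dirichlet distribution on the triangle -/

/-- The open standard triangle. -/
def triangle : Set (ℝ × ℝ) := {q | 0 < q.1 ∧ 0 < q.2 ∧ q.1 + q.2 < 1}

/-- The density of the Dirichlet distribution with parameters `1/2, 1/2, 1`, up to a factor. -/
def dirichlet (q : ℝ × ℝ) : ℝ := (√q.1 * √q.2)⁻¹

/-- The moments of the Dirichlet distribution in the variables `1 - q₁, 1 - q₂, 1 - q₁ - q₂`. -/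
def triangleMoment (j k l : ℕ) : ℝ :=
  ∫ q in triangle, ((1 - q.1) ^ k * (1 - q.2) ^ l * (1 - q.1 - q.2) ^ j) * dirichlet q

lemma isOpen_triangle : IsOpen triangle :=
  (isOpen_lt continuous_const continuous_fst).inter
    ((isOpen_lt continuous_const continuous_snd).inter
      (isOpen_lt (continuous_fst.add continuous_snd) continuous_const))

lemma dirichlet_pos {q : ℝ × ℝ} (hq : q ∈ triangle) : 0 < dirichlet q :=
  inv_pos.2 (mul_pos (Real.sqrt_pos.2 hq.1) (Real.sqrt_pos.2 hq.2.1))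

lemma integrableOn_dirichlet : IntegrableOn dirichlet triangle := by
  have h1 : IntegrableOn (fun x : ℝ => (√x)⁻¹) (Ioo 0 1) := by
    have : IntervalIntegrable (fun x : ℝ => x ^ (-(1 / 2) : ℝ)) volume 0 1 :=
      intervalIntegral.intervalIntegrable_rpow' (by norm_num)
    rw [intervalIntegrable_iff_integrableOn_Ioo_of_le zero_le_one] at this
    refine this.congr_fun (fun x hx => ?_) measurableSet_Ioo
    simp only [Real.rpow_neg hx.1.le, Real.sqrt_eq_rpow]
  have h2 : IntegrableOn (fun q : ℝ × ℝ => (√q.1)⁻¹ * (√q.2)⁻¹) (Ioo 0 1 ×ˢ Ioo 0 1) := by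
    rw [IntegrableOn, Measure.volume_eq_prod, ← Measure.prod_restrict]
    exact Integrable.mul_prod h1 h1
  refine (h2.mono_set ?_).congr_fun (fun q _ => ?_) isOpen_triangle.measurableSet
  · rintro q ⟨h1, h2, h3⟩
    exact ⟨⟨h1, by linarith⟩, h2, by linarith⟩
  · rw [dirichlet, mul_inv]

/-- Bounded continuous functions are integrable with respect to the Dirichlet distribution. -/
lemma integrableOn_mul_dirichlet {f : ℝ × ℝ → ℝ} (hf : Continuous f) :
    IntegrableOn (fun q => f q * dirichlet q) triangle := by
  obtain ⟨M, hM⟩ := (isCompact_Icc.prod isCompact_Icc :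
    IsCompact (Icc (0 : ℝ) 1 ×ˢ Icc (0 : ℝ) 1)).exists_bound_of_continuousOn hf.continuousOn
  refine Integrable.bdd_mul (c := M) integrableOn_dirichlet hf.aestronglyMeasurable
    ((ae_restrict_iff' isOpen_triangle.measurableSet).2 (.of_forall ?_))
  rintro q ⟨h1, h2, h3⟩
  exact hM q ⟨⟨h1.le, by linarith⟩, h2.le, by linarith⟩

lemma triangleMoment_pos (j k l : ℕ) : 0 < triangleMoment j k l := by
  have hp : ∀ q ∈ triangle,
      0 < ((1 - q.1) ^ k * (1 - q.2) ^ l * (1 - q.1 - q.2) ^ j) * dirichlet q := by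
    intro q hq
    have h1 := hq.1
    have h2 := hq.2.1
    have h3 := hq.2.2
    have e1 : 0 < 1 - q.1 := by linarith
    have e2 : 0 < 1 - q.2 := by linarith
    have e3 : 0 < 1 - q.1 - q.2 := by linarith
    have := dirichlet_pos hq
    positivity
  rw [triangleMoment, setIntegral_pos_iff_support_of_nonneg_ae
    ((ae_restrict_iff' isOpen_triangle.measurableSet).2 (.of_forall fun q hq => (hp q hq).le))
    (integrableOn_mul_dirichlet (by fun_prop))]
  refine (isOpen_triangle.measure_pos volume ⟨(1 / 3, 1 / 3), ?_⟩).trans_le (measure_mono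
    fun q hq => ⟨(hp q hq).ne', hq⟩)
  norm_num [triangle]

lemma triangleMoment_swap (j k l : ℕ) : triangleMoment j k l = triangleMoment j l k := by
  have hmp : MeasurePreserving (Prod.swap : ℝ × ℝ → ℝ × ℝ) := Measure.measurePreserving_swap
  have := hmp.setIntegral_preimage_emb MeasurableEquiv.prodComm.measurableEmbedding
    (fun q => ((1 - q.1) ^ l * (1 - q.2) ^ k * (1 - q.1 - q.2) ^ j) * dirichlet q) triangle
  rw [triangleMoment, triangleMoment, ← this]
  have e : Prod.swap ⁻¹' triangle = triangle := by
    ext q; simp only [triangle, mem_preimage, Prod.fst_swap, Prod.snd_swap, mem_ofPred_eq]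
    rw [add_comm]; tauto
  rw [e]
  refine setIntegral_congr_fun isOpen_triangle.measurableSet fun q _ => ?_
  simp only [dirichlet, Prod.fst_swap, Prod.snd_swap]
  rw [mul_comm √q.2]; ring

/-! ### The simplex of quadratic polynomials with interlacing roots -/

namespace ClassicalLBT

variable {a b n : ℝ}

/-- The coefficients of the quadratic polynomial with the barycentric coordinates `q₁, q₂` with
respect to `(x - b) (x - n)`, `(x - a) (x - n)` and `(x - a) (x - b)`. -/
def baryCoeff (a b n : ℝ) (q : ℝ × ℝ) : ℝ × ℝ :=
  (a + b - ((a - n) * q.1 + (b - n) * q.2), a * b - (b * (a - n) * q.1 + a * (b - n) * q.2))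

/-- The coefficients of the quadratic polynomials which are positive at `a` and `n` and negative
at `b`. -/
def interlacing (a b n : ℝ) : Set (ℝ × ℝ) :=
  {c | 0 < quad c.1 c.2 a ∧ quad c.1 c.2 b < 0 ∧ 0 < quad c.1 c.2 n}

lemma quad_baryCoeff (q : ℝ × ℝ) (x : ℝ) :
    quad (baryCoeff a b n q).1 (baryCoeff a b n q).2 x = q.1 * ((x - b) * (x - n)) +
      q.2 * ((x - a) * (x - n)) + (1 - q.1 - q.2) * ((x - a) * (x - b)) := by
  simp only [quad, baryCoeff]; ring

lemma quad_baryCoeff_a (q : ℝ × ℝ) :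
    quad (baryCoeff a b n q).1 (baryCoeff a b n q).2 a = (a - b) * (a - n) * q.1 := by
  rw [quad_baryCoeff]; ring

lemma quad_baryCoeff_b (q : ℝ × ℝ) :
    quad (baryCoeff a b n q).1 (baryCoeff a b n q).2 b = -((a - b) * (b - n) * q.2) := by
  rw [quad_baryCoeff]; ring

lemma quad_baryCoeff_n (q : ℝ × ℝ) : quad (baryCoeff a b n q).1 (baryCoeff a b n q).2 n =
    (a - n) * (b - n) * (1 - q.1 - q.2) := by
  rw [quad_baryCoeff]; ring

/-- By Lagrange interpolation `q₁`, `q₂` and `1 - q₁ - q₂` are positive multiples of `quad(a)`,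
`-quad(b)` and `quad(n)`; that they sum to one says that the polynomial is monic. -/
lemma image_baryCoeff (hab : b < a) (hbn : n < b) :
    baryCoeff a b n '' triangle = interlacing a b n := by
  have h1 : 0 < a - b := by linarith
  have h2 : 0 < b - n := by linarith
  have h3 : 0 < a - n := by linarith
  ext c
  constructor
  · rintro ⟨q, hq, rfl⟩
    refine ⟨?_, ?_, ?_⟩
    · rw [quad_baryCoeff_a]; exact mul_pos (mul_pos h1 h3) hq.1
    · rw [quad_baryCoeff_b]; exact neg_neg_of_pos (mul_pos (mul_pos h1 h2) hq.2.1)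
    · rw [quad_baryCoeff_n]; exact mul_pos (mul_pos h3 h2) (by linarith [hq.2.2])
  · rintro ⟨ha, hb, hn⟩
    set q : ℝ × ℝ := (quad c.1 c.2 a / ((a - b) * (a - n)), -quad c.1 c.2 b / ((a - b) * (b - n)))
      with hq
    have hc : baryCoeff a b n q = c := by
      refine Prod.ext ?_ ?_ <;> simp only [baryCoeff, hq, quad] <;> field_simp <;> ring
    refine ⟨q, ⟨div_pos ha (mul_pos h1 h3), div_pos (neg_pos.2 hb) (mul_pos h1 h2), ?_⟩, hc⟩
    rw [← hc, quad_baryCoeff_n] at hn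
    linarith [(pos_iff_pos_of_mul_pos hn).1 (mul_pos h3 h2)]

lemma injective_baryCoeff (hab : b < a) (hbn : n < b) : Function.Injective (baryCoeff a b n) := by
  have h1 : 0 < a - b := by linarith
  have h2 : 0 < b - n := by linarith
  have h3 : 0 < a - n := by linarith
  intro q q' h
  have e1 := quad_baryCoeff_a (a := a) (b := b) (n := n) q
  have e2 := quad_baryCoeff_b (a := a) (b := b) (n := n) q
  rw [h, quad_baryCoeff_a] at e1
  rw [h, quad_baryCoeff_b, neg_inj] at e2
  exact Prod.ext (mul_left_cancel₀ (mul_pos h1 h3).ne' e1.symm)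
    (mul_left_cancel₀ (mul_pos h1 h2).ne' e2.symm)

lemma exists_hasFDerivAt_baryCoeff (a b n : ℝ) : ∃ L : ℝ × ℝ →L[ℝ] ℝ × ℝ,
    L.det = (a - b) * (a - n) * (b - n) ∧ ∀ q, HasFDerivAt (baryCoeff a b n) L q := by
  refine ⟨LinearMap.toContinuousLinearMap (Matrix.toLin (Module.Basis.finTwoProd ℝ)
    (Module.Basis.finTwoProd ℝ) !![-(a - n), -(b - n); -(b * (a - n)), -(a * (b - n))]), ?_, ?_⟩
  · rw [LinearMap.det_toContinuousLinearMap, LinearMap.det_toLin, Matrix.det_fin_two_of]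
    ring
  · intro q
    rw [Matrix.toLin_finTwoProd_toContinuousLinearMap]
    have e1 : HasFDerivAt (fun q : ℝ × ℝ => q.1) (ContinuousLinearMap.fst ℝ ℝ ℝ) q := hasFDerivAt_fst
    have e2 : HasFDerivAt (fun q : ℝ × ℝ => q.2) (ContinuousLinearMap.snd ℝ ℝ ℝ) q := hasFDerivAt_snd
    have k1 := ((e1.const_mul (a - n)).add (e2.const_mul (b - n))).const_sub (a + b)
    have k2 := ((e1.const_mul (b * (a - n))).add (e2.const_mul (a * (b - n)))).const_sub (a * b)
    refine (k1.prodMk k2).congr_fderiv ?_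
    ext <;> simp

/-- The density of the Leray measure as a function of the values of `φ₁` and `φ₂`. -/
def density (a b : ℝ) (c : ℝ × ℝ) : ℝ :=
  (a - b) / (2 * (√(quad c.1 c.2 a) * √(-quad c.1 c.2 b)))

/-- In barycentric coordinates both square roots factor, so the Jacobian times the Leray density is
a function of `(a, b)` times a fixed function of `q`. This splitting makes the averages over the
levels explicit. -/
lemma density_baryCoeff (hab : b < a) (hbn : n < b) {q : ℝ × ℝ} (hq : q ∈ triangle) :
    (a - b) * (a - n) * (b - n) * density a b (baryCoeff a b n q) =
      (a - b) * √((a - n) * (b - n)) / 2 * dirichlet q := by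
  have h1 : 0 < a - b := by linarith
  have h2 : 0 < b - n := by linarith
  have h3 : 0 < a - n := by linarith
  have x1 := Real.sqrt_pos.2 hq.1
  have x2 := Real.sqrt_pos.2 hq.2.1
  have s1 := Real.sqrt_pos.2 h1
  have s2 := Real.sqrt_pos.2 h2
  have s3 := Real.sqrt_pos.2 h3
  have e1 := Real.sq_sqrt h1.le
  have e2 := Real.sq_sqrt h2.le
  have e3 := Real.sq_sqrt h3.le
  rw [density, quad_baryCoeff_a, quad_baryCoeff_b, neg_neg, dirichlet, Real.sqrt_mul (by positivity),
    Real.sqrt_mul h1.le, Real.sqrt_mul (by positivity), Real.sqrt_mul h1.le, Real.sqrt_mul h3.le]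
  field_simp
  rw [e1, e2, e3]

lemma integrableOn_interlacing (hab : b < a) (hbn : n < b) (F : ℝ × ℝ → ℝ) :
    IntegrableOn (fun c => F c * density a b c) (interlacing a b n) ↔
      IntegrableOn (fun q => (a - b) * √((a - n) * (b - n)) / 2 *
        (F (baryCoeff a b n q) * dirichlet q)) triangle := by
  obtain ⟨L, hL, hd⟩ := exists_hasFDerivAt_baryCoeff a b n
  have hpos : 0 < (a - b) * (a - n) * (b - n) :=
    mul_pos (mul_pos (by linarith) (by linarith)) (by linarith)
  rw [← image_baryCoeff hab hbn, integrableOn_image_iff_integrableOn_abs_det_fderiv_smul volume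
    isOpen_triangle.measurableSet (fun q _ => (hd q).hasFDerivWithinAt)
    (injective_baryCoeff hab hbn).injOn]
  refine integrableOn_congr_fun (fun q hq => ?_) isOpen_triangle.measurableSet
  have := density_baryCoeff hab hbn hq
  simp only [hL, abs_of_pos hpos, smul_eq_mul]
  linear_combination F (baryCoeff a b n q) * this

lemma integral_interlacing (hab : b < a) (hbn : n < b) (F : ℝ × ℝ → ℝ) :
    ∫ c in interlacing a b n, F c * density a b c =
      (a - b) * √((a - n) * (b - n)) / 2 *
        ∫ q in triangle, F (baryCoeff a b n q) * dirichlet q := by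
  obtain ⟨L, hL, hd⟩ := exists_hasFDerivAt_baryCoeff a b n
  have hpos : 0 < (a - b) * (a - n) * (b - n) :=
    mul_pos (mul_pos (by linarith) (by linarith)) (by linarith)
  rw [← image_baryCoeff hab hbn, integral_image_eq_integral_abs_det_fderiv_smul volume
    isOpen_triangle.measurableSet (fun q _ => (hd q).hasFDerivWithinAt)
    (injective_baryCoeff hab hbn).injOn, ← integral_const_mul]
  refine setIntegral_congr_fun isOpen_triangle.measurableSet fun q hq => ?_
  have := density_baryCoeff hab hbn hq
  simp only [hL, abs_of_pos hpos, smul_eq_mul]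
  linear_combination F (baryCoeff a b n q) * this

/-- The test functions on the space of quadratic polynomials. -/
def testFun (n : ℝ) (i j : ℕ) (c : ℝ × ℝ) : ℝ := (c.1 - 2 * n) ^ i * quad c.1 c.2 n ^ j

/-- The shift by `2n` makes the first factor homogeneous: `c₁ - 2n = (a - n)(1 - q₁) + (b - n)(1 -
q₂)`, and `quad(n) = (a - n)(b - n)(1 - q₁ - q₂)`. The binomial theorem then separates `(a, b)` from
`q`. -/
lemma testFun_baryCoeff (i j : ℕ) (q : ℝ × ℝ) : testFun n i j (baryCoeff a b n q) =
    ∑ p ∈ Finset.HasAntidiagonal.antidiagonal i, (i.choose p.1 : ℝ) *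
      ((a - n) ^ (p.1 + j) * (b - n) ^ (p.2 + j)) *
        ((1 - q.1) ^ p.1 * (1 - q.2) ^ p.2 * (1 - q.1 - q.2) ^ j) := by
  have e : (baryCoeff a b n q).1 - 2 * n = (a - n) * (1 - q.1) + (b - n) * (1 - q.2) := by
    simp only [baryCoeff]; ring
  rw [testFun, quad_baryCoeff_n, e, (Commute.all _ _).add_pow', Finset.sum_mul]
  refine Finset.sum_congr rfl fun p _ => ?_
  simp only [nsmul_eq_mul, mul_pow, pow_add]
  ring

lemma integral_testFun (hab : b < a) (hbn : n < b) (i j : ℕ) :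
    ∫ c in interlacing a b n, testFun n i j c * density a b c =
      (a - b) * √((a - n) * (b - n)) / 2 * ∑ p ∈ Finset.HasAntidiagonal.antidiagonal i,
        (i.choose p.1 : ℝ) * triangleMoment j p.1 p.2 *
          ((a - n) ^ (p.1 + j) * (b - n) ^ (p.2 + j)) := by
  rw [integral_interlacing hab hbn]
  congr 1
  simp only [testFun_baryCoeff, Finset.sum_mul]
  rw [integral_finsetSum]
  · refine Finset.sum_congr rfl fun p _ => ?_
    rw [triangleMoment, mul_right_comm, ← integral_const_mul]
    refine integral_congr_ae (.of_forall fun q => ?_)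
    simp only; ring
  · intro p _
    exact integrableOn_mul_dirichlet (f := fun q => (i.choose p.1 : ℝ) *
      ((a - n) ^ (p.1 + j) * (b - n) ^ (p.2 + j)) *
        ((1 - q.1) ^ p.1 * (1 - q.2) ^ p.2 * (1 - q.1 - q.2) ^ j)) (by fun_prop)

lemma abs_testFun_le (hab : b < a) (hbn : n < b) {M : ℝ} (hM : a - n ≤ M) (i j : ℕ) {c : ℝ × ℝ}
    (hc : c ∈ interlacing a b n) : |testFun n i j c| ≤ (2 * M) ^ i * (M * M) ^ j := by
  have h2 : 0 < b - n := by linarith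
  have h3 : 0 < a - n := by linarith
  rw [← image_baryCoeff hab hbn] at hc
  obtain ⟨q, ⟨q1, q2, q3⟩, rfl⟩ := hc
  have e : (baryCoeff a b n q).1 - 2 * n = (a - n) * (1 - q.1) + (b - n) * (1 - q.2) := by
    simp only [baryCoeff]; ring
  have b1 : (a - n) * (1 - q.1) ≤ M * 1 := mul_le_mul hM (by linarith) (by linarith) (by linarith)
  have b2 : (b - n) * (1 - q.2) ≤ M * 1 :=
    mul_le_mul (by linarith) (by linarith) (by linarith) (by linarith)
  have p1 : 0 ≤ (a - n) * (1 - q.1) := mul_nonneg h3.le (by linarith)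
  have p2 : 0 ≤ (b - n) * (1 - q.2) := mul_nonneg h2.le (by linarith)
  have p3 : 0 ≤ (a - n) * (b - n) * (1 - q.1 - q.2) :=
    mul_nonneg (mul_pos h3 h2).le (by linarith)
  have b3 : (a - n) * (b - n) * (1 - q.1 - q.2) ≤ (M * M) * 1 :=
    mul_le_mul (mul_le_mul hM (by linarith) h2.le (by linarith)) (by linarith) (by linarith)
      (mul_nonneg (by linarith) (by linarith))
  rw [testFun, quad_baryCoeff_n, e, abs_mul, abs_pow, abs_pow, abs_of_nonneg (add_nonneg p1 p2),
    abs_of_nonneg p3]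
  exact mul_le_mul (pow_le_pow_left₀ (by linarith) (by linarith) i)
    (pow_le_pow_left₀ p3 (by linarith) j) (by positivity)
    (pow_nonneg (by linarith) i)

end ClassicalLBT

/-- The Stone-Weierstrass theorem for the polynomials in a family of functions which separates
points. -/
lemma exists_mvPolynomial_near {ι Q : Type*} [TopologicalSpace Q] [CompactSpace Q]
    (g : ι → C(Q, ℝ)) (hg : ∀ z z', (∀ k, g k z = g k z') → z = z') (f : C(Q, ℝ)) {ε : ℝ}
    (hε : 0 < ε) : ∃ p : MvPolynomial ι ℝ, ∀ z,
      |f z - MvPolynomial.eval (fun k => g k z) p| ≤ ε := by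
  have hgz : ∀ (p : MvPolynomial ι ℝ) (z : Q),
      (MvPolynomial.aeval g p) z = MvPolynomial.eval (fun k => g k z) p := by
    intro p z
    have := MvPolynomial.comp_aeval_apply (R := ℝ) g (ContinuousMap.evalAlgHom ℝ ℝ z) p
    change ContinuousMap.evalAlgHom ℝ ℝ z (MvPolynomial.aeval g p) = _
    rw [this, MvPolynomial.aeval_eq_eval]
    rfl
  have hsep : (MvPolynomial.aeval (R := ℝ) g).range.SeparatesPoints := by
    intro z z' hne
    by_contra hcon
    push Not at hcon
    refine hne (hg z z' fun k => ?_)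
    have := hcon _ ⟨_, ⟨MvPolynomial.X k, rfl⟩, rfl⟩
    have := (hgz (MvPolynomial.X k) z).symm.trans (this.trans (hgz (MvPolynomial.X k) z'))
    simpa using this
  obtain ⟨⟨_, p, rfl⟩, hp⟩ :=
    ContinuousMap.exists_mem_subalgebra_near_continuousMap_of_separatesPoints _ hsep f ε hε
  refine ⟨p, fun z => ?_⟩
  have h1 : |MvPolynomial.aeval g p z - f z| ≤ ε :=
    (ContinuousMap.norm_coe_le_norm (MvPolynomial.aeval g p - f) z).trans hp.le
  rwa [hgz, abs_sub_comm] at h1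

namespace ClassicalLBT

variable {T : ClassicalLBT}

/-! ### The kernel of the Radon transform -/

variable (T) in
/-- The pairs of a level and a point of the fundamental cell under the level. -/
def incidence : Set ((ℝ × ℝ) × (ℝ × ℝ)) :=
  {p | p.2 ∈ T.cell ∧ p.1 ∈ interlacing (T.φ₁ p.2.1) (T.φ₂ p.2.2) T.ν₃}

variable (T) in
/-- The Leray density, extended by zero. -/
def kernel : (ℝ × ℝ) × (ℝ × ℝ) → ℝ :=
  T.incidence.indicator fun p => density (T.φ₁ p.2.1) (T.φ₂ p.2.2) p.1

variable (T) in
/-- The Jacobian factor which arises in the integration of the kernel over the levels. -/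
def jacobian (z : ℝ × ℝ) : ℝ :=
  (T.φ₁ z.1 - T.φ₂ z.2) * √((T.φ₁ z.1 - T.ν₃) * (T.φ₂ z.2 - T.ν₃)) / 2

lemma lt_of_mem_cell {z : ℝ × ℝ} (hz : z ∈ T.cell) : T.φ₂ z.2 < T.φ₁ z.1 := by
  have := T.profile₁.strictMonoOn T.profile₁.zero_mem (Ioo_subset_Icc_self hz.1) hz.1.1
  rw [T.φ₁_zero] at this
  exact (T.φ₂_le_ν₁ _).trans_lt this

lemma jacobian_pos {z : ℝ × ℝ} (hz : z ∈ T.cell) : 0 < T.jacobian z :=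
  half_pos (mul_pos (sub_pos.2 (lt_of_mem_cell hz)) (Real.sqrt_pos.2 (Pi3_pos z.1 z.2)))

lemma continuous_jacobian : Continuous T.jacobian := by
  have h1 := T.smooth₁.continuous
  have h2 := T.smooth₂.continuous
  unfold jacobian
  fun_prop

lemma cell_subset : T.cell ⊆ Icc 0 (T.ω₁ / 4) ×ˢ Icc 0 (T.ω₂ / 4) :=
  prod_mono Ioo_subset_Icc_self Ioo_subset_Icc_self

lemma integrableOn_cell {f : ℝ × ℝ → ℝ} (hf : Continuous f) : IntegrableOn f T.cell :=
  (hf.continuousOn.integrableOn_compact (isCompact_Icc.prod isCompact_Icc)).mono_set cell_subset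

lemma measurableSet_incidence : MeasurableSet T.incidence := by
  have h1 := T.smooth₁.continuous
  have h2 := T.smooth₂.continuous
  have hq : ∀ f : (ℝ × ℝ) × (ℝ × ℝ) → ℝ, Continuous f →
      Continuous fun p => quad p.1.1 p.1.2 (f p) := fun f hf => by unfold quad; fun_prop
  have ho : IsOpen T.incidence := (isOpen_cell.preimage continuous_snd).inter
    ((isOpen_lt continuous_const (hq (fun p => T.φ₁ p.2.1) (by fun_prop))).inter
      ((isOpen_lt (hq (fun p => T.φ₂ p.2.2) (by fun_prop)) continuous_const).inter
        (isOpen_lt continuous_const (hq (fun _ => T.ν₃) continuous_const))))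
  exact ho.measurableSet

lemma measurable_kernel : Measurable T.kernel := by
  have h1 := T.smooth₁.continuous
  have h2 := T.smooth₂.continuous
  refine Measurable.indicator ?_ measurableSet_incidence
  unfold density quad
  refine Measurable.div ?_ ?_ <;> refine Continuous.measurable ?_ <;> fun_prop

lemma kernel_nonneg (p : (ℝ × ℝ) × (ℝ × ℝ)) : 0 ≤ T.kernel p :=
  indicator_nonneg (fun p hp => div_nonneg (sub_nonneg.2 (T.le₂₁ _ _)) (by positivity)) p

lemma kernel_eq_of_mem_cell {z : ℝ × ℝ} (hz : z ∈ T.cell) (c : ℝ × ℝ) : T.kernel (c, z) =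
    (interlacing (T.φ₁ z.1) (T.φ₂ z.2) T.ν₃).indicator (density (T.φ₁ z.1) (T.φ₂ z.2)) c := by
  by_cases hc : c ∈ interlacing (T.φ₁ z.1) (T.φ₂ z.2) T.ν₃
  · rw [indicator_of_mem hc, kernel, indicator_of_mem (show (c, z) ∈ T.incidence from ⟨hz, hc⟩)]
  · rw [indicator_of_notMem hc, kernel,
      indicator_of_notMem (show (c, z) ∉ T.incidence from fun h => hc h.2)]

lemma kernel_eq_zero {z : ℝ × ℝ} (hz : z ∉ T.cell) (c : ℝ × ℝ) : T.kernel (c, z) = 0 :=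
  indicator_of_notMem (fun h => hz h.1) _

lemma kernel_eq_lerayDensity {c : ℝ × ℝ} (hc : 0 < quad c.1 c.2 T.ν₃) (z : ℝ × ℝ) :
    T.kernel (c, z) = (T.openDom c.1 c.2).indicator (T.lerayDensity c.1 c.2) z := by
  by_cases hz : z ∈ T.openDom c.1 c.2
  · rw [indicator_of_mem hz, kernel, indicator_of_mem
      (show (c, z) ∈ T.incidence from ⟨hz.1, hz.2.1, hz.2.2, hc⟩)]
    rfl
  · rw [indicator_of_notMem hz, kernel,
      indicator_of_notMem (show (c, z) ∉ T.incidence from fun h => hz ⟨h.1, h.2.1, h.2.2.1⟩)]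

lemma kernel_eq_zero_of_nonpos {c : ℝ × ℝ} (hc : quad c.1 c.2 T.ν₃ ≤ 0) (z : ℝ × ℝ) :
    T.kernel (c, z) = 0 :=
  indicator_of_notMem (fun h => absurd h.2.2.2 (not_lt.2 hc)) _

lemma measurableSet_interlacing (a b n : ℝ) : MeasurableSet (interlacing a b n) := by
  have hq : ∀ x, Continuous fun c : ℝ × ℝ => quad c.1 c.2 x := fun x => by unfold quad; fun_prop
  have ho : IsOpen (interlacing a b n) := (isOpen_lt continuous_const (hq a)).inter
    ((isOpen_lt (hq b) continuous_const).inter (isOpen_lt continuous_const (hq n)))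
  exact ho.measurableSet

lemma integral_mul_kernel (F : ℝ × ℝ → ℝ) {z : ℝ × ℝ} (hz : z ∈ T.cell) :
    ∫ c, F c * T.kernel (c, z) = ∫ c in interlacing (T.φ₁ z.1) (T.φ₂ z.2) T.ν₃,
      F c * density (T.φ₁ z.1) (T.φ₂ z.2) c := by
  rw [← integral_indicator (measurableSet_interlacing _ _ _)]
  refine integral_congr_ae (.of_forall fun c => ?_)
  simp only [kernel_eq_of_mem_cell hz]
  exact (indicator_mul_right _ _ _).symm

lemma integrable_kernel_left (z : ℝ × ℝ) : Integrable fun c => T.kernel (c, z) := by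
  by_cases hz : z ∈ T.cell
  · simp only [kernel_eq_of_mem_cell hz]
    refine IntegrableOn.integrable_indicator ?_ (measurableSet_interlacing _ _ _)
    have := (integrableOn_interlacing (lt_of_mem_cell hz) (ν₃_lt z.2) fun _ => 1).2
      ((integrableOn_mul_dirichlet continuous_const).const_mul _)
    simpa using this
  · simp only [kernel_eq_zero hz]
    exact integrable_zero _ _ _

/-- Integrating over the levels first gives a constant times the continuous function `jacobian` on
the bounded cell. Besides Fubini, this yields the finiteness of the Leray volume for almost every
level. -/
lemma integrable_kernel : Integrable T.kernel (volume.prod volume) := by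
  refine (integrable_prod_iff' measurable_kernel.aestronglyMeasurable).2
    ⟨.of_forall integrable_kernel_left, ?_⟩
  have e : (fun z => ∫ c, ‖T.kernel (c, z)‖) =
      T.cell.indicator fun z => T.jacobian z * ∫ q in triangle, 1 * dirichlet q := by
    funext z
    simp only [Real.norm_eq_abs, abs_of_nonneg (kernel_nonneg _)]
    by_cases hz : z ∈ T.cell
    · have := integral_mul_kernel (fun _ => 1) hz
      rw [integral_interlacing (lt_of_mem_cell hz) (ν₃_lt z.2)] at this
      simp only [one_mul] at this
      rw [indicator_of_mem hz, this]
      simp only [jacobian, one_mul]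
    · simp [indicator_of_notMem hz, kernel_eq_zero hz]
  rw [e]
  exact (integrableOn_cell (continuous_jacobian.mul continuous_const)).integrable_indicator
    isOpen_cell.measurableSet

lemma ae_quad_ne_zero (x : ℝ) : ∀ᵐ c : ℝ × ℝ, quad c.1 c.2 x ≠ 0 := by
  have hc : Continuous fun c : ℝ × ℝ => quad c.1 c.2 x := by unfold quad; fun_prop
  have hm : MeasurableSet {c : ℝ × ℝ | quad c.1 c.2 x = 0} :=
    (isClosed_eq hc continuous_const).measurableSet
  have : (volume.prod volume) {c : ℝ × ℝ | quad c.1 c.2 x = 0} = 0 := by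
    rw [Measure.measure_prod_null hm]
    refine .of_forall fun c₁ => measure_mono_null (t := {c₁ * x - x ^ 2}) (fun c₂ h => ?_)
      (measure_singleton _)
    have h' : x ^ 2 - c₁ * x + c₂ = 0 := h
    rw [mem_singleton_iff]
    linarith
  rw [ae_iff, Measure.volume_eq_prod]
  simpa using this

/-- Fubini's theorem for the vanishing Radon transform. -/
lemma sum_moments_eq_zero {W : ℝ × ℝ → ℝ} (hW : Continuous W)
    (h : ∀ c₁ c₂, T.IsGeneric c₁ c₂ → (T.openDom c₁ c₂).Nonempty →
      IntegrableOn (T.lerayDensity c₁ c₂) (T.openDom c₁ c₂) →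
      ∫ z in T.openDom c₁ c₂, W z * T.lerayDensity c₁ c₂ z = 0) (i j : ℕ) :
    ∑ p ∈ Finset.HasAntidiagonal.antidiagonal i, (i.choose p.1 : ℝ) * triangleMoment j p.1 p.2 *
      ∫ z in T.cell, (W z * T.jacobian z) *
        ((T.φ₁ z.1 - T.ν₃) ^ (p.1 + j) * (T.φ₂ z.2 - T.ν₃) ^ (p.2 + j)) = 0 := by
  have hc1 := T.smooth₁.continuous
  have hc2 := T.smooth₂.continuous
  obtain ⟨M, hM⟩ := (isCompact_Icc.prod isCompact_Icc :
    IsCompact (Icc 0 (T.ω₁ / 4) ×ˢ Icc 0 (T.ω₂ / 4))).exists_bound_of_continuousOn hW.continuousOn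
  set R := T.φ₁ (T.ω₁ / 4) - T.ν₃ with hR
  have htc : Continuous (testFun T.ν₃ i j) := by unfold testFun quad; fun_prop
  have hGint : Integrable (Function.uncurry fun c z => testFun T.ν₃ i j c * (W z * T.kernel (c, z)))
      (volume.prod volume) := by
    refine Integrable.mono' ((integrable_kernel (T := T)).const_mul (((2 * R) ^ i * (R * R) ^ j) * M)) ?_
      (.of_forall ?_)
    · exact ((htc.measurable.comp measurable_fst).mul
        ((hW.measurable.comp measurable_snd).mul measurable_kernel)).aestronglyMeasurable
    · rintro ⟨c, z⟩
      simp only [Function.uncurry, norm_mul, Real.norm_eq_abs, abs_of_nonneg (kernel_nonneg _)]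
      by_cases hp : (c, z) ∈ T.incidence
      · have h1 := abs_testFun_le (lt_of_mem_cell hp.1) (ν₃_lt z.2) (M := R)
          (sub_le_sub_right (T.profile₁.mem_Icc _).2 _) i j hp.2
        have h2 : |W z| ≤ M := hM z (cell_subset hp.1)
        rw [← mul_assoc]
        exact mul_le_mul_of_nonneg_right (mul_le_mul h1 h2 (abs_nonneg _)
          ((abs_nonneg _).trans h1)) (kernel_nonneg _)
      · simp [kernel, indicator_of_notMem hp]
  have hswap := integral_integral_swap hGint
  -- For almost every `c` either the kernel vanishes identically in `z` or a point of `openDom`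
  -- supplies the two remaining genericity conditions, so that the hypothesis applies.
  have hleft : ∫ c, ∫ z, testFun T.ν₃ i j c * (W z * T.kernel (c, z)) = 0 := by
    rw [integral_eq_zero_of_ae]
    have hker : ∀ᵐ c : ℝ × ℝ, Integrable fun z => T.kernel (c, z) := integrable_kernel.prod_right_ae
    filter_upwards [ae_quad_ne_zero 0, ae_quad_ne_zero T.ν₁, hker] with c h0 h1 h2
    rw [integral_const_mul]
    refine mul_eq_zero_of_right _ ?_
    rcases le_or_gt (quad c.1 c.2 T.ν₃) 0 with hn | hn
    · simp [kernel_eq_zero_of_nonpos hn]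
    have hU := (isOpen_openDom (T := T) (c₁ := c.1) (c₂ := c.2)).measurableSet
    simp only [kernel_eq_lerayDensity hn] at h2 ⊢
    rw [integrable_indicator_iff hU] at h2
    have e : ∫ z, W z * (T.openDom c.1 c.2).indicator (T.lerayDensity c.1 c.2) z =
        ∫ z in T.openDom c.1 c.2, W z * T.lerayDensity c.1 c.2 z := by
      rw [← integral_indicator hU]
      exact integral_congr_ae (.of_forall fun z => (indicator_mul_right _ _ _).symm)
    rw [e]
    rcases (T.openDom c.1 c.2).eq_empty_or_nonempty with he | hne
    · rw [he]; simp
    · obtain ⟨z, hz⟩ := id hne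
      exact h _ _ ⟨h0, h1, hn, ⟨_, hz.2.1⟩, ⟨_, hz.2.2⟩⟩ hne h2
  rw [hleft] at hswap
  have hright : ∀ z, ∫ c, testFun T.ν₃ i j c * (W z * T.kernel (c, z)) =
      T.cell.indicator (fun z => ∑ p ∈ Finset.HasAntidiagonal.antidiagonal i,
        (i.choose p.1 : ℝ) * triangleMoment j p.1 p.2 * ((W z * T.jacobian z) *
        ((T.φ₁ z.1 - T.ν₃) ^ (p.1 + j) * (T.φ₂ z.2 - T.ν₃) ^ (p.2 + j)))) z := by
    intro z
    by_cases hz : z ∈ T.cell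
    · rw [indicator_of_mem hz]
      have e1 : ∀ c, testFun T.ν₃ i j c * (W z * T.kernel (c, z)) =
          W z * (testFun T.ν₃ i j c * T.kernel (c, z)) := fun c => by ring
      simp only [e1]
      rw [integral_const_mul, integral_mul_kernel _ hz,
        integral_testFun (lt_of_mem_cell hz) (ν₃_lt z.2), Finset.mul_sum, Finset.mul_sum]
      refine Finset.sum_congr rfl fun p _ => ?_
      rw [jacobian]
      ring
    · simp [indicator_of_notMem hz, kernel_eq_zero hz]
  simp only [hright] at hswap
  rw [integral_indicator isOpen_cell.measurableSet, integral_finsetSum] at hswap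
  · rw [hswap]
    exact Finset.sum_congr rfl fun p _ => (integral_const_mul _ _).symm
  · intro p _
    have hj := T.continuous_jacobian
    exact integrableOn_cell (by fun_prop)

/-! ### Density of the symmetric polynomials -/

/-- Antisymmetry of the moments means orthogonality of `H` to all symmetric polynomials in `A` and
`B`. These are dense in the continuous functions on the closed cell, so `H` is orthogonal to itself.
-/
lemma integral_sq_eq_zero_of_moments {H : ℝ × ℝ → ℝ} (hH : Continuous H)
    (h : ∀ k l, (∫ z in T.cell, H z * ((T.φ₁ z.1 - T.ν₃) ^ k * (T.φ₂ z.2 - T.ν₃) ^ l)) +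
      ∫ z in T.cell, H z * ((T.φ₁ z.1 - T.ν₃) ^ l * (T.φ₂ z.2 - T.ν₃) ^ k) = 0) :
    ∫ z in T.cell, H z * H z = 0 := by
  have hc1 := T.smooth₁.continuous
  have hc2 := T.smooth₂.continuous
  set A : ℝ × ℝ → ℝ := fun z => T.φ₁ z.1 - T.ν₃ with hA
  set B : ℝ × ℝ → ℝ := fun z => T.φ₂ z.2 - T.ν₃ with hB
  have hAc : Continuous A := by fun_prop
  have hBc : Continuous B := by fun_prop
  set e : ℝ × ℝ → Fin 2 → ℝ := fun z => ![A z + B z, A z * B z] with he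
  -- Exchanging the exponents of `A` and `B` changes the sign of each moment but not the sum, so the
  -- integral equals its negative.
  have hmon : ∀ i j : ℕ, ∫ z in T.cell, H z * ((A z + B z) ^ i * (A z * B z) ^ j) = 0 := by
    intro i j
    have e1 : ∀ z, H z * ((A z + B z) ^ i * (A z * B z) ^ j) =
        ∑ p ∈ Finset.HasAntidiagonal.antidiagonal i,
          (i.choose p.1 : ℝ) * (H z * (A z ^ (p.1 + j) * B z ^ (p.2 + j))) := by
      intro z
      rw [(Commute.all _ _).add_pow', Finset.sum_mul, Finset.mul_sum]
      refine Finset.sum_congr rfl fun p _ => ?_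
      simp only [nsmul_eq_mul, mul_pow, pow_add]
      ring
    have e2 : ∫ z in T.cell, H z * ((A z + B z) ^ i * (A z * B z) ^ j) =
        ∑ p ∈ Finset.HasAntidiagonal.antidiagonal i, (i.choose p.1 : ℝ) *
          ∫ z in T.cell, H z * (A z ^ (p.1 + j) * B z ^ (p.2 + j)) := by
      simp only [e1]
      rw [integral_finsetSum]
      · exact Finset.sum_congr rfl fun p _ => integral_const_mul _ _
      · exact fun p _ => integrableOn_cell (by fun_prop)
    have e3 := Finset.Nat.sum_antidiagonal_swap (n := i) (f := fun p => (i.choose p.1 : ℝ) *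
      ∫ z in T.cell, H z * (A z ^ (p.1 + j) * B z ^ (p.2 + j)))
    have e4 : ∑ p ∈ Finset.HasAntidiagonal.antidiagonal i, (i.choose p.1 : ℝ) *
        ((∫ z in T.cell, H z * (A z ^ (p.1 + j) * B z ^ (p.2 + j))) +
        ∫ z in T.cell, H z * (A z ^ (p.2 + j) * B z ^ (p.1 + j))) = 0 :=
      Finset.sum_eq_zero fun p _ => mul_eq_zero_of_right _ (h _ _)
    simp only [mul_add, Finset.sum_add_distrib] at e4
    rw [← e2] at e3 e4
    have e5 : ∑ p ∈ Finset.HasAntidiagonal.antidiagonal i, (i.choose p.1 : ℝ) *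
        ∫ z in T.cell, H z * (A z ^ (p.2 + j) * B z ^ (p.1 + j)) =
        ∫ z in T.cell, H z * ((A z + B z) ^ i * (A z * B z) ^ j) := by
      rw [← e3]
      refine Finset.sum_congr rfl fun p hp => ?_
      have hp' := Finset.HasAntidiagonal.mem_antidiagonal.1 hp
      rw [Prod.fst_swap, Prod.snd_swap, Nat.choose_symm_of_eq_add hp'.symm]
    rw [e5] at e4
    linarith
  have hec : ∀ p : MvPolynomial (Fin 2) ℝ, Continuous fun z => MvPolynomial.eval (e z) p := by
    intro p
    refine (MvPolynomial.continuous_eval p).comp (continuous_pi fun k => ?_)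
    fin_cases k
    exacts [hAc.add hBc, hAc.mul hBc]
  have hpoly : ∀ p : MvPolynomial (Fin 2) ℝ,
      ∫ z in T.cell, H z * MvPolynomial.eval (e z) p = 0 := by
    intro p
    have e1 : ∀ z, H z * MvPolynomial.eval (e z) p = ∑ d ∈ p.support,
        p.coeff d * (H z * ((A z + B z) ^ d 0 * (A z * B z) ^ d 1)) := by
      intro z
      rw [MvPolynomial.eval_eq', Finset.mul_sum]
      refine Finset.sum_congr rfl fun d _ => ?_
      rw [Fin.prod_univ_two]
      simp only [he, Matrix.cons_val]
      ring
    simp only [e1]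
    rw [integral_finsetSum]
    · refine Finset.sum_eq_zero fun d _ => ?_
      rw [integral_const_mul, hmon, mul_zero]
    · exact fun d _ => integrableOn_cell (by fun_prop)
  set Q : Set (ℝ × ℝ) := Icc 0 (T.ω₁ / 4) ×ˢ Icc 0 (T.ω₂ / 4) with hQ
  have : CompactSpace Q := isCompact_iff_compactSpace.1 (isCompact_Icc.prod isCompact_Icc)
  set g : Fin 2 → C(Q, ℝ) := ![⟨fun z => A z + B z, by fun_prop⟩, ⟨fun z => A z * B z, by fun_prop⟩]
    with hg
  have hsep : ∀ z z' : Q, (∀ k, g k z = g k z') → z = z' := by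
    intro z z' hzz
    have k0' : A z + B z = A z' + B z' := hzz 0
    have k1' : A z * B z = A z' * B z' := hzz 1
    have hd : ∀ z : ℝ × ℝ, 0 ≤ A z - B z := fun z => by
      have := T.le₂₁ z.1 z.2
      simp only [hA, hB]; linarith
    -- Symmetric functions give only the unordered pair; `A ≥ B` restores the order.
    have hsq : A z - B z = A z' - B z' := by
      refine (sq_eq_sq₀ (hd z) (hd z')).1 ?_
      have s1 : (A z - B z) ^ 2 = (A z + B z) ^ 2 - 4 * (A z * B z) := by ring
      have s2 : (A z' - B z') ^ 2 = (A z' + B z') ^ 2 - 4 * (A z' * B z') := by ring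
      rw [s1, s2, k0', k1']
    have a1 : T.φ₁ z.1.1 = T.φ₁ z'.1.1 := by
      have : A z = A z' := by linarith
      simpa [hA] using this
    have a2 : T.φ₂ z.1.2 = T.φ₂ z'.1.2 := by
      have : B z = B z' := by linarith
      simpa [hB] using this
    exact Subtype.ext (Prod.ext
      (T.profile₁.strictMonoOn.injOn z.2.1 z'.2.1 a1)
      (T.profile₂.strictMonoOn.injOn z.2.2 z'.2.2 a2))
  have hHi : IntegrableOn (fun z => |H z|) T.cell := integrableOn_cell hH.abs
  have hbound : ∀ ε > 0, |∫ z in T.cell, H z * H z| ≤ ε * ∫ z in T.cell, |H z| := by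
    intro ε hε
    obtain ⟨p, hp⟩ := exists_mvPolynomial_near g hsep ⟨fun z : Q => H z, by fun_prop⟩ hε
    have hpz : ∀ z ∈ T.cell, |H z - MvPolynomial.eval (e z) p| ≤ ε := by
      intro z hz
      have h1 := hp ⟨z, cell_subset hz⟩
      have h2 : (fun k => g k ⟨z, cell_subset hz⟩) = e z := by
        funext k
        fin_cases k <;> rfl
      rwa [h2] at h1
    have e1 : ∫ z in T.cell, H z * H z =
        ∫ z in T.cell, H z * (H z - MvPolynomial.eval (e z) p) := by
      simp only [mul_sub]
      have i1 : IntegrableOn (fun z => H z * H z) T.cell := integrableOn_cell (hH.mul hH)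
      have i2 : IntegrableOn (fun z => H z * MvPolynomial.eval (e z) p) T.cell :=
        integrableOn_cell (hH.mul (hec p))
      rw [integral_sub i1 i2, hpoly, sub_zero]
    rw [e1, ← integral_const_mul, ← Real.norm_eq_abs]
    refine norm_integral_le_of_norm_le (hHi.const_mul ε)
      ((ae_restrict_iff' isOpen_cell.measurableSet).2 (.of_forall fun z hz => ?_))
    rw [norm_mul, mul_comm]
    exact mul_le_mul_of_nonneg_right (hpz z hz) (norm_nonneg _)
  have hnn : 0 ≤ ∫ z in T.cell, |H z| := integral_nonneg fun z => abs_nonneg _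
  refine abs_eq_zero.1 (le_antisymm (le_of_forall_pos_le_add fun δ hδ => ?_) (abs_nonneg _))
  -- The `+ 1` keeps the denominator positive when the integral vanishes.
  refine (hbound (δ / ((∫ z in T.cell, |H z|) + 1)) (by positivity)).trans ?_
  rw [zero_add, div_mul_eq_mul_div, div_le_iff₀ (by positivity)]
  nlinarith

lemma eq_zero_of_moments {H : ℝ × ℝ → ℝ} (hH : Continuous H)
    (h : ∀ k l, (∫ z in T.cell, H z * ((T.φ₁ z.1 - T.ν₃) ^ k * (T.φ₂ z.2 - T.ν₃) ^ l)) +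
      ∫ z in T.cell, H z * ((T.φ₁ z.1 - T.ν₃) ^ l * (T.φ₂ z.2 - T.ν₃) ^ k) = 0) :
    ∀ z ∈ T.cell, H z = 0 := by
  have h0 := integral_sq_eq_zero_of_moments hH h
  rw [setIntegral_eq_zero_iff_of_nonneg_ae (.of_forall fun z => mul_self_nonneg _)
    (integrableOn_cell (hH.mul hH))] at h0
  have := Measure.eqOn_open_of_ae_eq h0 isOpen_cell (hH.mul hH).continuousOn continuousOn_const
  exact fun z hz => mul_self_eq_zero.1 (this hz)

/-- The Radon transform with a weight which is a function of the base point, up to a constant on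
each torus, is injective. -/
lemma eq_zero_of_hasRadonTransform {K : C(T.Γ, ℝ)} (hK : T.IsInvariant K) {μ : T.Phase → ℝ}
    (hR : ∀ Λ ∈ T.tori, T.HasRadonTransform K μ Λ 0) {w : ℝ × ℝ → ℝ} (hw : Continuous w)
    (hw0 : ∀ z, w z ≠ 0) {κ : ℝ → ℝ → ℝ} (hκ : ∀ c₁ c₂, T.IsGeneric c₁ c₂ → κ c₁ c₂ ≠ 0)
    (hμ : ∀ c₁ c₂, T.IsGeneric c₁ c₂ → ∀ i j, ∀ z ∈ T.openDom c₁ c₂,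
      μ (T.cover (T.piecePt c₁ c₂ i j z)) = κ c₁ c₂ * w z) : K = 0 := by
  have hW : Continuous fun z : ℝ × ℝ => onTorus K z.1 z.2 * w z := (continuous_onTorus K).mul hw
  have key := eq_zero_of_moments (T := T) (hW.mul (T.continuous_jacobian)) fun k l =>
    moment_add_swap_eq_zero (M := fun k l => ∫ z in T.cell,
      (onTorus K z.1 z.2 * w z * T.jacobian z) * ((T.φ₁ z.1 - T.ν₃) ^ k *
      (T.φ₂ z.2 - T.ν₃) ^ l)) triangleMoment_pos triangleMoment_swap
      (sum_moments_eq_zero hW fun c₁ c₂ h hne hint =>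
        h.integral_eq_zero hne hint hK hR hw (hκ c₁ c₂ h) (hμ c₁ c₂ h)) k l
  refine hK.eq_zero fun z hz => ?_
  have := key z hz
  simpa [hw0 z, (jacobian_pos hz).ne'] using this

end ClassicalLBT

end

theorem mainTheorem1 (T : ClassicalLBT) (μ : T.Phase → ℝ)
    (hμ : (∀ ξ ∈ T.coball, μ ξ = 1) ∨ (∀ ξ ∈ T.coball, μ ξ = (T.normalPairing ξ)⁻¹))
    (K : C(T.Γ, ℝ)) (hK : T.IsInvariant K)
    (hR : ∀ Λ ∈ T.tori, T.HasRadonTransform K μ Λ 0) :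
    K = 0 := by
  have hc : ∀ c₁ c₂, T.IsGeneric c₁ c₂ → ∀ i j, ∀ z ∈ T.openDom c₁ c₂,
      T.cover (T.piecePt c₁ c₂ i j z) ∈ T.coball := fun c₁ c₂ h i j z hz =>
    (h.piecePt_mem i j (ClassicalLBT.openDom_subset hz)).1
  rcases hμ with hμ | hμ
  · refine ClassicalLBT.eq_zero_of_hasRadonTransform hK hR (w := fun _ => 1) (κ := fun _ _ => 1)
      continuous_const (fun _ => one_ne_zero) (fun _ _ _ => one_ne_zero)
      fun c₁ c₂ h i j z hz => ?_
    rw [hμ _ (hc c₁ c₂ h i j z hz), one_mul]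
  · have h1 := T.smooth₁.continuous
    have h2 := T.smooth₂.continuous
    refine ClassicalLBT.eq_zero_of_hasRadonTransform hK hR
      (w := fun z => √(ClassicalLBT.Pi3 (T.φ₁ z.1) (T.φ₂ z.2) T.ν₃))
      (κ := fun c₁ c₂ => (√(ClassicalLBT.quad c₁ c₂ T.ν₃))⁻¹) ?_
      (fun z => (Real.sqrt_pos.2 (ClassicalLBT.Pi3_pos _ _)).ne')
      (fun c₁ c₂ h => inv_ne_zero (Real.sqrt_pos.2 h.ν₃_pos).ne') fun c₁ c₂ h i j z hz => ?_
    · unfold ClassicalLBT.Pi3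
      fun_prop
    · rw [hμ _ (hc c₁ c₂ h i j z hz), ClassicalLBT.normalPairing_piecePt h i j hz]
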